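/- Infinite draughts is played on the dark squares of the infinite checkerboard, that is, on the squares $(x,y)\in\mathbb Z^2$ with $x+y$ even. A position is an arbitrary (possibly infinite) arrangement of red and black pawns and kings on dark squares, together with the player, Red or Black, whose turn it is. Black pawns move and jump only upward, red pawns only downward, and kings both ways. We consider the variant with neither the forced-jump rule nor the forced-iterated-jump rule: on their turn a player uses one of their own pieces either to make a simple move to a diagonally adjacent empty square, or to make an iterated jump. In each single jump of an iterated jump, the piece jumps diagonally over an adjacent enemy piece to the empty square just beyond it, and the enemy piece is removed immediately. An iterated jump consists of one or more jumps by the same piece and counts as a single turn; the player may stop after any of the jumps, even when further jumps are possible, and jumping is never obligatory. Infinite iterated jumps are also allowed; after one, all the jumped pieces and also the jumping piece itself are gone from the board. A player who has no legal move on their turn loses, and infinite play is a draw. Game values for Red are defined by transfinite recursion: a position in which Red has already won (Black is to move and has no legal move) has value $0$; if it is Red's turn and she can move to some position having a value, then the value of the position is $\alpha+1$, where $\alpha$ is the smallest value of a position to which she can move; if it is Black's turn and every position to which he can move has a value, then the value is the supremum of these values; other positions have no value. Theorem. In this variant of infinite draughts, every countable ordinal is the game value for Red of some position. -/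

import Mathlib

namespace InfiniteDraughts

/-! ### Open games and ordinal game values -/

/-- A two-player game of perfect information, seen from the perspective of one of the players, the
open player.  `Won p` says that at `p` the game is already won for the open player. -/
structure OpenGame (Pos : Type) where
  Move : Pos → Pos → Prop
  OpenTurn : Pos → Prop
  Won : Pos → Prop

/-- `G.ValueAtMost p α`: the position `p` has a game value, and this value is at most `α`. -/
inductive OpenGame.ValueAtMost {Pos : Type} (G : OpenGame Pos) : Pos → Ordinal.{0} → Prop
  | won {p : Pos} {α : Ordinal.{0}} (h : G.Won p) : G.ValueAtMost p α
  | openMove {p q : Pos} {α β : Ordinal.{0}} (hp : G.OpenTurn p) (hpq : G.Move p q)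
      (hq : G.ValueAtMost q β) (hβ : β < α) : G.ValueAtMost p α
  | closedMove {p : Pos} {α : Ordinal.{0}} (hp : ¬ G.OpenTurn p)
      (hq : ∀ q, G.Move p q → G.ValueAtMost q α) : G.ValueAtMost p α

/-- `G.HasGameValue p α`: the position `p` has ordinal game value `α` for the open player.
The defining recursive clauses are in `OpenGame.hasGameValue_iff`. -/
def OpenGame.HasGameValue {Pos : Type} (G : OpenGame Pos) (p : Pos) (α : Ordinal.{0}) : Prop :=
  IsLeast {β | G.ValueAtMost p β} α

theorem OpenGame.ValueAtMost.mono {Pos : Type} {G : OpenGame Pos} {p : Pos} {α β : Ordinal.{0}}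
    (h : G.ValueAtMost p α) (hαβ : α ≤ β) : G.ValueAtMost p β := by
  induction h generalizing β with
  | won h => exact .won h
  | openMove hp hpq hq hβ _ => exact .openMove hp hpq hq (hβ.trans_le hαβ)
  | closedMove hp _ ih => exact .closedMove hp fun q hq => ih q hq hαβ

theorem OpenGame.ValueAtMost.exists_value {Pos : Type} {G : OpenGame Pos} {p : Pos}
    {α : Ordinal.{0}} (h : G.ValueAtMost p α) : ∃ β ≤ α, G.HasGameValue p β :=
  ⟨sInf {β | G.ValueAtMost p β}, csInf_le' h, csInf_mem ⟨α, h⟩, fun _ hγ => csInf_le' hγ⟩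

/-- The recursive clauses that define game values:
* if the game is already won for the open player, the value is `0`;
* otherwise, on the open player's turn, the value is the successor of the smallest value
  among the positions to which the open player can move;
* otherwise, on the closed player's turn, the value is the supremum of the values of the positions
  to which there is a legal move, provided that all of these have a value. -/
theorem OpenGame.hasGameValue_iff {Pos : Type} (G : OpenGame Pos) (p : Pos) (α : Ordinal.{0}) :
    G.HasGameValue p α ↔
      (G.Won p ∧ α = 0) ∨
      (¬ G.Won p ∧ G.OpenTurn p ∧
        ∃ β, IsLeast {γ | ∃ q, G.Move p q ∧ G.HasGameValue q γ} β ∧ α = Order.succ β) ∨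
      (¬ G.Won p ∧ ¬ G.OpenTurn p ∧ (∀ q, G.Move p q → ∃ γ, G.HasGameValue q γ) ∧
        IsLUB {γ | ∃ q, G.Move p q ∧ G.HasGameValue q γ} α) := by
  by_cases hw : G.Won p
  · have h0 : IsLeast {β | G.ValueAtMost p β} 0 := ⟨.won hw, fun _ _ => zero_le⟩
    simp only [hw, not_true_eq_false, false_and, or_false, true_and]
    exact ⟨fun h => IsLeast.unique h h0, fun h => h ▸ h0⟩
  by_cases ho : G.OpenTurn p
  · have key : ∀ δ, G.ValueAtMost p δ ↔ ∃ γ < δ, ∃ q, G.Move p q ∧ G.HasGameValue q γ := by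
      intro δ
      constructor
      · intro h
        cases h with
        | won h => exact absurd h hw
        | openMove _ hpq hq hβ =>
          obtain ⟨γ, hγ, hv⟩ := hq.exists_value
          exact ⟨γ, hγ.trans_lt hβ, _, hpq, hv⟩
        | closedMove h _ => exact absurd ho h
      · rintro ⟨γ, hγ, q, hpq, hv⟩
        exact .openMove ho hpq hv.1 hγ
    simp only [hw, ho, false_and, not_false_eq_true, true_and, false_or, not_true_eq_false,
      or_false]
    constructor
    · intro h
      obtain ⟨γ, hγ, q, hpq, hv⟩ := (key α).1 h.1
      have hα : α = Order.succ γ :=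
        le_antisymm (h.2 ((key _).2 ⟨γ, Order.lt_succ γ, q, hpq, hv⟩)) (Order.succ_le_of_lt hγ)
      refine ⟨γ, ⟨⟨q, hpq, hv⟩, ?_⟩, hα⟩
      rintro δ ⟨r, hr, hrv⟩
      have := h.2 ((key _).2 ⟨δ, Order.lt_succ δ, r, hr, hrv⟩)
      rw [hα] at this
      exact Order.succ_le_succ_iff.1 this
    · rintro ⟨β, ⟨hβ, hmin⟩, rfl⟩
      refine ⟨(key _).2 ⟨β, Order.lt_succ β, hβ⟩, ?_⟩
      intro δ hδ
      obtain ⟨γ, hγ, hq⟩ := (key δ).1 hδ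
      exact Order.succ_le_of_lt ((hmin hq).trans_lt hγ)
  · have key : ∀ δ, G.ValueAtMost p δ ↔ ∀ q, G.Move p q → ∃ γ ≤ δ, G.HasGameValue q γ := by
      intro δ
      constructor
      · intro h q hpq
        cases h with
        | won h => exact absurd h hw
        | openMove h _ _ _ => exact absurd h ho
        | closedMove _ hq => exact (hq q hpq).exists_value
      · intro h
        refine .closedMove ho fun q hpq => ?_
        obtain ⟨γ, hγ, hv⟩ := h q hpq
        exact hv.1.mono hγ
    have key' : (∀ q, G.Move p q → ∃ γ, G.HasGameValue q γ) →
        ∀ δ, G.ValueAtMost p δ ↔ δ ∈ upperBounds {γ | ∃ q, G.Move p q ∧ G.HasGameValue q γ} := by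
      intro hval δ
      rw [key]
      constructor
      · rintro h γ ⟨q, hpq, hv⟩
        obtain ⟨γ', hγ', hv'⟩ := h q hpq
        rwa [IsLeast.unique hv hv']
      · intro h q hpq
        obtain ⟨γ, hv⟩ := hval q hpq
        exact ⟨γ, h ⟨q, hpq, hv⟩, hv⟩
    simp only [hw, ho, false_and, not_false_eq_true, true_and, false_or]
    constructor
    · intro h
      have hval : ∀ q, G.Move p q → ∃ γ, G.HasGameValue q γ := fun q hpq =>
        let ⟨γ, _, hv⟩ := (key α).1 h.1 q hpq
        ⟨γ, hv⟩
      exact ⟨hval, (key' hval α).1 h.1, fun δ hδ => h.2 ((key' hval δ).2 hδ)⟩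
    · rintro ⟨hval, hub, hlub⟩
      exact ⟨(key' hval α).2 hub, fun δ hδ => hlub ((key' hval δ).1 hδ)⟩

/-! ### Infinite draughts without forced-jump rules -/

inductive Player
  | red
  | black

def Player.other : Player → Player
  | .red => .black
  | .black => .red

inductive PieceKind
  | pawn
  | king

structure Piece where
  owner : Player
  kind : PieceKind

/-- Squares of the infinite board; the first coordinate increases to the right and the second one
upward.  The dark squares are those with even coordinate sum. -/
abbrev Square := ℤ × ℤ

/-- A board configuration; `none` marks an empty square. -/
abbrev Board := Square → Option Piece

/-- All pieces stand on dark squares. -/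
def Board.OnDark (b : Board) : Prop := ∀ s, b s ≠ none → Even (s.1 + s.2)

/-- `a.Heads d`: the piece `a` may move or jump along the unit diagonal vector `d`.  Black pawns go
upward only, red pawns downward only, kings both ways. -/
def Piece.Heads (a : Piece) (d : ℤ × ℤ) : Prop :=
  (d.1 = 1 ∨ d.1 = -1) ∧
    match a.kind, a.owner with
    | .king, _ => d.2 = 1 ∨ d.2 = -1
    | .pawn, .black => d.2 = 1
    | .pawn, .red => d.2 = -1

/-- `SimpleMove a s b b'`: the piece `a`, standing on `s`, moves to an adjacent empty square. -/
def SimpleMove (a : Piece) (s : Square) (b b' : Board) : Prop :=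
  ∃ d, a.Heads d ∧ b (s + d) = none ∧
    b' = Function.update (Function.update b s none) (s + d) (some a)

/-- `JumpStep a c x y`: the piece `a`, standing on the square `x.2` of the board `x.1`, jumps over
an enemy piece on the square `c` to the empty square `y.2` just beyond.  The enemy piece is removed
immediately, which gives the board `y.1`. -/
def JumpStep (a : Piece) (c : Square) (x y : Board × Square) : Prop :=
  ∃ d, a.Heads d ∧ c = x.2 + d ∧ (∃ e, x.1 c = some e ∧ e.owner ≠ a.owner) ∧
    x.1 (c + d) = none ∧ y.2 = c + d ∧
    y.1 = Function.update (Function.update (Function.update x.1 x.2 none) c none) (c + d) (some a)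

/-- A finite iterated jump of `a` from `s`: at least one jump, stopping at any point. -/
def FiniteJump (a : Piece) (s : Square) (b b' : Board) : Prop :=
  ∃ s', Relation.TransGen (fun x y => ∃ c, JumpStep a c x y) (b, s) (b', s')

/-- An infinite iterated jump of `a` from `s`, jumping over the squares `c 0, c 1, …` in succession:
all jumped pieces are removed, and so is the jumping piece itself. -/
def InfiniteJump (a : Piece) (s : Square) (b b' : Board) : Prop :=
  ∃ (x : ℕ → Board × Square) (c : ℕ → Square),
    x 0 = (b, s) ∧ (∀ n, JumpStep a (c n) (x n) (x (n + 1))) ∧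
    b' s = none ∧ (∀ n, b' (c n) = none) ∧ ∀ t, t ≠ s → (∀ n, t ≠ c n) → b' t = b t

/-- The turns that the player `P` can make on the board `b` when there is no forced-jump rule and no
forced-iterated-jump rule. -/
def BoardMove (P : Player) (b b' : Board) : Prop :=
  ∃ a s, b s = some a ∧ a.owner = P ∧
    (SimpleMove a s b b' ∨ FiniteJump a s b b' ∨ InfiniteJump a s b b')

/-- A position: an arbitrary, possibly infinite, arrangement of pieces on the dark squares, together
with the player whose turn it is. -/
structure Position where
  board : Board
  onDark : board.OnDark
  turn : Player

def LegalMove (p q : Position) : Prop :=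
  BoardMove p.turn p.board q.board ∧ q.turn = p.turn.other

/-- Infinite draughts with neither the forced-jump nor the forced-iterated-jump rule, as an open
game for the player `P`: a player without a legal move on their turn has lost, and infinite play is
a draw. -/
def noForcedJumpDraughts (P : Player) : OpenGame Position where
  Move := LegalMove
  OpenTurn p := p.turn = P
  Won p := p.turn ≠ P ∧ ∀ q, ¬ LegalMove p q

theorem Piece.Heads.even {a : Piece} {d : ℤ × ℤ} (h : a.Heads d) : Even (d.1 + d.2) := by
  obtain ⟨h1, h2⟩ := h
  have h3 : d.2 = 1 ∨ d.2 = -1 := by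
    split at h2
    · exact h2
    · exact .inl h2
    · exact .inr h2
  rcases h1 with h1 | h1 <;> rcases h3 with h3 | h3 <;> rw [h1, h3] <;> decide

/-- Moves never leave the dark squares. -/
theorem BoardMove.onDark {P : Player} {b b' : Board} (h : BoardMove P b b') (hb : b.OnDark) :
    b'.OnDark := by
  have hstep : ∀ (a : Piece) (c : Square) (x y : Board × Square), JumpStep a c x y →
      x.1.OnDark ∧ Even (x.2.1 + x.2.2) → y.1.OnDark ∧ Even (y.2.1 + y.2.2) := by
    rintro a c x y ⟨d, hd, rfl, -, -, hy2, hy1⟩ ⟨hx, hs⟩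
    have hd' := hd.even
    have he : Even ((x.2 + d + d).1 + (x.2 + d + d).2) := by
      have : (x.2 + d + d).1 + (x.2 + d + d).2
          = (x.2.1 + x.2.2) + (d.1 + d.2) + (d.1 + d.2) := by
        simp only [Prod.fst_add, Prod.snd_add]; ring
      rw [this]
      exact (hs.add hd').add hd'
    refine ⟨?_, hy2 ▸ he⟩
    intro t ht
    rw [hy1] at ht
    simp only [Function.update_apply] at ht
    split_ifs at ht with h1 h2 h3
    · exact h1 ▸ he
    · exact absurd rfl ht
    · exact absurd rfl ht
    · exact hx t ht
  obtain ⟨a, s, hs, -, hm⟩ := h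
  have hse : Even (s.1 + s.2) := hb s (by rw [hs]; exact Option.some_ne_none a)
  rcases hm with ⟨d, hd, -, rfl⟩ | ⟨s', hj⟩ | ⟨x, c, -, -, h1, h2, h3⟩
  · intro t ht
    simp only [Function.update_apply] at ht
    split_ifs at ht with h1 h2
    · have : t.1 + t.2 = (s.1 + s.2) + (d.1 + d.2) := by
        rw [h1]; simp only [Prod.fst_add, Prod.snd_add]; ring
      rw [this]
      exact hse.add hd.even
    · exact absurd rfl ht
    · exact hb t ht
  · have : ∀ y, Relation.TransGen (fun x y => ∃ c, JumpStep a c x y) (b, s) y →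
        y.1.OnDark ∧ Even (y.2.1 + y.2.2) := by
      intro y hy
      induction hy with
      | single h => exact hstep a _ _ _ h.choose_spec ⟨hb, hse⟩
      | tail _ h ih => exact hstep a _ _ _ h.choose_spec ih
    exact (this _ hj).1
  · intro t ht
    by_cases hts : t = s
    · exact absurd (hts ▸ h1) ht
    by_cases htc : ∃ n, t = c n
    · obtain ⟨n, rfl⟩ := htc
      exact absurd (h2 n) ht
    · exact hb t (h3 t hts (fun n hn => htc ⟨n, hn⟩) ▸ ht)

end InfiniteDraughts

namespace InfiniteDraughts

/-! The position consists of pawns only. In diagonal coordinates black pawns go in the directions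
(1,0) and (0,1), red ones the opposite way. A jump moves by two squares and preserves the parities
of both coordinates, so a row of empty squares at distance two in a sea of red pawns is a road for
an iterated jump.

A well-founded tree of ranks at most `α` is laid out with such roads. A node of rank `ρ` has an
endless corridor whose `n`-th exit leads to a node of rank `listing ρ n < ρ`. At the end of an exit
two black tokens are walled in. A pawn that runs to the very end jumps over one guard of each of
them and so releases both; each token then stands at the beginning of its own copy of the corridor
of the new node. In the initial position the first token of an exit of rank `α` is released.

A value exists (`Alive.exists_valueAtMost`, induction on the rank): the released token is Black's
only mobile piece. Wherever it stops, Red takes it from straight ahead (`Runner.locked_of_capture`,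
`Ending.alive_of_capture`). Then either all of Black is blocked, or just the first token of an exit
of smaller rank is released; if both tokens had been released, the capturing pawn lands on the
release square of the second. If the jump is infinite, the token is gone, and Red wins with a spare
move.

The value is at least `α` (`le_of_valueAtMost`, again by induction): Black can run to the end of an
exit of any prescribed smaller rank (`exists_twin`). The two tokens released there use disjoint
parts of the board, so one turn of Red cannot stop both (`Twin.red_move`), and Black goes on with
the other.

The exact value is not computed. Since the values that occur form an initial segment, `α` is a value
too. To fit all the roads into the plane, they follow a binary tree of square cells in which no cell
has two predecessors. -/

/-- The game values that occur form an initial segment. -/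
theorem OpenGame.HasGameValue.exists_of_le {Pos : Type} {G : OpenGame Pos} {p : Pos}
    {γ β : Ordinal.{0}} (h : G.HasGameValue p γ) (hβ : β ≤ γ) : ∃ q, G.HasGameValue q β := by
  have key : ∀ {p : Pos} {α : Ordinal.{0}}, G.ValueAtMost p α → ∀ γ, G.HasGameValue p γ →
      ∀ β ≤ γ, ∃ q, G.HasGameValue q β := by
    intro p α hv
    induction hv with
    | @won p α hw =>
      intro γ hγ β hβ
      have : γ ≤ 0 := hγ.2 (.won hw)
      have h0 : γ = β := by
        rw [le_antisymm this zero_le, eq_comm]; exact le_antisymm (hβ.trans this) zero_le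
      exact ⟨p, h0 ▸ hγ⟩
    | @openMove p q α δ hp hpq hq hδ ih =>
      intro γ hγ β hβ
      rcases hβ.eq_or_lt with rfl | hlt
      · exact ⟨p, hγ⟩
      obtain ⟨ε, -, hε⟩ := hq.exists_value
      -- The move to `q` need not be optimal, but it bounds `γ` by the successor of the value `ε` of
      -- `q`; hence everything below `γ` is at most `ε`.
      have h1 : γ ≤ Order.succ ε := hγ.2 (.openMove hp hpq hε.1 (Order.lt_succ ε))
      exact ih ε hε β (Order.lt_succ_iff.1 (hlt.trans_le h1))
    | @closedMove p α hp hq ih =>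
      intro γ hγ β hβ
      rcases hβ.eq_or_lt with rfl | hlt
      · exact ⟨p, hγ⟩
      -- If `β` did not occur, then by induction no option of the closed player could have a value
      -- above `β`, so the value of `p` would be at most `β`.
      by_contra hcon
      have : G.ValueAtMost p β := by
        refine .closedMove hp fun q hpq => ?_
        obtain ⟨ε, -, hε⟩ := (hq q hpq).exists_value
        refine hε.1.mono ?_
        by_contra hlt'
        exact hcon (ih q hpq ε hε β (not_le.1 hlt').le)
      exact absurd (hγ.2 this) (not_le.2 hlt)
  exact key h.1 γ h β hβ

/-- If every move of the closed player leads to a position with a value, so has the position. -/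
theorem OpenGame.exists_valueAtMost_of_closed {Pos : Type} {G : OpenGame Pos} {p : Pos}
    (hp : ¬ G.OpenTurn p) (h : ∀ q, G.Move p q → ∃ γ, G.ValueAtMost q γ) :
    ∃ γ, G.ValueAtMost p γ := by
  choose! g hg using h
  -- Positions form a type in the lowest universe, so this supremum is an ordinal without any
  -- countability assumption on the options.
  refine ⟨⨆ q, g q, .closedMove hp fun q hq => (hg q hq).mono (Ordinal.le_iSup g q)⟩

/-! ### Boards on which all pieces are pawns, in diagonal coordinates -/

/-- Kings are not needed, and no rule promotes a pawn, so boards of pawns are closed under moves. -/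
inductive Mark
  | empty
  | red
  | black

def Mark.toPiece : Mark → Option Piece
  | .empty => none
  | .red => some ⟨.red, .pawn⟩
  | .black => some ⟨.black, .pawn⟩

abbrev Pt := ℤ × ℤ

abbrev Grid := Pt → Mark

def Player.mark : Player → Mark
  | .red => .red
  | .black => .black

/-- The directions of a pawn in diagonal coordinates. -/
def Player.Step : Player → Pt → Prop
  | .red, e => e = (-1, 0) ∨ e = (0, -1)
  | .black, e => e = (1, 0) ∨ e = (0, 1)

/-- The dark square with given diagonal coordinates. -/
def tilt (p : Pt) : Square := (p.1 - p.2, p.1 + p.2)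

/-- On dark squares both divisions are exact and invert `tilt`. -/
def Grid.toBoard (f : Grid) : Board := fun s =>
  if Even (s.1 + s.2) then (f ((s.1 + s.2) / 2, (s.2 - s.1) / 2)).toPiece else none

def Grid.toPosition (f : Grid) (P : Player) : Position where
  board := f.toBoard
  onDark s hs := by
    by_contra h
    exact hs (by simp [Grid.toBoard, h])
  turn := P

theorem tilt_add (p q : Pt) : tilt (p + q) = tilt p + tilt q := by
  ext <;> simp [tilt] <;> ring

theorem tilt_injective : Function.Injective tilt := by
  rintro ⟨a, b⟩ ⟨c, d⟩ h
  simp only [tilt, Prod.mk.injEq] at h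
  ext <;> simp <;> omega

theorem Grid.toBoard_tilt (f : Grid) (p : Pt) : f.toBoard (tilt p) = (f p).toPiece := by
  obtain ⟨a, b⟩ := p
  have h1 : Even ((tilt (a, b)).1 + (tilt (a, b)).2) := ⟨a, by simp [tilt]⟩
  have h2 : ((tilt (a, b)).1 + (tilt (a, b)).2) / 2 = a := by simp [tilt]; omega
  have h3 : ((tilt (a, b)).2 - (tilt (a, b)).1) / 2 = b := by simp [tilt]; omega
  simp only [Grid.toBoard]
  rw [if_pos h1, h2, h3]

theorem exists_tilt {s : Square} (h : Even (s.1 + s.2)) : ∃ p, s = tilt p := by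
  refine ⟨((s.1 + s.2) / 2, (s.2 - s.1) / 2), ?_⟩
  obtain ⟨k, hk⟩ := h
  ext <;> simp [tilt] <;> omega

theorem Grid.toBoard_off (f : Grid) {s : Square} (h : ¬ Even (s.1 + s.2)) :
    f.toBoard s = none := by
  simp [Grid.toBoard, h]

theorem even_tilt (p : Pt) : Even ((tilt p).1 + (tilt p).2) := ⟨p.1, by simp [tilt]⟩

theorem Grid.toBoard_update (f : Grid) (p : Pt) (m : Mark) :
    Grid.toBoard (Function.update f p m) = Function.update f.toBoard (tilt p) m.toPiece := by
  funext s
  by_cases h : Even (s.1 + s.2)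
  · obtain ⟨q, rfl⟩ := exists_tilt h
    rw [Grid.toBoard_tilt]
    by_cases hq : q = p
    · subst hq; simp
    · rw [Function.update_of_ne hq, Function.update_of_ne (fun h => hq (tilt_injective h)),
        Grid.toBoard_tilt]
  · rw [Grid.toBoard_off _ h, Function.update_of_ne, Grid.toBoard_off _ h]
    rintro rfl
    exact h (even_tilt p)

@[simp] theorem Mark.toPiece_eq_none {m : Mark} : m.toPiece = none ↔ m = .empty := by
  cases m <;> simp [Mark.toPiece]

theorem Player.toPiece_mark (P : Player) : P.mark.toPiece = some ⟨P, .pawn⟩ := by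
  cases P <;> rfl

theorem Mark.toPiece_eq_some {m : Mark} {a : Piece} (h : m.toPiece = some a) :
    a = ⟨a.owner, .pawn⟩ ∧ m = a.owner.mark := by
  cases m <;> simp [Mark.toPiece] at h <;> subst h <;> exact ⟨rfl, rfl⟩

theorem heads_pawn_iff {P : Player} {d : ℤ × ℤ} :
    (⟨P, .pawn⟩ : Piece).Heads d ↔ ∃ e, P.Step e ∧ d = tilt e := by
  obtain ⟨a, b⟩ := d
  cases P
  · simp only [Piece.Heads, Player.Step, tilt]
    constructor
    · rintro ⟨rfl | rfl, rfl⟩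
      · exact ⟨(0, -1), by simp⟩
      · exact ⟨(-1, 0), by simp⟩
    · rintro ⟨e, rfl | rfl, h⟩ <;> simp_all
  · simp only [Piece.Heads, Player.Step, tilt]
    constructor
    · rintro ⟨rfl | rfl, rfl⟩
      · exact ⟨(1, 0), by simp⟩
      · exact ⟨(0, 1), by simp⟩
    · rintro ⟨e, rfl | rfl, h⟩ <;> simp_all

/-! ### Moves in diagonal coordinates -/

/-- The grid after a pawn of `P` on `p` has jumped in direction `e`. -/
def Grid.jumped (f : Grid) (P : Player) (p e : Pt) : Grid :=
  Function.update (Function.update (Function.update f p .empty) (p + e) .empty) (p + e + e) P.mark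

/-- One jump of a pawn of `P`, over the square `c`. -/
def GridJump (P : Player) (c : Pt) (x y : Grid × Pt) : Prop :=
  ∃ e, P.Step e ∧ c = x.2 + e ∧ x.1 c = P.other.mark ∧ x.1 (c + e) = .empty ∧
    y = (x.1.jumped P x.2 e, c + e)

def GridMove (P : Player) (f f' : Grid) : Prop :=
  ∃ p, f p = P.mark ∧
    ((∃ e, P.Step e ∧ f (p + e) = .empty ∧
        f' = Function.update (Function.update f p .empty) (p + e) P.mark) ∨
      (∃ p', Relation.TransGen (fun x y => ∃ c, GridJump P c x y) (f, p) (f', p')) ∨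
      (∃ (x : ℕ → Grid × Pt) (c : ℕ → Pt), x 0 = (f, p) ∧
        (∀ n, GridJump P (c n) (x n) (x (n + 1))) ∧
        f' p = .empty ∧ (∀ n, f' (c n) = .empty) ∧
        ∀ t, t ≠ p → (∀ n, t ≠ c n) → f' t = f t))

def boardOf (x : Grid × Pt) : Board × Square := (x.1.toBoard, tilt x.2)

theorem other_mark_iff {P : Player} {m : Mark} :
    (∃ e, m.toPiece = some e ∧ e.owner ≠ P) ↔ m = P.other.mark := by
  cases P <;> cases m <;> simp [Mark.toPiece, Player.mark, Player.other]

/-- The target `y` is arbitrary: besides translating jumps, the equivalence shows that a jump from a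
pawn board ends on a pawn board, which allows sequences of jumps to be lifted step by step. -/
theorem jumpStep_iff {P : Player} {c : Square} {x : Grid × Pt} {y : Board × Square} :
    JumpStep ⟨P, .pawn⟩ c (boardOf x) y ↔
      ∃ c' y', GridJump P c' x y' ∧ c = tilt c' ∧ y = boardOf y' := by
  constructor
  · rintro ⟨d, hd, rfl, h1, h2, h3, h4⟩
    obtain ⟨e, he, rfl⟩ := heads_pawn_iff.1 hd
    simp only [boardOf, ← tilt_add, Grid.toBoard_tilt] at h1 h2 h3 h4 ⊢
    refine ⟨x.2 + e, _, ⟨e, he, rfl, other_mark_iff.1 h1, Mark.toPiece_eq_none.1 h2, rfl⟩,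
      rfl, ?_⟩
    refine Prod.ext ?_ h3
    rw [h4]
    simp only [Grid.jumped, Grid.toBoard_update, Player.toPiece_mark]
    rfl
  · rintro ⟨c', y', ⟨e, he, rfl, h1, h2, rfl⟩, rfl, rfl⟩
    refine ⟨tilt e, heads_pawn_iff.2 ⟨e, he, rfl⟩, by simp [boardOf, tilt_add], ?_, ?_, ?_, ?_⟩
    · simp only [boardOf, Grid.toBoard_tilt]; exact other_mark_iff.2 h1
    · simp only [boardOf, ← tilt_add, Grid.toBoard_tilt]; exact Mark.toPiece_eq_none.2 h2
    · simp only [boardOf, ← tilt_add]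
    · simp only [boardOf, ← tilt_add, Grid.jumped, Grid.toBoard_update, Player.toPiece_mark]
      rfl

/-- Since `q` is arbitrary here, no move leaves the class of pawn positions, and the rest of the
argument can work with grids alone. -/
theorem legalMove_iff {P : Player} {f : Grid} {q : Position} :
    LegalMove (f.toPosition P) q ↔ ∃ f', GridMove P f f' ∧ q = f'.toPosition P.other := by
  have transfer : ∀ {f' : Grid}, BoardMove P f.toBoard f'.toBoard →
      (LegalMove (f.toPosition P) (f'.toPosition P.other)) := fun h => ⟨h, rfl⟩
  constructor
  · rintro ⟨⟨a, s, hs, ha, hm⟩, hturn⟩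
    obtain ⟨qb, qd, qt⟩ := q
    simp only [Grid.toPosition] at hs ha hm hturn
    subst hturn
    suffices h : ∃ f', GridMove P f f' ∧ qb = f'.toBoard by
      obtain ⟨f', h1, rfl⟩ := h
      exact ⟨f', h1, rfl⟩
    have hse : Even (s.1 + s.2) := by
      by_contra h
      rw [Grid.toBoard_off _ h] at hs
      cases hs
    obtain ⟨p, rfl⟩ := exists_tilt hse
    rw [Grid.toBoard_tilt] at hs
    obtain ⟨hk, hfp⟩ := Mark.toPiece_eq_some hs
    rw [ha] at hk hfp
    subst hk
    rcases hm with ⟨d, hd, h1, rfl⟩ | ⟨s', hj⟩ | ⟨x, c, hx0, hx, h1, h2, h3⟩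
    · obtain ⟨e, he, rfl⟩ := heads_pawn_iff.1 hd
      rw [← tilt_add, Grid.toBoard_tilt] at h1
      refine ⟨_, ⟨p, hfp, .inl ⟨e, he, Mark.toPiece_eq_none.1 h1, rfl⟩⟩, ?_⟩
      rw [Grid.toBoard_update, Grid.toBoard_update, Player.toPiece_mark, tilt_add]
      rfl
    · have key : ∀ y, Relation.TransGen (fun x y => ∃ c, JumpStep ⟨P, .pawn⟩ c x y)
          (f.toBoard, tilt p) y → ∃ y', Relation.TransGen (fun x y => ∃ c, GridJump P c x y)
            (f, p) y' ∧ y = boardOf y' := by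
        intro y hy
        induction hy with
        | single h =>
          obtain ⟨c, h⟩ := h
          obtain ⟨c', y', hc, -, rfl⟩ := (jumpStep_iff (x := (f, p))).1 h
          exact ⟨y', .single ⟨c', hc⟩, rfl⟩
        | tail _ h ih =>
          obtain ⟨z, hz, rfl⟩ := ih
          obtain ⟨c, h⟩ := h
          obtain ⟨c', y', hc, -, rfl⟩ := jumpStep_iff.1 h
          exact ⟨y', hz.tail ⟨c', hc⟩, rfl⟩
      obtain ⟨⟨f', p'⟩, h, he⟩ := key _ hj
      refine ⟨f', ⟨p, hfp, .inr (.inl ⟨p', h⟩)⟩, ?_⟩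
      simpa [boardOf] using congrArg Prod.fst he
    · have hnext : ∀ z : Grid × Pt, ∀ n, boardOf z = x n →
          ∃ c' z', GridJump P c' z z' ∧ c n = tilt c' ∧ x (n + 1) = boardOf z' := by
        intro z n hz
        have := hx n
        rw [← hz] at this
        exact jumpStep_iff.1 this
      choose! C Z hCZ using hnext
      let g : ℕ → Grid × Pt := fun n => Nat.rec (f, p) (fun n z => Z z n) n
      have hg : ∀ n, boardOf (g n) = x n := by
        intro n
        induction n with
        | zero => exact hx0.symm
        | succ n ih => exact (hCZ (g n) n ih).2.2.symm
      have hq : ∀ s, qb s ≠ none → Even (s.1 + s.2) := qd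
      classical
      refine ⟨fun t => if t = p ∨ ∃ n, t = C (g n) n then .empty else f t, ⟨p, hfp,
        .inr (.inr ⟨g, fun n => C (g n) n, rfl, fun n => (hCZ (g n) n (hg n)).1, by simp,
          fun n => if_pos (.inr ⟨n, rfl⟩), fun t ht htn => ?_⟩)⟩, ?_⟩
      · refine if_neg ?_
        rintro (h | ⟨n, h⟩)
        exacts [ht h, htn n h]
      · funext s
        by_cases hs' : Even (s.1 + s.2)
        · obtain ⟨t, rfl⟩ := exists_tilt hs'
          rw [Grid.toBoard_tilt]
          split_ifs with h
          · rcases h with rfl | ⟨n, rfl⟩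
            · exact h1
            · rw [← (hCZ (g n) n (hg n)).2.1]; exact h2 n
          · push Not at h
            rw [h3, Grid.toBoard_tilt]
            · exact fun h' => h.1 (tilt_injective h')
            · intro n h'
              rw [(hCZ (g n) n (hg n)).2.1] at h'
              exact h.2 n (tilt_injective h')
        · rw [Grid.toBoard_off _ hs']
          by_contra h
          exact hs' (hq s h)
  · rintro ⟨f', ⟨p, hp, hm⟩, rfl⟩
    refine transfer ⟨⟨P, .pawn⟩, tilt p, by rw [Grid.toBoard_tilt, hp, Player.toPiece_mark], rfl,
      ?_⟩
    rcases hm with ⟨e, he, h1, rfl⟩ | ⟨p', h⟩ | ⟨x, c, hx0, hx, h1, h2, h3⟩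
    · refine .inl ⟨tilt e, heads_pawn_iff.2 ⟨e, he, rfl⟩, ?_, ?_⟩
      · rw [← tilt_add, Grid.toBoard_tilt, h1]; rfl
      · rw [Grid.toBoard_update, Grid.toBoard_update, Player.toPiece_mark, tilt_add]; rfl
    · refine .inr (.inl ⟨tilt p', ?_⟩)
      exact Relation.TransGen.lift (p := fun x y => ∃ c, JumpStep ⟨P, .pawn⟩ c x y) boardOf
        (fun x y ⟨c, h⟩ => ⟨tilt c, jumpStep_iff.2 ⟨c, y, h, rfl, rfl⟩⟩) _ _ h
    · refine .inr (.inr ⟨fun n => boardOf (x n), fun n => tilt (c n), by simp [hx0, boardOf],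
        fun n => jumpStep_iff.2 ⟨_, _, hx n, rfl, rfl⟩, ?_, fun n => ?_, fun t ht htn => ?_⟩)
      · rw [Grid.toBoard_tilt, h1]; rfl
      · rw [Grid.toBoard_tilt, h2]; rfl
      · by_cases hte : Even (t.1 + t.2)
        · obtain ⟨t, rfl⟩ := exists_tilt hte
          rw [Grid.toBoard_tilt, Grid.toBoard_tilt, h3 t (fun h => ht (h ▸ rfl))
            (fun n h => htn n (h ▸ rfl))]
        · rw [Grid.toBoard_off _ hte, Grid.toBoard_off _ hte]

/-! ### A planar binary tree of cells -/

/-- The largest power of two that is at most `n`. -/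
def scale (n : ℕ) : ℕ := 2 ^ Nat.log 2 n

theorem scale_le {n : ℕ} (h : n ≠ 0) : scale n ≤ n := Nat.pow_log_le_self 2 h

theorem lt_two_mul_scale (n : ℕ) : n < 2 * scale n := by
  have := Nat.lt_pow_succ_log_self (b := 2) (by norm_num) n
  rw [pow_succ] at this
  rw [scale]; omega

theorem scale_eq {n k : ℕ} (h1 : 2 ^ k ≤ n) (h2 : n < 2 * 2 ^ k) : scale n = 2 ^ k := by
  rw [scale, (Nat.log_eq_iff (.inr ⟨by norm_num, by have := Nat.one_le_two_pow (n := k); omega⟩)).2]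
  exact ⟨h1, by rw [pow_succ]; omega⟩

theorem scale_succ {n : ℕ} (h : n ≠ 0) :
    n + 1 < 2 * scale n ∧ scale (n + 1) = scale n ∨
      n + 1 = 2 * scale n ∧ scale (n + 1) = n + 1 := by
  have h1 := scale_le h
  have h2 := lt_two_mul_scale n
  rcases Nat.lt_or_ge (n + 1) (2 * scale n) with h3 | h3
  · exact .inl ⟨h3, scale_eq (k := Nat.log 2 n) (by rw [scale] at h1; omega) h3⟩
  · have h4 : n + 1 = 2 ^ (Nat.log 2 n + 1) := by
      rw [pow_succ]; rw [scale] at h2 h3; omega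
    refine .inr ⟨by omega, ?_⟩
    rw [h4]
    exact scale_eq le_rfl (by have := Nat.one_le_two_pow (n := Nat.log 2 n + 1); omega)

/-- The tree continues from the cell `(u, w)` to the right. -/
def GoesR (u w : ℕ) : Prop := u + 2 * w ≤ 2 * scale (u + w)

/-- The tree continues from the cell `(u, w)` upward. -/
def GoesU (u w : ℕ) : Prop := 2 * scale (u + w) ≤ u + 2 * w

/-- The cell `(u, w)` is entered from the left. -/
def FromL (u w : ℕ) : Prop := 0 < u ∧ GoesR (u - 1) w

theorem goesR_or_goesU (u w : ℕ) : GoesR u w ∨ GoesU u w := le_total _ _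

/-- Both cells lie on one antidiagonal, so both conditions compare with the same scale, and `u + 2 *
(w + 1)` exceeds `(u + 1) + 2 * w` by exactly one. Consequently the cell `(u + 1, w + 1)` is entered
from exactly one side. -/
theorem goesR_iff_not_goesU (u w : ℕ) : GoesR u (w + 1) ↔ ¬ GoesU (u + 1) w := by
  simp only [GoesR, GoesU]
  rw [show u + 1 + w = u + (w + 1) by ring]
  omega

theorem fromL_succ {u w : ℕ} : FromL (u + 1) w ↔ GoesR u w := by simp [FromL]

theorem not_fromL_of_goesU {u w : ℕ} (h : GoesU u w) : ¬ FromL u (w + 1) := by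
  rintro ⟨h0, h1⟩
  obtain ⟨u, rfl⟩ : ∃ k, u = k + 1 := ⟨u - 1, by omega⟩
  exact (goesR_iff_not_goesU u w).1 h1 h

/-- A step to the right raises `u + 2 * w` by one, so the inequality survives unless it was an
equality, that is, unless the cell branches. For `w ≥ 2` the scale cannot double during such a step.
-/
theorem goesR_succ_iff {u w : ℕ} (hw : 2 ≤ w) (h : GoesR u w) :
    GoesR (u + 1) w ↔ ¬ GoesU u w := by
  simp only [GoesR, GoesU] at *
  rw [show u + 1 + w = u + w + 1 by ring]
  rcases scale_succ (n := u + w) (by omega) with ⟨h1, h2⟩ | ⟨h1, h2⟩ <;> rw [h2] <;> omega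

/-- Equality at `(u, w)` leaves a slack of one at `(u - 1, w)`, unless the scale has just doubled;
but then equality would force `u = 0`. Hence the end of an exit has to be designed for one
orientation only. -/
theorem fromL_of_branch {u w : ℕ} (hu : 1 ≤ u) (hw : 2 ≤ w) (hR : GoesR u w) (hU : GoesU u w) :
    FromL u w := by
  obtain ⟨u, rfl⟩ : ∃ k, u = k + 1 := ⟨u - 1, by omega⟩
  rw [fromL_succ]
  simp only [GoesR, GoesU] at *
  rw [show u + 1 + w = u + w + 1 by ring] at hR hU
  have h3 := lt_two_mul_scale (u + w + 1)
  rcases scale_succ (n := u + w) (by omega) with ⟨h1, h2⟩ | ⟨h1, h2⟩ <;> rw [h2] at hR hU h3 <;>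
    omega

/-! ### Ancestors and descendants in the tree of cells -/

inductive CellStep : ℕ × ℕ → ℕ × ℕ → Prop
  | right {u w : ℕ} (h : GoesR u w) : CellStep (u, w) (u + 1, w)
  | up {u w : ℕ} (h : GoesU u w) : CellStep (u, w) (u, w + 1)

theorem CellStep.left_unique {c c' d : ℕ × ℕ} (h : CellStep c d) (h' : CellStep c' d) :
    c = c' := by
  obtain ⟨u, w⟩ := c
  obtain ⟨u', w'⟩ := c'
  obtain ⟨x, y⟩ := d
  rcases h with @⟨_, _, h⟩ | @⟨_, _, h⟩ <;> cases h' with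
  | right h1 => first | rfl | exact absurd (fromL_succ.2 h1) (not_fromL_of_goesU h)
  | up h1 => first | rfl | exact absurd (fromL_succ.2 h) (not_fromL_of_goesU h1)

def Reach (c d : ℕ × ℕ) : Prop := Relation.ReflTransGen CellStep c d

theorem Reach.le {c d : ℕ × ℕ} (h : Reach c d) : c.1 ≤ d.1 ∧ c.2 ≤ d.2 := by
  induction h with
  | refl => simp
  | tail _ h ih => cases h <;> simp at * <;> omega

/-- Predecessors are unique, so the ancestors of a cell form a chain. -/
theorem Reach.total {c c' d : ℕ × ℕ} (h : Reach c d) (h' : Reach c' d) :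
    Reach c c' ∨ Reach c' c := by
  induction h with
  | refl => exact .inr h'
  | tail h1 h2 ih =>
    rcases Relation.ReflTransGen.cases_tail h' with rfl | ⟨e, he, hed⟩
    · exact .inl (h1.tail h2)
    · rw [hed.left_unique h2] at he
      exact ih he

/-- From every cell on there is a branching cell. -/
theorem cell_induction {motive : ℕ → ℕ → Prop}
    (branch : ∀ u w, 1 ≤ u → 2 ≤ w → GoesR u w → GoesU u w → motive u w)
    (right : ∀ u w, 1 ≤ u → 2 ≤ w → GoesR u w → ¬ GoesU u w → motive (u + 1) w → motive u w)
    (up : ∀ u w, 1 ≤ u → 2 ≤ w → ¬ GoesR u w → GoesU u w → motive u (w + 1) → motive u w)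
    (u w : ℕ) (hu : 1 ≤ u) (hw : 2 ≤ w) : motive u w := by
  -- While the path goes right the scale is constant, and the slack decreases by one at each step;
  -- the cell branches when it is zero.
  have hR : ∀ k u w, 1 ≤ u → 2 ≤ w → GoesR u w → 2 * scale (u + w) - (u + 2 * w) ≤ k →
      motive u w := by
    intro k
    induction k with
    | zero =>
      intro u w hu hw h1 h2
      exact branch u w hu hw h1 (by simp only [GoesR, GoesU] at *; omega)
    | succ k ih =>
      intro u w hu hw h1 h2
      by_cases h3 : GoesU u w
      · exact branch u w hu hw h1 h3
      refine right u w hu hw h1 h3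
        (ih (u + 1) w (by omega) hw ((goesR_succ_iff hw h1).2 h3) ?_)
      simp only [GoesR, GoesU] at *
      rw [show u + 1 + w = u + w + 1 by ring]
      rcases scale_succ (n := u + w) (by omega) with ⟨h1, h2⟩ | ⟨h1, h2⟩ <;> rw [h2] <;> omega
  -- While the path goes up, `u + w` approaches the next power of two. There `u + 2 * w ≤ 2 * (u +
  -- w)` lets it go right again.
  have hU : ∀ k u w, 1 ≤ u → 2 ≤ w → 2 * scale (u + w) - (u + w) ≤ k → motive u w := by
    intro k
    induction k with
    | zero =>
      intro u w hu hw h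
      have := lt_two_mul_scale (u + w)
      omega
    | succ k ih =>
      intro u w hu hw h
      by_cases h1 : GoesR u w
      · exact hR _ u w hu hw h1 le_rfl
      have h2 := (goesR_or_goesU u w).resolve_left h1
      refine up u w hu hw h1 h2 ?_
      rcases scale_succ (n := u + w) (by omega) with ⟨h3, h4⟩ | ⟨h3, h4⟩
      · refine ih u (w + 1) hu (by omega) ?_
        rw [show u + (w + 1) = u + w + 1 by ring, h4]; omega
      · refine hR _ u (w + 1) hu (by omega) ?_ le_rfl
        simp only [GoesR]
        rw [show u + (w + 1) = u + w + 1 by ring, h4]; omega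
  exact hU _ u w hu hw le_rfl

/-! ### States of the cells -/

open Classical in
/-- For a countable ordinal `ρ ≠ 0`, a list of the ordinals below `ρ`. -/
noncomputable def listing (ρ : Ordinal.{0}) : ℕ → Ordinal.{0} :=
  if h : ∃ g : ℕ → Ordinal.{0}, (∀ n, g n < ρ) ∧ ∀ σ < ρ, ∃ n, g n = σ then h.choose else fun _ => 0

theorem listing_lt {ρ : Ordinal.{0}} (h : ρ ≠ 0) (n : ℕ) : listing ρ n < ρ := by
  unfold listing
  split_ifs with h'
  · exact h'.choose_spec.1 n
  · exact pos_iff_ne_zero.2 h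

theorem exists_listing_eq {ρ σ : Ordinal.{0}} (hρ : ρ.card ≤ Cardinal.aleph0) (h : σ < ρ) :
    ∃ n, listing ρ n = σ := by
  have h' : ∃ g : ℕ → Ordinal.{0}, (∀ n, g n < ρ) ∧ ∀ σ < ρ, ∃ n, g n = σ := by
    have hc : (Set.Iio ρ).Countable := by
      rw [← Cardinal.le_aleph0_iff_set_countable, Cardinal.mk_Iio_ordinal]
      exact Cardinal.lift_le_aleph0.2 hρ
    obtain ⟨g, hg⟩ := hc.exists_eq_range ⟨σ, h⟩
    refine ⟨g, fun n => ?_, fun τ hτ => ?_⟩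
    · have : g n ∈ Set.Iio ρ := hg ▸ Set.mem_range_self n
      exact this
    · have : τ ∈ Set.range g := hg ▸ hτ
      exact this
  unfold listing
  rw [dif_pos h']
  exact h'.choose_spec.2 σ h

/-- The road that passes through a cell: none, or the corridor of a node of rank `ρ`, of which `n`
children have been passed, or an exit leading to a node of rank `ρ`.  The squares of the road on
which a pawn can land have coordinates congruent to `i` and `j` modulo two. -/
inductive CellState
  | dead
  | run (i j : ℕ) (ρ : Ordinal.{0}) (n : ℕ)
  | exit (i j : ℕ) (ρ : Ordinal.{0})

-- Meant for cells that go right, so `GoesU` says that the cell branches. In a corridor the right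
-- branch passes one more exit. At the end of an exit it becomes the corridor of the first token,
-- which runs on a row of the opposite parity.
open Classical in
noncomputable def CellState.right (u w : ℕ) (s : CellState) : CellState :=
  if GoesU u w then
    match s with
    | .dead => .dead
    | .run i j ρ n => .run i j ρ (n + 1)
    | .exit i j ρ => .run i (1 - j) ρ 0
  else s

-- Here `GoesR` says that the cell branches. The upward branch of a corridor is its next exit, or
-- nothing if the rank is 0. At the end of an exit it is the corridor of the second token, on a
-- column of the opposite parity.
open Classical in
noncomputable def CellState.up (u w : ℕ) (s : CellState) : CellState :=
  if GoesR u w then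
    match s with
    | .dead => .dead
    | .run i j ρ n => if ρ = 0 then .dead else .exit i j (listing ρ n)
    | .exit i j ρ => .run (1 - i) j ρ 0
  else s

-- The recursion follows the unique predecessor, so only descendants of `(4, 2)` carry roads. The
-- root branches because `scale 6 = 4`, so the exit placed there ends at once.
open Classical in
noncomputable def cellState (α : Ordinal.{0}) (u w : ℕ) : CellState :=
  if u = 4 ∧ w = 2 then .exit 0 0 α
  else if h : FromL u w then (cellState α (u - 1) w).right (u - 1) w
  else if h : 0 < w then (cellState α u (w - 1)).up u (w - 1)
  else .dead
termination_by u + w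
decreasing_by
  · have := h.1; omega
  · omega

variable {α : Ordinal.{0}}

theorem cellState_root : cellState α 4 2 = .exit 0 0 α := by
  rw [cellState]; simp

theorem scale_six : scale 6 = 4 := scale_eq (k := 2) (by norm_num) (by norm_num)

theorem goesR_root : GoesR 4 2 := by simp [GoesR, scale_six]

theorem goesU_root : GoesU 4 2 := by simp [GoesU, scale_six]

theorem cellState_le {u w : ℕ} (h : cellState α u w ≠ .dead) : 4 ≤ u ∧ 2 ≤ w := by
  induction hn : u + w using Nat.strong_induction_on generalizing u w with
  | _ n ih =>
    rw [cellState] at h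
    split_ifs at h with h1 h2 h3
    · omega
    · have h4 : cellState α (u - 1) w ≠ .dead := by
        intro h5; rw [h5] at h; simp [CellState.right] at h
      have := h2.1
      have := ih _ (by omega) h4 rfl
      omega
    · have h4 : cellState α u (w - 1) ≠ .dead := by
        intro h5; rw [h5] at h; simp [CellState.up] at h
      have := ih _ (by omega) h4 rfl
      omega
    · exact absurd rfl h

theorem cellState_right {u w : ℕ} (h : cellState α u w ≠ .dead) (hR : GoesR u w) :
    cellState α (u + 1) w = (cellState α u w).right u w := by
  have := cellState_le h
  conv_lhs => rw [cellState]
  rw [if_neg (by omega), dif_pos (fromL_succ.2 hR)]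
  rfl

theorem cellState_up {u w : ℕ} (h : cellState α u w ≠ .dead) (hU : GoesU u w) :
    cellState α u (w + 1) = (cellState α u w).up u w := by
  have := cellState_le h
  conv_lhs => rw [cellState]
  rw [if_neg (by omega), dif_neg (not_fromL_of_goesU hU), dif_pos (by omega)]
  rfl

/-- The bounds on `i` and `j` make the truncated differences `1 - i` and `1 - j` genuine changes of
parity. -/
def CellState.Ok (α : Ordinal.{0}) : CellState → Prop
  | .dead => True
  | .run i j ρ _ => i < 2 ∧ j < 2 ∧ ρ ≤ α
  | .exit i j ρ => i < 2 ∧ j < 2 ∧ ρ ≤ α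

theorem cellState_ok (u w : ℕ) : (cellState α u w).Ok α := by
  induction hn : u + w using Nat.strong_induction_on generalizing u w with
  | _ n ih =>
    rw [cellState]
    split_ifs with h1 h2 h3
    · simp [CellState.Ok]
    · have := h2.1
      have := ih _ (by omega) (u - 1) w rfl
      revert this
      cases cellState α (u - 1) w <;> simp only [CellState.right] <;> split_ifs <;>
        simp only [CellState.Ok] <;> intro h <;> first | exact h | exact ⟨h.1, by omega, h.2.2⟩
    · have := ih _ (by omega) u (w - 1) rfl
      revert this
      cases cellState α u (w - 1) <;> simp only [CellState.up] <;> split_ifs <;>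
        simp only [CellState.Ok] <;> intro h <;>
        first
        | exact h
        | exact ⟨by omega, h.2.1, h.2.2⟩
        | exact ⟨h.1, h.2.1, (listing_lt (by assumption) _).le.trans h.2.2⟩
        | trivial
    · trivial

/-- The cell `(u, w)` carries the end of an exit of class `(i, j)`, which releases two tokens of
rank `ρ`. -/
def Gadget (α : Ordinal.{0}) (u w i j : ℕ) (ρ : Ordinal.{0}) : Prop :=
  cellState α u w = .exit i j ρ ∧ GoesR u w ∧ GoesU u w

theorem Gadget.ok {u w i j : ℕ} {ρ : Ordinal.{0}} (h : Gadget α u w i j ρ) :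
    i < 2 ∧ j < 2 ∧ ρ ≤ α ∧ 4 ≤ u ∧ 2 ≤ w := by
  have h1 := cellState_ok (α := α) u w
  have h2 := cellState_le (α := α) (u := u) (w := w) (by rw [h.1]; simp)
  rw [h.1] at h1
  exact ⟨h1.1, h1.2.1, h1.2.2, h2⟩

theorem Gadget.unique {u w i j i' j' : ℕ} {ρ ρ' : Ordinal.{0}} (h : Gadget α u w i j ρ)
    (h' : Gadget α u w i' j' ρ') : i = i' ∧ j = j' ∧ ρ = ρ' := by
  have := h.1.symm.trans h'.1
  simpa using this

theorem Gadget.right {u w i j : ℕ} {ρ : Ordinal.{0}} (h : Gadget α u w i j ρ) :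
    cellState α (u + 1) w = .run i (1 - j) ρ 0 := by
  rw [cellState_right (by rw [h.1]; simp) h.2.1, h.1]
  simp [CellState.right, h.2.2]

theorem Gadget.up {u w i j : ℕ} {ρ : Ordinal.{0}} (h : Gadget α u w i j ρ) :
    cellState α u (w + 1) = .run (1 - i) j ρ 0 := by
  rw [cellState_up (by rw [h.1]; simp) h.2.2, h.1]
  simp [CellState.up, h.2.1]

/-- The cell `(u, w)` belongs to the corridor of a node of rank `ρ` or to one of its exits. -/
def Corridor (α : Ordinal.{0}) (i j : ℕ) (ρ : Ordinal.{0}) (u w : ℕ) : Prop :=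
  (∃ n, cellState α u w = .run i j ρ n) ∨ ∃ σ < ρ, cellState α u w = .exit i j σ

theorem Corridor.ne_dead {i j u w : ℕ} {ρ : Ordinal.{0}} (h : Corridor α i j ρ u w) :
    cellState α u w ≠ .dead := by
  rcases h with ⟨n, h⟩ | ⟨σ, -, h⟩ <;> simp [h]

theorem Corridor.ok {i j u w : ℕ} {ρ : Ordinal.{0}} (h : Corridor α i j ρ u w) :
    i < 2 ∧ j < 2 ∧ 4 ≤ u ∧ 2 ≤ w := by
  have h1 := cellState_ok (α := α) u w
  have h2 := cellState_le h.ne_dead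
  rcases h with ⟨n, h⟩ | ⟨σ, -, h⟩ <;> rw [h] at h1 <;> exact ⟨h1.1, h1.2.1, h2⟩

/-! ### The board -/

/-- The landing squares, in local coordinates, of a road of class `(i, j)` through a cell which is
entered from the left (`L`) or from below and left to the right (`R`) or upward (`U`). -/
def Arms (i j : ℕ) (L R U ok : Prop) (a b : ℕ) : Prop :=
  (L ∧ a % 2 = i ∧ a ≤ 6 - i ∧ (R ∧ b = 4 + j ∨ ¬ R ∧ b = 6 - j)) ∨
  (¬ L ∧ a = 6 - i ∧ b % 2 = j ∧ b ≤ 4 + j) ∨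
  (R ∧ a % 2 = i ∧ 6 - i ≤ a ∧ (U ∧ b = 6 - j ∨ ¬ U ∧ b = 4 + j)) ∨
  (U ∧ a = 6 - i ∧ b % 2 = j ∧ 4 + j ≤ b ∧ (ok ∨ b ≤ 6 - j))

/-- The landing squares of an exit of class `(i, j)` in the cell where it ends. -/
def EndRoad (i j a b : ℕ) : Prop :=
  (a ≤ 4 + i ∧ a % 2 = i ∧ b = 4 + j) ∨ (a = 4 + i ∧ (b = 6 + j ∨ b = 8 + j)) ∨
    (a = 6 + i ∧ b = 8 + j)

/-- The numbers in `Arms` are dictated by parity: `6 - i` is congruent to `i`, and `4 + j` and `6 -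
j` to `j`. The tokens leave an exit on row `5 + j` and column `5 + i`, which are `6 - j'` and `6 -
i'` for the new parities `j' = 1 - j`, `i' = 1 - i`. Where a corridor of rank 0 branches, the upward
arm is cut off just after the point that the right arm needs. -/
def Road (α : Ordinal.{0}) (u w a b : ℕ) : Prop :=
  match cellState α u w with
  | .dead => False
  | .run i j ρ _ => Arms i j (FromL u w) (GoesR u w) (GoesU u w) (ρ ≠ 0 ∨ ¬ GoesR u w) a b
  | .exit i j _ =>
    GoesR u w ∧ GoesU u w ∧ EndRoad i j a b ∨
      ¬ (GoesR u w ∧ GoesU u w) ∧ Arms i j (FromL u w) (GoesR u w) (GoesU u w) True a b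

/-- The initially empty squares in local coordinates. -/
def Vacant (α : Ordinal.{0}) (u w a b : ℕ) : Prop :=
  Road α u w a b ∨ ∃ i j ρ, Gadget α u w i j ρ ∧
    (b = 5 + j ∧ 6 + i ≤ a ∧ a % 2 = i ∨ a = 5 + i ∧ 10 + j ≤ b ∧ b % 2 = j)

/-- The tokens in local coordinates. -/
def Token (α : Ordinal.{0}) (u w a b : ℕ) : Prop :=
  ∃ i j ρ, Gadget α u w i j ρ ∧ (a = 2 + i ∧ b = 5 + j ∨ a = 5 + i ∧ b = 6 + j)

open Classical in
noncomputable def content (α : Ordinal.{0}) (u w a b : ℕ) : Mark :=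
  if Token α u w a b then .black else if Vacant α u w a b then .empty else .red

/-- The red column at `-1` next to an empty half-plane supplies a spare move for Red, far from the
guards of the tokens. -/
noncomputable def baseGrid (α : Ordinal.{0}) : Grid := fun p =>
  if p.1 < -1 then .empty else if p.1 < 0 ∨ p.2 < 0 then .red else
    content α (p.1.toNat / 12) (p.2.toNat / 12) (p.1.toNat % 12) (p.2.toNat % 12)

/-- The square with local coordinates `a`, `b` in the cell `(u, w)`. -/
def pt (u w a b : ℕ) : Pt := (12 * u + a, 12 * w + b)

theorem pt_inj {u w a b u' w' a' b' : ℕ} (h : pt u w a b = pt u' w' a' b') (ha : a < 12)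
    (hb : b < 12) (ha' : a' < 12) (hb' : b' < 12) : u = u' ∧ w = w' ∧ a = a' ∧ b = b' := by
  simp only [pt, Prod.mk.injEq] at h
  omega

theorem pt_right (u w a b : ℕ) : pt u w a b + (1, 0) = pt u w (a + 1) b := by
  simp only [pt, Prod.mk_add_mk, Prod.mk.injEq]; push_cast; exact ⟨by ring, by ring⟩

theorem pt_up (u w a b : ℕ) : pt u w a b + (0, 1) = pt u w a (b + 1) := by
  simp only [pt, Prod.mk_add_mk, Prod.mk.injEq]; push_cast; exact ⟨by ring, by ring⟩

theorem pt_shift_right (u w a b : ℕ) : pt u w (a + 12) b = pt (u + 1) w a b := by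
  refine Prod.ext ?_ ?_ <;> simp only [pt] <;> omega

theorem pt_shift_up (u w a b : ℕ) : pt u w a (b + 12) = pt u (w + 1) a b := by
  refine Prod.ext ?_ ?_ <;> simp only [pt] <;> omega

theorem baseGrid_pt {u w a b : ℕ} (ha : a < 12) (hb : b < 12) :
    baseGrid α (pt u w a b) = content α u w a b := by
  have h1 : ¬ (pt u w a b).1 < -1 := by simp only [pt]; omega
  have h2 : ¬ ((pt u w a b).1 < 0 ∨ (pt u w a b).2 < 0) := by simp only [pt]; omega
  rw [baseGrid, if_neg h1, if_neg h2]
  congr 1 <;> simp only [pt] <;> omega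

theorem baseGrid_eq_black {s : Pt} (h : baseGrid α s = .black) :
    ∃ u w a b, a < 12 ∧ b < 12 ∧ s = pt u w a b ∧ Token α u w a b := by
  rw [baseGrid] at h
  split_ifs at h with h1 h2
  refine ⟨s.1.toNat / 12, s.2.toNat / 12, s.1.toNat % 12, s.2.toNat % 12,
    Nat.mod_lt _ (by norm_num), Nat.mod_lt _ (by norm_num), ?_, ?_⟩
  · ext <;> simp only [pt] <;> omega
  · rw [content] at h
    split_ifs at h with h3
    exact h3

/-! ### Contents of cells with a passing road and of cells where an exit ends -/

/-- The cell `(u, w)` carries a road of class `(i, j)` that does not end there. -/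
def Plain (α : Ordinal.{0}) (u w i j : ℕ) (ok : Prop) : Prop :=
  (∃ ρ n, cellState α u w = .run i j ρ n ∧ (ok ↔ ρ ≠ 0 ∨ ¬ GoesR u w)) ∨
    ((∃ ρ, cellState α u w = .exit i j ρ) ∧ ¬ (GoesR u w ∧ GoesU u w) ∧ (ok ↔ True))

theorem Plain.not_gadget {u w i j i' j' : ℕ} {ok : Prop} {ρ : Ordinal.{0}}
    (h : Plain α u w i j ok) : ¬ Gadget α u w i' j' ρ := by
  rintro ⟨h1, h2⟩
  rcases h with ⟨ρ, n, h, -⟩ | ⟨-, h, -⟩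
  · simp [h] at h1
  · exact h h2

theorem Plain.road {u w i j a b : ℕ} {ok : Prop} (h : Plain α u w i j ok) :
    Road α u w a b ↔ Arms i j (FromL u w) (GoesR u w) (GoesU u w) ok a b := by
  rcases h with ⟨ρ, n, h, h'⟩ | ⟨⟨ρ, h⟩, h', h''⟩
  · simp only [Road, h, h']
  · have h0 := h''.2 trivial
    simp only [Road, h, h0]
    constructor
    · rintro (h1 | h1)
      exacts [absurd ⟨h1.1, h1.2.1⟩ h', (eq_true h0) ▸ h1.2]
    · exact fun h1 => .inr ⟨h', (eq_true h0) ▸ h1⟩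

theorem Plain.content_empty {u w i j a b : ℕ} {ok : Prop} (h : Plain α u w i j ok)
    (hA : Arms i j (FromL u w) (GoesR u w) (GoesU u w) ok a b) :
    content α u w a b = .empty := by
  rw [content, if_neg, if_pos]
  · exact .inl (h.road.2 hA)
  · rintro ⟨i', j', ρ, h1, -⟩; exact h.not_gadget h1

theorem Plain.content_red {u w i j a b : ℕ} {ok : Prop} (h : Plain α u w i j ok)
    (hA : ¬ Arms i j (FromL u w) (GoesR u w) (GoesU u w) ok a b) :
    content α u w a b = .red := by
  rw [content, if_neg, if_neg]
  · rintro (h1 | ⟨i', j', ρ, h1, -⟩)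
    · exact hA (h.road.1 h1)
    · exact h.not_gadget h1
  · rintro ⟨i', j', ρ, h1, -⟩; exact h.not_gadget h1

theorem Gadget.road {u w i j a b : ℕ} {ρ : Ordinal.{0}} (h : Gadget α u w i j ρ) :
    Road α u w a b ↔ EndRoad i j a b := by
  simp only [Road, h.1, h.2.1, h.2.2, true_and, not_true_eq_false, false_and, or_false]

theorem Gadget.content_empty {u w i j a b : ℕ} {ρ : Ordinal.{0}} (h : Gadget α u w i j ρ)
    (hA : EndRoad i j a b ∨ b = 5 + j ∧ 6 + i ≤ a ∧ a % 2 = i ∨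
      a = 5 + i ∧ 10 + j ≤ b ∧ b % 2 = j) :
    content α u w a b = .empty := by
  have := h.ok
  rw [content, if_neg, if_pos]
  · rcases hA with hA | hA
    · exact .inl (h.road.2 hA)
    · exact .inr ⟨i, j, ρ, h, hA⟩
  · rintro ⟨i', j', ρ, h1, h2⟩
    obtain ⟨rfl, rfl, -⟩ := h.unique h1
    simp only [EndRoad] at hA
    omega

theorem Gadget.content_red {u w i j a b : ℕ} {ρ : Ordinal.{0}} (h : Gadget α u w i j ρ)
    (hA : ¬ (EndRoad i j a b ∨ b = 5 + j ∧ 6 + i ≤ a ∧ a % 2 = i ∨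
      a = 5 + i ∧ 10 + j ≤ b ∧ b % 2 = j))
    (hT : ¬ (a = 2 + i ∧ b = 5 + j ∨ a = 5 + i ∧ b = 6 + j)) :
    content α u w a b = .red := by
  rw [content, if_neg, if_neg]
  · rintro (h1 | ⟨i', j', ρ, h1, h2⟩)
    · exact hA (.inl (h.road.1 h1))
    · obtain ⟨rfl, rfl, -⟩ := h.unique h1
      exact hA (.inr h2)
  · rintro ⟨i', j', ρ, h1, h2⟩
    obtain ⟨rfl, rfl, -⟩ := h.unique h1
    exact hT h2

theorem Gadget.content_black {u w i j a b : ℕ} {ρ : Ordinal.{0}} (h : Gadget α u w i j ρ)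
    (hT : a = 2 + i ∧ b = 5 + j ∨ a = 5 + i ∧ b = 6 + j) :
    content α u w a b = .black := by
  rw [content, if_pos ⟨i, j, ρ, h, hT⟩]

theorem Corridor.plain_or_gadget {i j u w : ℕ} {ρ : Ordinal.{0}} (h : Corridor α i j ρ u w) :
    (∃ ok, Plain α u w i j ok) ∨ ∃ σ < ρ, Gadget α u w i j σ := by
  rcases h with ⟨n, h⟩ | ⟨σ, hσ, h⟩
  · exact .inl ⟨_, .inl ⟨ρ, n, h, Iff.rfl⟩⟩
  · by_cases hb : GoesR u w ∧ GoesU u w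
    · exact .inr ⟨σ, hσ, h, hb⟩
    · exact .inl ⟨_, .inr ⟨⟨σ, h⟩, hb, Iff.rfl⟩⟩

theorem Corridor.right {i j u w : ℕ} {ρ : Ordinal.{0}} {ok : Prop} (h : Corridor α i j ρ u w)
    (hP : Plain α u w i j ok) (hR : GoesR u w) : Corridor α i j ρ (u + 1) w := by
  have h1 := cellState_right h.ne_dead hR
  rcases h with ⟨n, h⟩ | ⟨σ, hσ, h⟩
  · rw [h, CellState.right] at h1
    split_ifs at h1
    exacts [.inl ⟨_, h1⟩, .inl ⟨_, h1⟩]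
  · rw [h, CellState.right] at h1
    split_ifs at h1 with hb
    · exact absurd ⟨h, hR, hb⟩ hP.not_gadget
    · exact .inr ⟨σ, hσ, h1⟩

/-- The assumption `ok` excludes the branching cells of a corridor of rank 0, above which the state
is dead. -/
theorem Corridor.up {i j u w : ℕ} {ρ : Ordinal.{0}} {ok : Prop} (h : Corridor α i j ρ u w)
    (hP : Plain α u w i j ok) (hU : GoesU u w) (hok : ok) : Corridor α i j ρ u (w + 1) := by
  have h1 := cellState_up h.ne_dead hU
  rcases h with ⟨n, h⟩ | ⟨σ, hσ, h⟩
  · have h2 : ρ ≠ 0 ∨ ¬ GoesR u w := by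
      rcases hP with ⟨ρ', n', h', h''⟩ | ⟨⟨ρ', h'⟩, -⟩
      · rw [h] at h'
        simp only [CellState.run.injEq] at h'
        rw [h'.2.2.1]
        exact h''.1 hok
      · simp [h] at h'
    rw [h, CellState.up] at h1
    split_ifs at h1 with h3 h4
    · tauto
    · exact .inr ⟨_, listing_lt h4 n, h1⟩
    · exact .inl ⟨_, h1⟩
  · rw [h, CellState.up] at h1
    split_ifs at h1 with hb
    · exact absurd ⟨h, hb, hU⟩ hP.not_gadget
    · exact .inr ⟨σ, hσ, h1⟩

theorem Gadget.corridor_right {u w i j : ℕ} {ρ : Ordinal.{0}} (h : Gadget α u w i j ρ) :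
    Corridor α i (1 - j) ρ (u + 1) w := .inl ⟨0, h.right⟩

/-! ### Continuation of roads from cell to cell -/

/-- A road leaves a cell to the right only at the landing squares where it enters the next one. -/
theorem Corridor.road_right {i j u w a b : ℕ} {ρ : Ordinal.{0}} (h : Corridor α i j ρ u w)
    (hr : Road α u w a b) (ha : 10 ≤ a) :
    GoesR u w ∧ Corridor α i j ρ (u + 1) w ∧ a % 2 = i ∧ Road α (u + 1) w i b := by
  have hk := h.ok
  rcases h.plain_or_gadget with ⟨ok, hP⟩ | ⟨σ, -, hG⟩
  · have hA := hP.road.1 hr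
    have h1 : GoesR u w ∧ a % 2 = i ∧ (GoesU u w ∧ b = 6 - j ∨ ¬ GoesU u w ∧ b = 4 + j) := by
      rcases hA with h | h | h | h
      · omega
      · omega
      · exact ⟨h.1, h.2.1, h.2.2.2⟩
      · omega
    obtain ⟨hR, hai, hb⟩ := h1
    have hc := h.right hP hR
    refine ⟨hR, hc, hai, ?_⟩
    -- The row on which a road leaves depends on whether this cell goes up, the row on which it is
    -- expected on whether the next one goes right; these conditions are complementary.
    have hiff := goesR_succ_iff hk.2.2.2 hR
    have hL := fromL_succ.2 hR
    rcases hc.plain_or_gadget with ⟨ok', hP'⟩ | ⟨σ, -, hG⟩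
    · refine hP'.road.2 (.inl ⟨hL, by omega, by omega, ?_⟩)
      tauto
    · refine hG.road.2 (.inl ⟨by omega, by omega, ?_⟩)
      have := hG.2.1
      tauto
  · have hA := hG.road.1 hr
    simp only [EndRoad] at hA
    omega

theorem Corridor.road_up {i j u w a b : ℕ} {ρ : Ordinal.{0}} (h : Corridor α i j ρ u w)
    (hr : Road α u w a b) (hb : 10 ≤ b) :
    GoesU u w ∧ Corridor α i j ρ u (w + 1) ∧ b % 2 = j ∧ Road α u (w + 1) a j := by
  have hk := h.ok
  rcases h.plain_or_gadget with ⟨ok, hP⟩ | ⟨σ, -, hG⟩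
  · have hA := hP.road.1 hr
    have h1 : GoesU u w ∧ b % 2 = j ∧ a = 6 - i ∧ ok := by
      rcases hA with h | h | h | h
      · omega
      · omega
      · omega
      · exact ⟨h.1, h.2.2.1, h.2.1, h.2.2.2.2.resolve_right (by omega)⟩
    obtain ⟨hU, hbj, ha, hok⟩ := h1
    have hc := h.up hP hU hok
    refine ⟨hU, hc, hbj, ?_⟩
    have hL := not_fromL_of_goesU hU
    rcases hc.plain_or_gadget with ⟨ok', hP'⟩ | ⟨σ, -, hG⟩
    · exact hP'.road.2 (.inr (.inl ⟨hL, ha, by omega, by omega⟩))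
    -- A road coming from below cannot be at the end of an exit, since branching cells are entered
    -- from the left.
    · exact absurd (fromL_of_branch (by omega) (by omega) hG.2.1 hG.2.2) hL
  · have hA := hG.road.1 hr
    simp only [EndRoad] at hA
    omega

theorem Corridor.road_parity {i j u w a b : ℕ} {ρ : Ordinal.{0}} (h : Corridor α i j ρ u w)
    (hr : Road α u w a b) : a % 2 = i ∧ b % 2 = j := by
  have hk := h.ok
  rcases h.plain_or_gadget with ⟨ok, hP⟩ | ⟨σ, -, hG⟩
  · have hA := hP.road.1 hr
    simp only [Arms] at hA
    omega
  · have hA := hG.road.1 hr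
    simp only [EndRoad] at hA
    omega

/-- Squares of the class of the road are empty only on the road. -/
theorem Corridor.road_of_empty {i j u w a b : ℕ} {ρ : Ordinal.{0}} (h : Corridor α i j ρ u w)
    (ha : a % 2 = i) (hb : b % 2 = j) (he : content α u w a b = .empty) : Road α u w a b := by
  have hk := h.ok
  rcases h.plain_or_gadget with ⟨ok, hP⟩ | ⟨σ, -, hG⟩
  · by_contra hA
    rw [hP.content_red (fun h => hA (hP.road.2 h))] at he
    cases he
  · by_contra hA
    rw [hG.content_red] at he
    · cases he
    -- The outgoing row and column of the tokens have the wrong parity in one coordinate.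
    · rintro (h | h | h)
      · exact hA (hG.road.2 h)
      · omega
      · omega
    · omega

theorem Plain.parity {u w i j a b : ℕ} {ok : Prop} (h : Plain α u w i j ok)
    (hr : Road α u w a b) : a % 2 = i ∧ b % 2 = j := by
  have := cellState_ok (α := α) u w
  have hij : i < 2 ∧ j < 2 := by
    rcases h with ⟨ρ, n, h, -⟩ | ⟨⟨ρ, h⟩, -⟩ <;> rw [h] at this <;> exact ⟨this.1, this.2.1⟩
  have hA := h.road.1 hr
  simp only [Arms] at hA
  omega

theorem Plain.content_red_of_parity {u w i j a b : ℕ} {ok : Prop} (h : Plain α u w i j ok)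
    (hab : ¬ (a % 2 = i ∧ b % 2 = j)) : content α u w a b = .red :=
  h.content_red fun hA => hab (h.parity (h.road.2 hA))

/-! ### Regions of the board -/

/-- The squares of the cells that are reached from the cell `(u, w)`. -/
def Region (u w : ℕ) : Set Pt :=
  {s | ∃ u' w' a b, Reach (u, w) (u', w') ∧ a < 12 ∧ b < 12 ∧ s = pt u' w' a b}

theorem pt_mem_region {u w a b u' w' : ℕ} (ha : a < 12) (hb : b < 12) :
    pt u' w' a b ∈ Region u w ↔ Reach (u, w) (u', w') := by
  constructor
  · rintro ⟨x, y, c, d, h, hc, hd, he⟩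
    obtain ⟨rfl, rfl, rfl, rfl⟩ := pt_inj he ha hb hc hd
    exact h
  · exact fun h => ⟨_, _, _, _, h, ha, hb, rfl⟩

theorem region_subset {u w u' w' : ℕ} (h : Reach (u, w) (u', w')) : Region u' w' ⊆ Region u w := by
  rintro _ ⟨x, y, a, b, h', ha, hb, rfl⟩
  exact ⟨x, y, a, b, h.trans h', ha, hb, rfl⟩

theorem le_of_mem_region {u w : ℕ} {s : Pt} (h : s ∈ Region u w) :
    (12 * u : ℤ) ≤ s.1 ∧ (12 * w : ℤ) ≤ s.2 := by
  obtain ⟨x, y, a, b, h, -, -, rfl⟩ := h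
  have := h.le
  simp only [pt]
  simp only at this
  omega

/-- A common descendant would make the ancestors `(u + 1, w)` and `(u, w + 1)` comparable, but each
has one larger coordinate. This is why the two tokens of an exit never share squares of later cells.
-/
theorem region_disjoint {u w : ℕ} {s : Pt} (h1 : s ∈ Region (u + 1) w)
    (h2 : s ∈ Region u (w + 1)) : False := by
  obtain ⟨x, y, a, b, h, ha, hb, rfl⟩ := h1
  have h2 := (pt_mem_region ha hb).1 h2
  rcases h.total h2 with h | h <;> have := h.le <;> simp only at this <;> omega

/-- `s` is one of the four squares which have to be occupied for a token on `t` to be blocked. -/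
def GuardOf (t s : Pt) : Prop := ∃ e, Player.black.Step e ∧ (s = t + e ∨ s = t + e + e)

theorem guardOf_iff {u w a b : ℕ} {s : Pt} : GuardOf (pt u w a b) s ↔
    s = pt u w (a + 1) b ∨ s = pt u w (a + 2) b ∨ s = pt u w a (b + 1) ∨ s = pt u w a (b + 2) := by
  constructor
  · rintro ⟨e, rfl | rfl, h | h⟩ <;> simp only [pt_right, pt_up] at h <;> tauto
  · rintro (h | h | h | h)
    · exact ⟨(1, 0), .inl rfl, .inl (by simp only [pt_right, h])⟩
    · exact ⟨(1, 0), .inl rfl, .inr (by simp only [pt_right, h])⟩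
    · exact ⟨(0, 1), .inr rfl, .inl (by simp only [pt_up, h])⟩
    · exact ⟨(0, 1), .inr rfl, .inr (by simp only [pt_up, h])⟩

/-- Tokens stand at least three squares away from the right and upper sides of their cell, so their
guard squares belong to the same cell. -/
theorem guardOf_local {u w a b : ℕ} {t : Pt} (ht : baseGrid α t = .black)
    (h : GuardOf t (pt u w a b)) (ha : a < 12) (hb : b < 12) : ∃ i j ρ, Gadget α u w i j ρ ∧
      (t = pt u w (2 + i) (5 + j) ∧
        ((a = 3 + i ∨ a = 4 + i) ∧ b = 5 + j ∨ a = 2 + i ∧ (b = 6 + j ∨ b = 7 + j)) ∨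
      t = pt u w (5 + i) (6 + j) ∧
        ((a = 6 + i ∨ a = 7 + i) ∧ b = 6 + j ∨ a = 5 + i ∧ (b = 7 + j ∨ b = 8 + j))) := by
  obtain ⟨u', w', a', b', -, -, rfl, i, j, ρ, hG, hT⟩ := baseGrid_eq_black ht
  have hk := hG.ok
  have key : ∀ c d, c < 12 → d < 12 → pt u w a b = pt u' w' c d →
      u' = u ∧ w' = w ∧ a = c ∧ b = d := by
    intro c d hc hd h
    obtain ⟨rfl, rfl, rfl, rfl⟩ := pt_inj h ha hb hc hd
    simp
  rw [guardOf_iff] at h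
  rcases hT with ⟨rfl, rfl⟩ | ⟨rfl, rfl⟩ <;> rcases h with h | h | h | h <;>
    obtain ⟨rfl, rfl, h1, h2⟩ := key _ _ (by omega) (by omega) h <;>
    refine ⟨i, j, ρ, hG, ?_⟩
  any_goals exact .inl ⟨rfl, by omega⟩
  any_goals exact .inr ⟨rfl, by omega⟩

theorem Plain.not_guardOf {u w i j a b : ℕ} {ok : Prop} (h : Plain α u w i j ok) {t : Pt}
    (ht : baseGrid α t = .black) (ha : a < 12) (hb : b < 12) : ¬ GuardOf t (pt u w a b) := by
  intro hg
  obtain ⟨i, j, ρ, hG, -⟩ := guardOf_local ht hg ha hb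
  exact h.not_gadget hG

theorem Gadget.not_guardOf {u w i j a b : ℕ} {ρ : Ordinal.{0}} (h : Gadget α u w i j ρ) {t : Pt}
    (ht : baseGrid α t = .black) (ha : a < 12) (hb : b < 12)
    (h1 : ¬ ((a = 3 + i ∨ a = 4 + i) ∧ b = 5 + j ∨ a = 2 + i ∧ (b = 6 + j ∨ b = 7 + j)))
    (h2 : ¬ ((a = 6 + i ∨ a = 7 + i) ∧ b = 6 + j ∨ a = 5 + i ∧ (b = 7 + j ∨ b = 8 + j))) :
    ¬ GuardOf t (pt u w a b) := by
  intro hg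
  obtain ⟨i', j', ρ, hG, hcase⟩ := guardOf_local ht hg ha hb
  obtain ⟨rfl, rfl, -⟩ := h.unique hG
  tauto

/-- The square to the right of a landing square of a road. -/
theorem Corridor.edge_right {i j u w a b : ℕ} {ρ : Ordinal.{0}} (h : Corridor α i j ρ u w)
    (hr : Road α u w a b) (ha : a < 12) (hb : b < 12)
    (hg : ∀ σ, Gadget α u w i j σ → b = 4 + j) :
    baseGrid α (pt u w (a + 1) b) = .red ∧
      (∀ t, baseGrid α t = .black → ¬ GuardOf t (pt u w (a + 1) b)) ∧
      pt u w (a + 1) b ∈ Region u w := by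
  have hk := h.ok
  have hpar := h.road_parity hr
  rcases Nat.lt_or_ge (a + 1) 12 with ha' | ha'
  · rw [baseGrid_pt ha' hb, pt_mem_region ha' hb]
    refine ⟨?_, ?_, .refl⟩
    · rcases h.plain_or_gadget with ⟨ok, hP⟩ | ⟨σ, -, hG⟩
      · exact hP.content_red_of_parity (by omega)
      · have := hg σ hG
        have hE := hG.road.1 hr
        refine hG.content_red ?_ ?_ <;> simp only [EndRoad] at hE ⊢ <;> omega
    · intro t ht
      rcases h.plain_or_gadget with ⟨ok, hP⟩ | ⟨σ, -, hG⟩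
      · exact hP.not_guardOf ht ha' hb
      · have := hg σ hG
        exact hG.not_guardOf ht ha' hb (by omega) (by omega)
  · obtain rfl : a = 11 := by omega
    obtain ⟨hR, hc, hi, hr'⟩ := h.road_right hr (by omega)
    have e : pt u w (11 + 1) b = pt (u + 1) w 0 b := pt_shift_right u w 0 b
    rw [e, baseGrid_pt (by omega) hb, pt_mem_region (by omega) hb]
    refine ⟨?_, ?_, .single (.right hR)⟩
    · rcases hc.plain_or_gadget with ⟨ok, hP⟩ | ⟨σ, -, hG⟩
      · exact hP.content_red_of_parity (by omega)
      · exact hG.content_red (by simp only [EndRoad]; omega) (by omega)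
    · intro t ht
      rcases hc.plain_or_gadget with ⟨ok, hP⟩ | ⟨σ, -, hG⟩
      · exact hP.not_guardOf ht (by omega) hb
      · exact hG.not_guardOf ht (by omega) hb (by omega) (by omega)

/-- The square above a landing square of a road. -/
theorem Corridor.edge_up {i j u w a b : ℕ} {ρ : Ordinal.{0}} (h : Corridor α i j ρ u w)
    (hr : Road α u w a b) (ha : a < 12) (hb : b < 12)
    (hg : ∀ σ, ¬ Gadget α u w i j σ) :
    baseGrid α (pt u w a (b + 1)) = .red ∧
      (∀ t, baseGrid α t = .black → ¬ GuardOf t (pt u w a (b + 1))) ∧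
      pt u w a (b + 1) ∈ Region u w := by
  have hk := h.ok
  have hpar := h.road_parity hr
  rcases Nat.lt_or_ge (b + 1) 12 with hb' | hb'
  · rw [baseGrid_pt ha hb', pt_mem_region ha hb']
    rcases h.plain_or_gadget with ⟨ok, hP⟩ | ⟨σ, -, hG⟩
    · exact ⟨hP.content_red_of_parity (by omega), fun t ht => hP.not_guardOf ht ha hb', .refl⟩
    · exact absurd hG (hg σ)
  · obtain rfl : b = 11 := by omega
    obtain ⟨hU, hc, hi, hr'⟩ := h.road_up hr (by omega)
    have e : pt u w a (11 + 1) = pt u (w + 1) a 0 := pt_shift_up u w a 0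
    rw [e, baseGrid_pt ha (by omega), pt_mem_region ha (by omega)]
    rcases hc.plain_or_gadget with ⟨ok, hP⟩ | ⟨σ, -, hG⟩
    · exact ⟨hP.content_red_of_parity (by omega), fun t ht => hP.not_guardOf ht ha (by omega),
        .single (.up hU)⟩
    · have := hG.road.1 hr'
      simp only [EndRoad] at this
      omega

theorem Corridor.road_not_guardOf {i j u w a b : ℕ} {ρ : Ordinal.{0}} (h : Corridor α i j ρ u w)
    (hr : Road α u w a b) (ha : a < 12) (hb : b < 12) {t : Pt} (ht : baseGrid α t = .black) :
    ¬ GuardOf t (pt u w a b) := by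
  have hk := h.ok
  rcases h.plain_or_gadget with ⟨ok, hP⟩ | ⟨σ, -, hG⟩
  · exact hP.not_guardOf ht ha hb
  · have hE := hG.road.1 hr
    simp only [EndRoad] at hE
    exact hG.not_guardOf ht ha hb (by omega) (by omega)

/-- The next landing square to the right, if it is empty, is on the road. -/
theorem Corridor.landing_right {i j u w a b : ℕ} {ρ : Ordinal.{0}} (h : Corridor α i j ρ u w)
    (hr : Road α u w a b) (ha : a < 12) (hb : b < 12) :
    pt u w (a + 2) b ∈ Region u w ∧ (baseGrid α (pt u w (a + 2) b) = .empty →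
      ∃ u' w' a' b', a' < 12 ∧ b' < 12 ∧ pt u w (a + 2) b = pt u' w' a' b' ∧
        Reach (u, w) (u', w') ∧ Corridor α i j ρ u' w' ∧ Road α u' w' a' b' ∧
        (u' = u ∧ w' = w ∧ a' = a + 2 ∧ b' = b ∨
          ∀ σ, Gadget α u' w' i j σ → b' = 4 + j)) := by
  have hk := h.ok
  have hpar := h.road_parity hr
  rcases Nat.lt_or_ge (a + 2) 12 with ha' | ha'
  · refine ⟨(pt_mem_region ha' hb).2 .refl, fun he => ?_⟩
    rw [baseGrid_pt ha' hb] at he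
    exact ⟨u, w, a + 2, b, ha', hb, rfl, .refl, h, h.road_of_empty (by omega) hpar.2 he,
      .inl ⟨rfl, rfl, rfl, rfl⟩⟩
  · obtain ⟨hR, hc, hi, hr'⟩ := h.road_right hr (by omega)
    have e : pt u w (a + 2) b = pt (u + 1) w i b := by
      rw [← pt_shift_right]; congr 1; omega
    rw [e]
    refine ⟨(pt_mem_region (by omega) hb).2 (.single (.right hR)), fun he => ⟨u + 1, w, i, b,
      by omega, hb, rfl, .single (.right hR), hc, hr', .inr fun σ hG => ?_⟩⟩
    have := hG.road.1 hr'
    simp only [EndRoad] at this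
    omega

/-- The next landing square above, if it is empty, is on the road. -/
theorem Corridor.landing_up {i j u w a b : ℕ} {ρ : Ordinal.{0}} (h : Corridor α i j ρ u w)
    (hr : Road α u w a b) (ha : a < 12) (hb : b < 12) :
    pt u w a (b + 2) ∈ Region u w ∧ (baseGrid α (pt u w a (b + 2)) = .empty →
      ∃ u' w' a' b', a' < 12 ∧ b' < 12 ∧ pt u w a (b + 2) = pt u' w' a' b' ∧
        Reach (u, w) (u', w') ∧ Corridor α i j ρ u' w' ∧ Road α u' w' a' b' ∧
        (u' = u ∧ w' = w ∧ a' = a ∧ b' = b + 2 ∨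
          ∀ σ, ¬ Gadget α u' w' i j σ)) := by
  have hk := h.ok
  have hpar := h.road_parity hr
  rcases Nat.lt_or_ge (b + 2) 12 with hb' | hb'
  · refine ⟨(pt_mem_region ha hb').2 .refl, fun he => ?_⟩
    rw [baseGrid_pt ha hb'] at he
    exact ⟨u, w, a, b + 2, ha, hb', rfl, .refl, h, h.road_of_empty hpar.1 (by omega) he,
      .inl ⟨rfl, rfl, rfl, rfl⟩⟩
  · obtain ⟨hU, hc, hi, hr'⟩ := h.road_up hr (by omega)
    have e : pt u w a (b + 2) = pt u (w + 1) a j := by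
      rw [← pt_shift_up]; congr 1; omega
    rw [e]
    refine ⟨(pt_mem_region ha (by omega)).2 (.single (.up hU)), fun he => ⟨u, w + 1, a, j,
      ha, by omega, rfl, .single (.up hU), hc, hr', .inr fun σ hG => ?_⟩⟩
    have := hG.road.1 hr'
    simp only [EndRoad] at this
    omega

/-! ### Effects of jumps -/

open Classical in
theorem jumped_black_apply {f : Grid} {v e s : Pt} :
    f.jumped .black v e s =
      if s = v + e + e then .black else if s = v ∨ s = v + e then .empty else f s := by
  by_cases h1 : s = v + e + e
  · simp [Grid.jumped, h1, Player.mark]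
  · rw [Grid.jumped, Function.update_of_ne h1, if_neg h1]
    by_cases h2 : s = v + e
    · simp [h2]
    · rw [Function.update_of_ne h2]
      by_cases h3 : s = v
      · simp [h3]
      · rw [Function.update_of_ne h3, if_neg (by tauto)]

open Classical in
theorem capture_apply {f : Grid} {v e s : Pt} :
    f.jumped .red (v + e) (-e) s =
      if s = v - e then .red else if s = v ∨ s = v + e then .empty else f s := by
  have e1 : v + e + -e = v := by abel
  have e2 : v + -e = v - e := by abel
  rw [Grid.jumped, e1, e2]
  by_cases h1 : s = v - e
  · simp [h1, Player.mark]
  · rw [Function.update_of_ne h1, if_neg h1]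
    by_cases h2 : s = v
    · simp [h2]
    · rw [Function.update_of_ne h2]
      by_cases h3 : s = v + e
      · simp [h3]
      · rw [Function.update_of_ne h3, if_neg (by tauto)]

/-- After a black jump in direction `e` the square `v - e` has just been emptied, so a red pawn
straight ahead can take the jumper. -/
theorem capture_move {f : Grid} {v e : Pt} (he : Player.black.Step e) (h1 : f v = .black)
    (h2 : f (v + e) = .red) (h3 : f (v - e) = .empty) :
    GridMove .red f (f.jumped .red (v + e) (-e)) := by
  refine ⟨v + e, h2, .inr (.inl ⟨v - e, .single ⟨v, -e, ?_, by simp, h1, ?_, ?_⟩⟩)⟩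
  · rcases he with rfl | rfl
    exacts [.inl rfl, .inr rfl]
  · rw [← sub_eq_add_neg]; exact h3
  · simp [sub_eq_add_neg]

/-! ### Red wins by always capturing the piece that has moved -/

theorem pt_eq_iff {u w a b a' b' : ℕ} : pt u w a b = pt u w a' b' ↔ a = a' ∧ b = b' := by
  simp only [pt, Prod.mk.injEq]; omega

theorem pt_sub_right (u w a b : ℕ) : pt u w (a + 1) b - (1, 0) = pt u w a b := by
  rw [← pt_right]; simp

theorem pt_sub_up (u w a b : ℕ) : pt u w a (b + 1) - (0, 1) = pt u w a b := by
  rw [← pt_up]; simp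

/-- The squares that matter for the first token of the exit that ends in the cell `(u, w)`. -/
def Ahead (u w i j : ℕ) : Set Pt :=
  {s | s ∈ Region (u + 1) w ∨ ∃ a b, a < 12 ∧ b < 12 ∧ s = pt u w a b ∧
    (b = 5 + j ∧ 2 + i ≤ a ∨ (b = 6 + j ∨ b = 7 + j) ∧ 5 + i ≤ a)}

/-! ### Positions in which at most one black pawn can move -/

/-- All black pieces outside `X`, if not on a square of `Q`, are surrounded by occupied squares. -/
def Locked (f : Grid) (X Q : Set Pt) : Prop :=
  ∀ t s, f t = .black → t ∉ X → GuardOf t s → s ∉ Q → f s ≠ .empty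

/-- Black pieces outside `X` have not moved, and Red has a spare move. -/
structure Calm (α : Ordinal.{0}) (f : Grid) (X : Set Pt) : Prop where
  black : ∀ s, f s = .black → s ∈ X ∨ baseGrid α s = .black
  red : f (-1, 0) = .red
  empty : f (-2, 0) = .empty

/-- On the board `f` only the first token released by the exit that ends in `(u, w)` can move. -/
structure Alive (α : Ordinal.{0}) (f : Grid) (u w i j : ℕ) (ρ : Ordinal.{0}) : Prop where
  gadget : Gadget α u w i j ρ
  calm : Calm α f ∅
  locked : Locked f ∅ {pt u w (4 + i) (5 + j)}
  ahead : ∀ s ∈ Ahead u w i j, s ≠ pt u w (4 + i) (5 + j) → f s = baseGrid α s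
  release : f (pt u w (4 + i) (5 + j)) = .empty
  above : f (pt u w (4 + i) (6 + j)) = .empty

/-- Any turn, however long, begins by entering an empty guard square of the piece, and such a square
must be in `Q`. -/
theorem Locked.of_black_move {f f' : Grid} {Q : Set Pt} (h : Locked f ∅ Q)
    (hm : GridMove .black f f') : ∃ p e, f p = .black ∧ Player.black.Step e ∧
      ((p + e ∈ Q ∧ f (p + e) = .empty) ∨
        (p + e + e ∈ Q ∧ f (p + e) = .red ∧ f (p + e + e) = .empty)) := by
  have key : ∀ p e, f p = .black → Player.black.Step e →
      (f (p + e) = .empty → p + e ∈ Q) ∧ (f (p + e + e) = .empty → p + e + e ∈ Q) := by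
    intro p e hp he
    constructor
    · intro h1
      by_contra hQ
      exact h p _ hp (by simp) ⟨e, he, .inl rfl⟩ hQ h1
    · intro h1
      by_contra hQ
      exact h p _ hp (by simp) ⟨e, he, .inr rfl⟩ hQ h1
  obtain ⟨p, hp, hm⟩ := hm
  have jump : ∀ c y, GridJump .black c (f, p) y → ∃ p e, f p = .black ∧ Player.black.Step e ∧
      ((p + e ∈ Q ∧ f (p + e) = .empty) ∨
        (p + e + e ∈ Q ∧ f (p + e) = .red ∧ f (p + e + e) = .empty)) := by
    rintro _ y ⟨e, he, rfl, h1, h2, rfl⟩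
    exact ⟨p, e, hp, he, .inr ⟨(key p e hp he).2 h2, h1, h2⟩⟩
  rcases hm with ⟨e, he, h1, -⟩ | ⟨p', h1⟩ | ⟨x, c, h0, h1, -⟩
  · exact ⟨p, e, hp, he, .inl ⟨(key p e hp he).1 h1, h1⟩⟩
  · rcases Relation.TransGen.head'_iff.1 h1 with ⟨y, ⟨c, hc⟩, -⟩
    exact jump c y hc
  · have := h1 0
    rw [h0] at this
    exact jump _ _ this

theorem Locked.no_move {f f' : Grid} (h : Locked f ∅ ∅) : ¬ GridMove .black f f' := by
  intro hm
  obtain ⟨p, e, -, -, h | h⟩ := h.of_black_move hm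
  exacts [h.1, h.1]

/-! ### Invariants of the travelling pawn -/

/-- The pawn on `v` is travelling away from the exit that ends in the cell `(u, w)`. -/
structure Runner (α : Ordinal.{0}) (u w i j : ℕ) (f : Grid) (v : Pt) : Prop where
  calm : Calm α f {v}
  black : f v = .black
  locked : Locked f {v} ∅
  ahead : ∀ s ∈ Ahead u w i j, ¬ s ≤ v → f s = baseGrid α s
  start : f (pt u w (2 + i) (5 + j)) ≠ .black
  capture : ∃ e, Player.black.Step e ∧ f (v - e) = .empty ∧ f (v + e) = .red ∧
    ∀ t, f t = .black → t ≠ v → ¬ GuardOf t v ∧ ¬ GuardOf t (v + e)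
  pos : 2 ≤ v.1

theorem step_ne {e : Pt} (h : Player.black.Step e) (v : Pt) :
    v ≠ v + e ∧ v ≠ v + e + e ∧ v ≤ v + e ∧ ¬ v + e ≤ v := by
  obtain ⟨x, y⟩ := v
  rcases h with rfl | rfl <;> simp [Prod.ext_iff] <;> omega

theorem step_fst {e : Pt} (h : Player.black.Step e) (v : Pt) :
    v.1 ≤ (v + e).1 ∧ v.1 ≤ (v + e + e).1 ∧ (v + e).1 ≤ v.1 + 1 := by
  obtain ⟨x, y⟩ := v
  rcases h with rfl | rfl <;> simp; omega

theorem Calm.jumped {f : Grid} {X : Set Pt} {v e : Pt} (h : Calm α f X) (hX : X ⊆ {v})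
    (he : Player.black.Step e) (hv : 2 ≤ v.1) :
    Calm α (f.jumped .black v e) {v + e + e} := by
  have h3 := step_fst he v
  have key : ∀ x : ℤ, x < 0 → (f.jumped .black v e) (x, 0) = f (x, 0) := by
    intro x hx
    rw [jumped_black_apply, if_neg, if_neg]
    · rintro (h | h)
      · have := congrArg Prod.fst h; simp only at this; omega
      · have := congrArg Prod.fst h; simp only at this; omega
    · intro h; have := congrArg Prod.fst h; simp only at this; omega
  refine ⟨fun s hs => ?_, by rw [key _ (by norm_num), h.red], by rw [key _ (by norm_num), h.empty]⟩
  rw [jumped_black_apply] at hs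
  split_ifs at hs with h1 h2
  · exact .inl h1
  · refine .inr ((h.black s hs).resolve_left fun hs' => ?_)
    exact h2 (.inl (hX hs'))

/-- The squares newly emptied are `v` and `v + e`; if one of them guards another token, it has to be
listed as an exception in `Q'`. -/
theorem Locked.jumped {f : Grid} {X Q Q' : Set Pt} {v e : Pt} (h : Locked f X Q) (hX : X ⊆ {v})
    (hQ : Q ⊆ Q') (hv : ∀ t, f t = .black → t ≠ v → GuardOf t v → v ∈ Q')
    (he : ∀ t, f t = .black → t ≠ v → GuardOf t (v + e) → v + e ∈ Q') :
    Locked (f.jumped .black v e) {v + e + e} Q' := by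
  intro t s ht htX hg hs
  have ht' : f t = .black ∧ t ≠ v := by
    rw [jumped_black_apply] at ht
    split_ifs at ht with h1 h2
    · exact absurd h1 htX
    · exact ⟨ht, fun h => h2 (.inl h)⟩
  rw [jumped_black_apply]
  split_ifs with h1 h2
  · simp
  · rcases h2 with rfl | rfl
    · exact absurd (hv t ht'.1 ht'.2 hg) hs
    · exact absurd (he t ht'.1 ht'.2 hg) hs
  · exact h t s ht'.1 (fun h => ht'.2 (hX h)) hg (fun h => hs (hQ h))

/-- Black jumps increase the position in the product order, so every square altered so far lies
below the present one. -/
theorem ahead_jumped {f : Grid} {S : Set Pt} {v e : Pt}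
    (h : ∀ s ∈ S, ¬ s ≤ v → f s = baseGrid α s) (he : Player.black.Step e) :
    ∀ s ∈ S, ¬ s ≤ v + e + e → f.jumped .black v e s = baseGrid α s := by
  intro s hs hle
  have h1 := step_ne he v
  have h2 := step_ne he (v + e)
  rw [jumped_black_apply, if_neg, if_neg]
  · exact h s hs fun h => hle (h.trans (h1.2.2.1.trans h2.2.2.1))
  · rintro (rfl | rfl)
    exacts [hle (h1.2.2.1.trans h2.2.2.1), hle h2.2.2.1]
  · rintro rfl; exact hle le_rfl

/-- The possibility of capture renews itself: the square just jumped is empty behind the pawn, the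
square straight ahead is red, and neither it nor the landing square guards another mobile token. -/
theorem Runner.jumped {u w i j : ℕ} {f : Grid} {v e : Pt} (h : Runner α u w i j f v)
    (he : Player.black.Step e)
    (hv : ∀ t, baseGrid α t = .black → t ≠ pt u w (2 + i) (5 + j) → ¬ GuardOf t v)
    (hve : ∀ t, baseGrid α t = .black → t ≠ pt u w (2 + i) (5 + j) → ¬ GuardOf t (v + e))
    (hv' : ∀ t, baseGrid α t = .black → t ≠ pt u w (2 + i) (5 + j) → ¬ GuardOf t (v + e + e))
    (hv'e : ∀ t, baseGrid α t = .black → ¬ GuardOf t (v + e + e + e))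
    (hr : baseGrid α (v + e + e + e) = .red) (hS : v + e + e + e ∈ Ahead u w i j)
    (hs : v + e + e ≠ pt u w (2 + i) (5 + j)) :
    Runner α u w i j (f.jumped .black v e) (v + e + e) := by
  have hbase : ∀ t, f t = .black → t ≠ v → baseGrid α t = .black ∧ t ≠ pt u w (2 + i) (5 + j) := by
    intro t ht htv
    refine ⟨(h.calm.black t ht).resolve_left htv, ?_⟩
    rintro rfl
    exact h.start ht
  have h1 := step_ne he v
  have h2 := step_ne he (v + e)
  have h3 := step_ne he (v + e + e)
  refine ⟨h.calm.jumped le_rfl he h.pos, by simp [jumped_black_apply],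
    h.locked.jumped le_rfl le_rfl (fun t ht htv hg => ?_) (fun t ht htv hg => ?_),
    ahead_jumped h.ahead he, ?_, ⟨e, he, ?_, ?_, fun t ht htv => ?_⟩, ?_⟩
  · exact absurd hg (hv t (hbase t ht htv).1 (hbase t ht htv).2)
  · exact absurd hg (hve t (hbase t ht htv).1 (hbase t ht htv).2)
  · rw [jumped_black_apply, if_neg hs.symm]
    split_ifs
    · simp
    · exact h.start
  · rw [add_sub_cancel_right, jumped_black_apply, if_neg h2.1, if_pos (.inr rfl)]
  · rw [ahead_jumped h.ahead he _ hS h3.2.2.2, hr]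
  · rw [jumped_black_apply, if_neg htv] at ht
    split_ifs at ht with h4
    have := hbase t ht (fun h => h4 (.inl h))
    exact ⟨hv' t this.1 this.2, hv'e t this.1⟩
  · have := step_fst he v
    exact h.pos.trans this.2.1

theorem Calm.captured {f : Grid} {v e : Pt} (h : Calm α f {v}) (he : Player.black.Step e)
    (hv : 2 ≤ v.1) : Calm α (f.jumped .red (v + e) (-e)) ∅ := by
  have h3 := step_fst he v
  have h4 := step_fst he (v - e)
  rw [sub_add_cancel] at h4
  have key : ∀ x : ℤ, x < 0 → (f.jumped .red (v + e) (-e)) (x, 0) = f (x, 0) := by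
    intro x hx
    rw [capture_apply, if_neg, if_neg]
    · rintro (h | h)
      · have := congrArg Prod.fst h; simp only at this; omega
      · have := congrArg Prod.fst h; simp only at this; omega
    · intro h; have := congrArg Prod.fst h; simp only at this; omega
  refine ⟨fun s hs => ?_, by rw [key _ (by norm_num), h.red], by rw [key _ (by norm_num), h.empty]⟩
  rw [capture_apply] at hs
  split_ifs at hs with h1 h2
  exact .inr ((h.black s hs).resolve_left fun hs' => h2 (.inl hs'))

/-- The capturing pawn fills `v - e`, which is how a released token can be locked again; the squares
`v` and `v + e` that become empty must guard no other token. -/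
theorem Locked.captured {f : Grid} {Q Q' : Set Pt} {v e : Pt} (h : Locked f {v} Q)
    (hQ : ∀ s ∈ Q, s = v - e ∨ s ∈ Q')
    (hg : ∀ t, f t = .black → t ≠ v → ¬ GuardOf t v ∧ ¬ GuardOf t (v + e)) :
    Locked (f.jumped .red (v + e) (-e)) ∅ Q' := by
  intro t s ht _ hts hs
  have ht' : f t = .black ∧ t ≠ v := by
    rw [capture_apply] at ht
    split_ifs at ht with h1 h2
    exact ⟨ht, fun h => h2 (.inl h)⟩
  have := hg t ht'.1 ht'.2
  rw [capture_apply]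
  split_ifs with h1 h2
  · simp
  · rcases h2 with rfl | rfl
    exacts [absurd hts this.1, absurd hts this.2]
  · exact h t s ht'.1 ht'.2 hts fun hsQ => (hQ s hsQ).elim h1 hs

theorem Runner.locked_of_capture {u w i j : ℕ} {f : Grid} {v : Pt} (h : Runner α u w i j f v) :
    ∃ f', GridMove .red f f' ∧ Locked f' ∅ ∅ := by
  obtain ⟨e, he, h1, h2, h3⟩ := h.capture
  exact ⟨_, capture_move he h.black h2 h1, h.locked.captured (fun s hs => hs.elim) h3⟩

/-- The pawn on `v` has not passed the release squares of the next exit. -/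
def Cruise (α : Ordinal.{0}) (u w i j : ℕ) (ρ : Ordinal.{0}) (f : Grid) (v : Pt) : Prop :=
  Runner α u w i j f v ∧
    ((∃ a, v = pt u w a (5 + j) ∧ 4 + i ≤ a ∧ a < 12 ∧ a % 2 = i ∧
      (a = 4 + i → f (pt u w (4 + i) (6 + j)) = .empty)) ∨
    ∃ u' w' a b, v = pt u' w' a b ∧ a < 12 ∧ b < 12 ∧ Reach (u + 1, w) (u', w') ∧
      Corridor α i (1 - j) ρ u' w' ∧ Road α u' w' a b ∧
      ∀ σ, Gadget α u' w' i (1 - j) σ → b = 4 + (1 - j))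

/-- The pawn on `v` has passed the release squares of an exit that ends in the cell `(u, w)`. -/
structure Ending (α : Ordinal.{0}) (k u w i j : ℕ) (ρ : Ordinal.{0}) (f : Grid) (v : Pt) :
    Prop where
  gadget : Gadget α u w i j ρ
  calm : Calm α f {v}
  black : f v = .black
  ahead : ∀ s ∈ Ahead u w i j, s ≠ pt u w (4 + i) (5 + j) → f s = baseGrid α s
  release : f (pt u w (4 + i) (5 + j)) = .empty
  far : ∀ a b, a < 12 → b < 12 → 8 + j ≤ b → pt u w a b ≠ v → pt u w a b ≠ pt u w (5 + i) (8 + j) →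
    f (pt u w a b) = baseGrid α (pt u w a b)
  phase : (k = 0 ∧ v = pt u w (4 + i) (6 + j) ∧ f (pt u w (4 + i) (7 + j)) = .red ∧
      f (pt u w (5 + i) (8 + j)) = .red ∧ Locked f {v} {pt u w (4 + i) (5 + j)}) ∨
    (k = 1 ∧ v = pt u w (4 + i) (8 + j) ∧ f (pt u w (4 + i) (7 + j)) = .empty ∧
      f (pt u w (4 + i) (6 + j)) = .empty ∧ f (pt u w (5 + i) (8 + j)) = .red ∧
      Locked f {v} {pt u w (4 + i) (5 + j)}) ∨
    (k = 2 ∧ v = pt u w (6 + i) (8 + j) ∧ f (pt u w (5 + i) (8 + j)) = .empty ∧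
      f (pt u w (4 + i) (6 + j)) = .empty ∧
      Locked f {v} {pt u w (4 + i) (5 + j), pt u w (5 + i) (8 + j)})

/-! ### Single jumps of the travelling pawn -/

theorem gridJump_pt {f : Grid} {u w a b : ℕ} {c : Pt} {y : Grid × Pt}
    (h : GridJump .black c (f, pt u w a b) y) :
    (c = pt u w (a + 1) b ∧ f (pt u w (a + 1) b) = .red ∧ f (pt u w (a + 2) b) = .empty ∧
      y = (f.jumped .black (pt u w a b) (1, 0), pt u w (a + 2) b)) ∨
    (c = pt u w a (b + 1) ∧ f (pt u w a (b + 1)) = .red ∧ f (pt u w a (b + 2)) = .empty ∧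
      y = (f.jumped .black (pt u w a b) (0, 1), pt u w a (b + 2))) := by
  obtain ⟨e, rfl | rfl, rfl, h1, h2, rfl⟩ := h
  · simp only [pt_right] at h1 h2 ⊢
    exact .inl ⟨trivial, h1, h2, trivial⟩
  · simp only [pt_up] at h1 h2 ⊢
    exact .inr ⟨trivial, h1, h2, trivial⟩

theorem not_pt_le {u w a b c d : ℕ} (h : c < a ∨ d < b) : ¬ pt u w a b ≤ pt u w c d := by
  simp only [pt, Prod.mk_le_mk]; omega

theorem Gadget.guardOf_row {u w i j a : ℕ} {ρ : Ordinal.{0}} (h : Gadget α u w i j ρ)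
    (ha : a < 12) {t : Pt} (ht : baseGrid α t = .black) (htt : t ≠ pt u w (2 + i) (5 + j)) :
    ¬ GuardOf t (pt u w a (5 + j)) := by
  have := h.ok
  intro hg
  obtain ⟨i', j', σ, hG, hc⟩ := guardOf_local ht hg ha (by omega)
  obtain ⟨rfl, rfl, -⟩ := h.unique hG
  rcases hc with hc | hc
  · exact htt hc.1
  · omega

theorem Gadget.plain_right {u w i j : ℕ} {ρ : Ordinal.{0}} (h : Gadget α u w i j ρ) :
    ∃ ok, Plain α (u + 1) w i (1 - j) ok := ⟨_, .inl ⟨ρ, 0, h.right, Iff.rfl⟩⟩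

/-- The row of the first token is continued by the road in the next cell. -/
theorem Gadget.road_right {u w i j : ℕ} {ρ : Ordinal.{0}} (h : Gadget α u w i j ρ) :
    Road α (u + 1) w i (5 + j) := by
  obtain ⟨ok, hP⟩ := h.plain_right
  have hk := h.ok
  refine hP.road.2 (.inl ⟨fromL_succ.2 h.2.1, by omega, by omega, .inr ⟨?_, by omega⟩⟩)
  rw [goesR_succ_iff hk.2.2.2.2 h.2.1]
  exact not_not.2 h.2.2

theorem Cruise.step_row {u w i j a : ℕ} {ρ : Ordinal.{0}} {f : Grid} {c : Pt} {y : Grid × Pt}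
    (hG : Gadget α u w i j ρ) (h : Runner α u w i j f (pt u w a (5 + j))) (ha : 4 + i ≤ a)
    (ha' : a < 12) (hai : a % 2 = i) (h0 : a = 4 + i → f (pt u w (4 + i) (6 + j)) = .empty)
    (hJ : GridJump .black c (f, pt u w a (5 + j)) y) :
    (∀ t, baseGrid α t = .black → t ≠ pt u w (2 + i) (5 + j) → ¬ GuardOf t c) ∧
      Cruise α u w i j ρ y.1 y.2 := by
  have hk := hG.ok
  rcases gridJump_pt hJ with ⟨rfl, h1, h2, rfl⟩ | ⟨rfl, h1, h2, rfl⟩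
  · obtain ⟨ok, hP⟩ := hG.plain_right
    have hedge : ∀ t, baseGrid α t = .black → t ≠ pt u w (2 + i) (5 + j) →
        ¬ GuardOf t (pt u w (a + 1) (5 + j)) := by
      intro t ht htt
      rcases Nat.lt_or_ge (a + 1) 12 with h3 | h3
      · exact hG.guardOf_row h3 ht htt
      · obtain rfl : a = 11 := by omega
        rw [show 11 + 1 = 0 + 12 from rfl, pt_shift_right]
        exact hP.not_guardOf ht (by omega) (by omega)
    refine ⟨hedge, ?_⟩
    have hrun := fun h1 h2 h3 h4 h5 h6 => h.jumped (e := (1, 0)) (.inl rfl) h1 h2 h3 h4 h5 h6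
    simp only [pt_right] at hrun
    replace hrun := hrun (fun t ht htt => hG.guardOf_row ha' ht htt) hedge
    rcases Nat.lt_or_ge (a + 2) 12 with h3 | h3
    · refine ⟨hrun (fun t ht htt => hG.guardOf_row h3 ht htt) ?_ ?_ ?_ ?_, .inl ⟨a + 2, rfl,
        by omega, h3, by omega, by omega⟩⟩
      · intro t ht
        rcases Nat.lt_or_ge (a + 3) 12 with h4 | h4
        · exact hG.not_guardOf ht h4 (by omega) (by omega) (by omega)
        · obtain rfl : a = 9 := by omega
          rw [show 9 + 1 + 1 + 1 = 0 + 12 from rfl, pt_shift_right]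
          exact hP.not_guardOf ht (by omega) (by omega)
      · rcases Nat.lt_or_ge (a + 3) 12 with h4 | h4
        · rw [baseGrid_pt h4 (by omega)]
          exact hG.content_red (by simp only [EndRoad]; omega) (by omega)
        · obtain rfl : a = 9 := by omega
          rw [show 9 + 1 + 1 + 1 = 0 + 12 from rfl, pt_shift_right,
            baseGrid_pt (by omega) (by omega)]
          exact hP.content_red_of_parity (by omega)
      · rcases Nat.lt_or_ge (a + 3) 12 with h4 | h4
        · exact .inr ⟨a + 3, 5 + j, h4, by omega, rfl, by omega⟩
        · obtain rfl : a = 9 := by omega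
          rw [show 9 + 1 + 1 + 1 = 0 + 12 from rfl, pt_shift_right]
          exact .inl ((pt_mem_region (by omega) (by omega)).2 .refl)
      · rw [Ne, pt_eq_iff]; omega
    · have e : a + 2 = i + 12 := by omega
      have hC := hG.corridor_right
      have hr := hG.road_right
      have hed := hC.edge_right hr (by omega) (by omega)
        (fun σ hσ => absurd hσ hP.not_gadget)
      rw [show a + 1 + 1 = i + 12 by omega, show i + 12 + 1 = i + 1 + 12 by omega, pt_shift_right,
        pt_shift_right] at hrun
      rw [e, pt_shift_right]
      refine ⟨hrun (fun t ht _ => hC.road_not_guardOf hr (by omega) (by omega) ht) hed.2.1 hed.1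
        (.inl hed.2.2) ?_, .inr ⟨u + 1, w, i, 5 + j, rfl, by omega, by omega, .refl, hC, hr,
        fun σ hσ => absurd hσ hP.not_gadget⟩⟩
      intro he
      have := (pt_inj he (by omega) (by omega) (by omega) (by omega)).1
      omega
  -- An upward jump fails on the release square because the square above it is empty and offers
  -- nothing to capture, and further along the row because the landing square is red.
  · exfalso
    rcases Nat.lt_or_ge (4 + i) a with h3 | h3
    · rw [h.ahead _ (.inr ⟨a, 5 + j + 2, ha', by omega, rfl, by omega⟩) (not_pt_le (by omega)),
        baseGrid_pt ha' (by omega), hG.content_red] at h2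
      · cases h2
      · simp only [EndRoad]; omega
      · omega
    · obtain rfl : a = 4 + i := by omega
      rw [show 5 + j + 1 = 6 + j by omega, h0 rfl] at h1
      cases h1

/-- The jump upward from the entering row removes the red pawn on the release square `(4 + i, 5 +
j)`, and this is the only hole it makes in the guards of the tokens. -/
theorem Ending.of_road {u w i j : ℕ} {σ : Ordinal.{0}} {f : Grid} (hG : Gadget α u w i j σ)
    (hcalm : Calm α f {pt u w (4 + i) (4 + j)})
    (hpos : 2 ≤ (pt u w (4 + i) (4 + j)).1) (hlock : Locked f {pt u w (4 + i) (4 + j)} ∅)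
    (hbase : ∀ s ∈ Region u w, ¬ s ≤ pt u w (4 + i) (4 + j) → f s = baseGrid α s) :
    Ending α 0 u w i j σ (f.jumped .black (pt u w (4 + i) (4 + j)) (0, 1))
      (pt u w (4 + i) (6 + j)) := by
  have hk := hG.ok
  have hj : ∀ s, f.jumped .black (pt u w (4 + i) (4 + j)) (0, 1) s = _ :=
    fun s => jumped_black_apply
  simp only [pt_up, show 4 + j + 1 = 5 + j by omega, show 5 + j + 1 = 6 + j by omega] at hj
  have hjt : ∀ a b, a < 12 → b < 12 → (4 + i < a ∨ 4 + j < b) → ¬ (a = 4 + i ∧ b = 5 + j) →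
      ¬ (a = 4 + i ∧ b = 6 + j) → f.jumped .black (pt u w (4 + i) (4 + j)) (0, 1) (pt u w a b)
        = content α u w a b := by
    intro a b ha hb h1 h2 h3
    rw [hj, if_neg (by rwa [pt_eq_iff]), if_neg (by simp only [pt_eq_iff]; omega),
      hbase _ ((pt_mem_region ha hb).2 .refl) (not_pt_le h1), baseGrid_pt ha hb]
  refine ⟨hG, ?_, ?_, ?_, ?_, ?_, .inl ⟨rfl, rfl, ?_, ?_, ?_⟩⟩
  · have := hcalm.jumped le_rfl (e := (0, 1)) (.inr rfl) hpos
    simpa only [pt_up, show 4 + j + 1 + 1 = 6 + j by omega] using this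
  · rw [hj, if_pos rfl]
  · rintro s (hs | ⟨a, b, ha, hb, rfl, hab⟩) hne
    · have hs1 := le_of_mem_region hs
      have h1 : ∀ a b, a < 12 → b < 12 → s ≠ pt u w a b := by
        rintro a b ha hb rfl
        simp only [pt] at hs1
        push_cast at hs1
        omega
      rw [hj, if_neg (h1 _ _ (by omega) (by omega)), if_neg]
      · refine hbase s (region_subset (.single (.right hG.2.1)) hs) fun hle => ?_
        have := hle.1
        simp only [pt] at this hs1
        push_cast at this hs1
        omega
      · rintro (h | h) <;> exact h1 _ _ (by omega) (by omega) h
    · rw [Ne, pt_eq_iff] at hne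
      rw [hjt a b ha hb (by omega) (by omega) (by omega), baseGrid_pt ha hb]
  · rw [hj, if_neg (by rw [pt_eq_iff]; omega), if_pos (.inr rfl)]
  · intro a b ha hb h1 h2 h3
    rw [Ne, pt_eq_iff] at h2
    rw [hjt a b ha hb (by omega) (by omega) (by omega), baseGrid_pt ha hb]
  · rw [hjt _ _ (by omega) (by omega) (by omega) (by omega) (by omega)]
    exact hG.content_red (by simp only [EndRoad]; omega) (by omega)
  · rw [hjt _ _ (by omega) (by omega) (by omega) (by omega) (by omega)]
    exact hG.content_red (by simp only [EndRoad]; omega) (by omega)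
  · have := hlock.jumped (Q' := {pt u w (4 + i) (5 + j)}) (e := (0, 1)) le_rfl
      (Set.empty_subset _) (fun t ht htv hg => ?_) (fun t ht htv hg => ?_)
    · simpa only [pt_up, show 4 + j + 1 + 1 = 6 + j by omega] using this
    · exact absurd hg (hG.not_guardOf ((hcalm.black t ht).resolve_left htv) (by omega) (by omega)
        (by omega) (by omega))
    · simp only [pt_up, show 4 + j + 1 = 5 + j by omega]; rfl

theorem Cruise.step {u w i j : ℕ} {ρ : Ordinal.{0}} {f : Grid} {v c : Pt} {y : Grid × Pt}
    (hG : Gadget α u w i j ρ) (h : Cruise α u w i j ρ f v) (hJ : GridJump .black c (f, v) y) :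
    ((∀ t, baseGrid α t = .black → t ≠ pt u w (2 + i) (5 + j) → ¬ GuardOf t c) ∧
      Cruise α u w i j ρ y.1 y.2) ∨
    ∃ u' w' σ, σ < ρ ∧ Ending α 0 u' w' i (1 - j) σ y.1 y.2 := by
  have hk := hG.ok
  obtain ⟨h, ⟨a, rfl, ha, ha', hai, h0⟩ | ⟨u', w', a, b, rfl, ha, hb, hreach, hC, hr, hg⟩⟩ := h
  · exact .inl (Cruise.step_row hG h ha ha' hai h0 hJ)
  have hkC := hC.ok
  have hsub : Region u' w' ⊆ Region (u + 1) w := region_subset hreach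
  have hahead : ∀ s ∈ Region u' w', s ∈ Ahead u w i j := fun s hs => .inl (hsub hs)
  have hstart : ∀ u'' w'' a b, a < 12 → b < 12 → Reach (u + 1, w) (u'', w'') →
      pt u'' w'' a b ≠ pt u w (2 + i) (5 + j) := by
    intro u'' w'' a b ha hb hle h
    have := (pt_inj h ha hb (by omega) (by omega)).1
    have := hle.le
    simp only at this
    omega
  have hv : ∀ t, baseGrid α t = .black → t ≠ pt u w (2 + i) (5 + j) →
      ¬ GuardOf t (pt u' w' a b) := fun t ht _ => hC.road_not_guardOf hr ha hb ht
  rcases gridJump_pt hJ with ⟨rfl, h1, h2, rfl⟩ | ⟨rfl, h1, h2, rfl⟩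
  · refine .inl ?_
    have hed := hC.edge_right hr ha hb hg
    have hl := hC.landing_right hr ha hb
    have hrun := fun h1 h2 h3 h4 h5 h6 => h.jumped (e := (1, 0)) (.inl rfl) h1 h2 h3 h4 h5 h6
    simp only [pt_right] at hrun
    replace hrun := hrun hv (fun t ht _ => hed.2.1 t ht)
    rw [h.ahead _ (hahead _ hl.1) (not_pt_le (by omega))] at h2
    obtain ⟨u'', w'', a'', b'', ha'', hb'', e, hre, hC', hr', hg'⟩ := hl.2 h2
    have hg'' : ∀ σ, Gadget α u'' w'' i (1 - j) σ → b'' = 4 + (1 - j) := by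
      rcases hg' with ⟨rfl, rfl, rfl, rfl⟩ | hg'
      exacts [hg, hg']
    have hed' := hC'.edge_right hr' ha'' hb'' hg''
    have e' : pt u' w' (a + 2 + 1) b = pt u'' w'' (a'' + 1) b'' := by
      rw [← pt_right, e, pt_right]
    refine ⟨fun t ht _ => hed.2.1 t ht, ?_⟩
    rw [e'] at hrun
    rw [e] at hrun ⊢
    exact ⟨hrun (fun t ht _ => hC'.road_not_guardOf hr' ha'' hb'' ht) hed'.2.1 hed'.1
      (hahead _ (region_subset hre hed'.2.2)) (hstart _ _ _ _ ha'' hb'' (hreach.trans hre)),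
      .inr ⟨u'', w'', a'', b'', rfl, ha'', hb'', hreach.trans hre, hC', hr', hg''⟩⟩
  · have hl := hC.landing_up hr ha hb
    have h2' := h2
    rw [h.ahead _ (hahead _ hl.1) (not_pt_le (by omega))] at h2
    obtain ⟨u'', w'', a'', b'', ha'', hb'', e, hre, hC', hr', hg'⟩ := hl.2 h2
    -- In the cell where an exit ends, a pawn still on row `4 + j` can jump upward only from column
    -- `4 + i`; this jump enters the end of the exit.
    by_cases hgad : ∃ σ, Gadget α u' w' i (1 - j) σ
    · right
      obtain ⟨σ, hσ, hG'⟩ : ∃ σ < ρ, Gadget α u' w' i (1 - j) σ := by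
        obtain ⟨σ, hσ⟩ := hgad
        rcases hC.plain_or_gadget with ⟨ok, hP⟩ | h'
        · exact absurd hσ hP.not_gadget
        · exact h'
      obtain rfl := hg σ hG'
      have hpar := hC.road_parity hr
      obtain ⟨rfl, rfl, rfl, rfl⟩ := pt_inj e (by omega) (by omega) ha'' hb''
      have hE := hG'.road.1 hr
      have hE' := hG'.road.1 hr'
      simp only [EndRoad] at hE hE'
      obtain rfl : a = 4 + i := by omega
      refine ⟨u', w', σ, hσ, ?_⟩
      have := Ending.of_road hG' h.calm h.pos h.locked
        (fun s hs hle => h.ahead s (hahead s hs) hle)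
      simpa only [show 4 + (1 - j) + 2 = 6 + (1 - j) by omega] using this
    · left
      push Not at hgad
      have hed := hC.edge_up hr ha hb hgad
      have hrun := fun h1 h2 h3 h4 h5 h6 => h.jumped (e := (0, 1)) (.inr rfl) h1 h2 h3 h4 h5 h6
      simp only [pt_up] at hrun
      replace hrun := hrun hv (fun t ht _ => hed.2.1 t ht)
      have hg'' : ∀ σ, ¬ Gadget α u'' w'' i (1 - j) σ := by
        rcases hg' with ⟨rfl, rfl, rfl, rfl⟩ | hg'
        exacts [hgad, hg']
      have hed' := hC'.edge_up hr' ha'' hb'' hg''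
      have e' : pt u' w' a (b + 2 + 1) = pt u'' w'' a'' (b'' + 1) := by
        rw [← pt_up, e, pt_up]
      refine ⟨fun t ht _ => hed.2.1 t ht, ?_⟩
      rw [e'] at hrun
      rw [e] at hrun ⊢
      exact ⟨hrun (fun t ht _ => hC'.road_not_guardOf hr' ha'' hb'' ht) hed'.2.1 hed'.1
        (hahead _ (region_subset hre hed'.2.2)) (hstart _ _ _ _ ha'' hb'' (hreach.trans hre)),
        .inr ⟨u'', w'', a'', b'', rfl, ha'', hb'', hreach.trans hre, hC', hr',
          fun σ hσ => absurd hσ (hg'' σ)⟩⟩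

/-- The end of an exit has three landing squares in succession and no way out, so at most two
further jumps are possible. In particular no infinite jump can enter it. -/
theorem Ending.step {k u w i j : ℕ} {σ : Ordinal.{0}} {f : Grid} {v c : Pt} {y : Grid × Pt}
    (h : Ending α k u w i j σ f v) (hJ : GridJump .black c (f, v) y) :
    k < 2 ∧ Ending α (k + 1) u w i j σ y.1 y.2 := by
  have hG := h.gadget
  have hk := hG.ok
  have hfar : ∀ a b, a < 12 → b < 12 → 8 + j ≤ b → pt u w a b ≠ v → ¬ (a = 5 + i ∧ b = 8 + j) →
      f (pt u w a b) = content α u w a b := by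
    intro a b ha hb h1 h2 h3
    rw [h.far a b ha hb h1 h2 (by rwa [Ne, pt_eq_iff]), baseGrid_pt ha hb]
  have hguard : ∀ t a b, f t = .black → t ≠ v → a < 12 → b < 12 →
      ¬ ((a = 3 + i ∨ a = 4 + i) ∧ b = 5 + j ∨ a = 2 + i ∧ (b = 6 + j ∨ b = 7 + j)) →
      ¬ ((a = 6 + i ∨ a = 7 + i) ∧ b = 6 + j ∨ a = 5 + i ∧ (b = 7 + j ∨ b = 8 + j)) →
      ¬ GuardOf t (pt u w a b) := fun t a b ht htv ha hb =>
    hG.not_guardOf ((h.calm.black t ht).resolve_left htv) ha hb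
  have hpos : ∀ a b, 2 ≤ (pt u w a b).1 := by intro a b; simp only [pt]; omega
  have hahead : ∀ s ∈ Ahead u w i j, ∀ a b, a < 12 → b < 12 →
      ¬ (b = 5 + j ∧ 2 + i ≤ a ∨ (b = 6 + j ∨ b = 7 + j) ∧ 5 + i ≤ a) → s ≠ pt u w a b := by
    rintro s (hs | ⟨a', b', ha', hb', rfl, hab⟩) a b ha hb hn he
    · have := le_of_mem_region (he ▸ hs)
      simp only [pt] at this
      push_cast at this
      omega
    · rw [pt_eq_iff] at he
      omega
  rcases h.phase with ⟨rfl, rfl, h1, h2, hl⟩ | ⟨rfl, rfl, h1, h2, h3, hl⟩ | ⟨rfl, rfl, h1, h2, hl⟩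
  · rcases gridJump_pt hJ with ⟨rfl, h3, h4, rfl⟩ | ⟨rfl, h3, h4, rfl⟩
    · exfalso
      rw [h.ahead _ (.inr ⟨4 + i + 1, 6 + j, by omega, by omega, rfl, by omega⟩)
        (by rw [Ne, pt_eq_iff]; omega), baseGrid_pt (by omega) (by omega),
        hG.content_black (by omega)] at h3
      cases h3
    · have hj : ∀ s, f.jumped .black (pt u w (4 + i) (6 + j)) (0, 1) s = _ :=
        fun s => jumped_black_apply
      simp only [pt_up, show 6 + j + 1 = 7 + j by omega, show 7 + j + 1 = 8 + j by omega] at hj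
      have hjt : ∀ a b, ¬ (a = 4 + i ∧ 6 + j ≤ b ∧ b ≤ 8 + j) →
          f.jumped .black (pt u w (4 + i) (6 + j)) (0, 1) (pt u w a b) = f (pt u w a b) := by
        intro a b h
        rw [hj, if_neg (by rw [pt_eq_iff]; omega), if_neg (by simp only [pt_eq_iff]; omega)]
      rw [show 6 + j + 2 = 8 + j by omega]
      dsimp only
      refine ⟨by omega, hG, ?_, by rw [hj, if_pos rfl], fun s hs hne => ?_, ?_,
        fun a b ha hb h5 h6 h7 => ?_, .inr (.inl ⟨rfl, rfl, ?_, ?_, ?_, ?_⟩)⟩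
      · have := h.calm.jumped le_rfl (e := (0, 1)) (.inr rfl) (hpos _ _)
        simpa only [pt_up, show 6 + j + 1 + 1 = 8 + j by omega] using this
      · have := hahead s hs
        rw [hj, if_neg (this _ _ (by omega) (by omega) (by omega)), if_neg, h.ahead s hs hne]
        rintro (h | h)
        exacts [this _ _ (by omega) (by omega) (by omega) h,
          this _ _ (by omega) (by omega) (by omega) h]
      · rw [hjt _ _ (by omega), h.release]
      · rw [Ne, pt_eq_iff] at h6
        rw [hjt _ _ (by omega), h.far a b ha hb h5 (by rw [Ne, pt_eq_iff]; omega) h7]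
      · rw [hj, if_neg (by rw [pt_eq_iff]; omega), if_pos (.inr rfl)]
      · rw [hj, if_neg (by rw [pt_eq_iff]; omega), if_pos (.inl rfl)]
      · rw [hjt _ _ (by omega), h2]
      · have := hl.jumped (Q' := {pt u w (4 + i) (5 + j)}) (e := (0, 1)) le_rfl le_rfl
          (fun t ht htv hg => ?_) (fun t ht htv hg => ?_)
        · simpa only [pt_up, show 6 + j + 1 + 1 = 8 + j by omega] using this
        · exact absurd hg (hguard t _ _ ht htv (by omega) (by omega) (by omega) (by omega))
        · rw [pt_up] at hg
          exact absurd hg (hguard t _ _ ht htv (by omega) (by omega) (by omega) (by omega))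
  · rcases gridJump_pt hJ with ⟨rfl, h4, h5, rfl⟩ | ⟨rfl, h4, h5, rfl⟩
    · have hj : ∀ s, f.jumped .black (pt u w (4 + i) (8 + j)) (1, 0) s = _ :=
        fun s => jumped_black_apply
      simp only [pt_right, show 4 + i + 1 = 5 + i by omega, show 5 + i + 1 = 6 + i by omega] at hj
      have hjt : ∀ a b, ¬ (4 + i ≤ a ∧ a ≤ 6 + i ∧ b = 8 + j) →
          f.jumped .black (pt u w (4 + i) (8 + j)) (1, 0) (pt u w a b) = f (pt u w a b) := by
        intro a b h
        rw [hj, if_neg (by rw [pt_eq_iff]; omega), if_neg (by simp only [pt_eq_iff]; omega)]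
      rw [show 4 + i + 2 = 6 + i by omega]
      dsimp only
      refine ⟨by omega, hG, ?_, by rw [hj, if_pos rfl], fun s hs hne => ?_, ?_,
        fun a b ha hb h6 h7 h8 => ?_, .inr (.inr ⟨rfl, rfl, ?_, ?_, ?_⟩)⟩
      · have := h.calm.jumped le_rfl (e := (1, 0)) (.inl rfl) (hpos _ _)
        simpa only [pt_right, show 4 + i + 1 + 1 = 6 + i by omega] using this
      · have := hahead s hs
        rw [hj, if_neg (this _ _ (by omega) (by omega) (by omega)), if_neg, h.ahead s hs hne]
        rintro (h | h)
        exacts [this _ _ (by omega) (by omega) (by omega) h,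
          this _ _ (by omega) (by omega) (by omega) h]
      · rw [hjt _ _ (by omega), h.release]
      · by_cases h9 : a = 4 + i ∧ b = 8 + j
        · obtain ⟨rfl, rfl⟩ := h9
          rw [hj, if_neg h7, if_pos (.inl rfl), baseGrid_pt ha hb, hG.content_empty]
          exact .inl (.inr (.inl ⟨rfl, .inr rfl⟩))
        · rw [Ne, pt_eq_iff] at h7
          have h8' := h8
          rw [Ne, pt_eq_iff] at h8'
          rw [hjt _ _ (by omega), h.far a b ha hb h6 (by rw [Ne, pt_eq_iff]; omega) h8]
      · rw [hj, if_neg (by rw [pt_eq_iff]; omega), if_pos (.inr rfl)]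
      · rw [hjt _ _ (by omega), h2]
      · have := hl.jumped (Q' := {pt u w (4 + i) (5 + j), pt u w (5 + i) (8 + j)}) (e := (1, 0))
          le_rfl (by simp) (fun t ht htv hg => ?_) (fun t ht htv hg => ?_)
        · simpa only [pt_right, show 4 + i + 1 + 1 = 6 + i by omega] using this
        · exact absurd hg (hguard t _ _ ht htv (by omega) (by omega) (by omega) (by omega))
        · rw [pt_right, show 4 + i + 1 = 5 + i by omega]
          simp
    · exfalso
      rw [hfar _ _ (by omega) (by omega) (by omega) (by rw [Ne, pt_eq_iff]; omega) (by omega),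
        hG.content_red (by simp only [EndRoad]; omega) (by omega)] at h5
      cases h5
  · exfalso
    rcases gridJump_pt hJ with ⟨rfl, h4, h5, rfl⟩ | ⟨rfl, h4, h5, rfl⟩ <;>
    · rw [hfar _ _ (by omega) (by omega) (by omega) (by rw [Ne, pt_eq_iff]; omega) (by omega),
        hG.content_red (by simp only [EndRoad]; omega) (by omega)] at h5
      cases h5

/-- Red captures against the direction of the last jump. At `k = 0` the capturing pawn lands on the
release square of the first token and locks everything. At `k = 1` it lands on `(4 + i, 7 + j)`, so
the first token stays released. At `k = 2` it lands on the release square of the second token, and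
again only the first is released. -/
theorem Ending.alive_of_capture {k u w i j : ℕ} {σ : Ordinal.{0}} {f : Grid} {v : Pt}
    (h : Ending α k u w i j σ f v) : ∃ f', GridMove .red f f' ∧
      (Locked f' ∅ ∅ ∨ Alive α f' u w i j σ) := by
  have hG := h.gadget
  have hk := hG.ok
  have hpos : ∀ a b, 2 ≤ (pt u w a b).1 := by intro a b; simp only [pt]; omega
  have hguard : ∀ t a b, f t = .black → t ≠ v → a < 12 → b < 12 →
      ¬ ((a = 3 + i ∨ a = 4 + i) ∧ b = 5 + j ∨ a = 2 + i ∧ (b = 6 + j ∨ b = 7 + j)) →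
      ¬ ((a = 6 + i ∨ a = 7 + i) ∧ b = 6 + j ∨ a = 5 + i ∧ (b = 7 + j ∨ b = 8 + j)) →
      ¬ GuardOf t (pt u w a b) := fun t a b ht htv ha hb =>
    hG.not_guardOf ((h.calm.black t ht).resolve_left htv) ha hb
  have hahead : ∀ s ∈ Ahead u w i j, ∀ a b, a < 12 → b < 12 →
      ¬ (b = 5 + j ∧ 2 + i ≤ a ∨ (b = 6 + j ∨ b = 7 + j) ∧ 5 + i ≤ a) → s ≠ pt u w a b := by
    rintro s (hs | ⟨a', b', ha', hb', rfl, hab⟩) a b ha hb hn he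
    · have := le_of_mem_region (he ▸ hs)
      simp only [pt] at this
      push_cast at this
      omega
    · rw [pt_eq_iff] at he
      omega
  have hfar : ∀ a b, a < 12 → b < 12 → 8 + j ≤ b → pt u w a b ≠ v → ¬ (a = 5 + i ∧ b = 8 + j) →
      f (pt u w a b) = content α u w a b := by
    intro a b ha hb h1 h2 h3
    rw [h.far a b ha hb h1 h2 (by rwa [Ne, pt_eq_iff]), baseGrid_pt ha hb]
  rcases h.phase with ⟨rfl, rfl, h1, h2, hl⟩ | ⟨rfl, rfl, h1, h2, h3, hl⟩ | ⟨rfl, rfl, h1, h2, hl⟩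
  · have e1 : pt u w (4 + i) (6 + j) - (0, 1) = pt u w (4 + i) (5 + j) := by
      rw [show 6 + j = 5 + j + 1 by omega, pt_sub_up]
    have e2 : pt u w (4 + i) (6 + j) + (0, 1) = pt u w (4 + i) (7 + j) := by
      rw [pt_up]; congr 1; omega
    refine ⟨_, capture_move (e := (0, 1)) (.inr rfl) h.black (e2 ▸ h1) (e1 ▸ h.release),
      .inl (hl.captured ?_ fun t ht htv => ⟨?_, ?_⟩)⟩
    · rintro s rfl; exact .inl e1.symm
    · exact hguard t _ _ ht htv (by omega) (by omega) (by omega) (by omega)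
    · rw [e2]; exact hguard t _ _ ht htv (by omega) (by omega) (by omega) (by omega)
  · have e1 : pt u w (4 + i) (8 + j) - (0, 1) = pt u w (4 + i) (7 + j) := by
      rw [show 8 + j = 7 + j + 1 by omega, pt_sub_up]
    have e2 : pt u w (4 + i) (8 + j) + (0, 1) = pt u w (4 + i) (9 + j) := by
      rw [pt_up]; congr 1; omega
    have h4 : f (pt u w (4 + i) (9 + j)) = .red := by
      rw [hfar _ _ (by omega) (by omega) (by omega) (by rw [Ne, pt_eq_iff]; omega) (by omega),
        hG.content_red (by simp only [EndRoad]; omega) (by omega)]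
    have hj : ∀ s, f.jumped .red (pt u w (4 + i) (8 + j) + (0, 1)) (-(0, 1)) s = _ :=
      fun s => capture_apply
    rw [e1, e2] at hj
    have hjt : ∀ a b, ¬ (a = 4 + i ∧ 7 + j ≤ b ∧ b ≤ 9 + j) →
        f.jumped .red (pt u w (4 + i) (9 + j)) (-(0, 1)) (pt u w a b) = f (pt u w a b) := by
      intro a b h
      rw [hj, if_neg (by rw [pt_eq_iff]; omega), if_neg (by simp only [pt_eq_iff]; omega)]
    refine ⟨_, capture_move (e := (0, 1)) (.inr rfl) h.black (e2 ▸ h4) (e1 ▸ h1),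
      .inr ⟨hG, h.calm.captured (.inr rfl) (hpos _ _), hl.captured ?_ fun t ht htv => ⟨?_, ?_⟩,
        fun s hs hne => ?_, ?_, ?_⟩⟩
    · intro s hs; exact .inr hs
    · exact hguard t _ _ ht htv (by omega) (by omega) (by omega) (by omega)
    · rw [e2]; exact hguard t _ _ ht htv (by omega) (by omega) (by omega) (by omega)
    · have := hahead s hs
      rw [e2, hj, if_neg (this _ _ (by omega) (by omega) (by omega)), if_neg, h.ahead s hs hne]
      rintro (h | h)
      exacts [this _ _ (by omega) (by omega) (by omega) h,
        this _ _ (by omega) (by omega) (by omega) h]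
    · rw [e2, hjt _ _ (by omega), h.release]
    · rw [e2, hjt _ _ (by omega), h2]
  · have e1 : pt u w (6 + i) (8 + j) - (1, 0) = pt u w (5 + i) (8 + j) := by
      rw [show 6 + i = 5 + i + 1 by omega, pt_sub_right]
    have e2 : pt u w (6 + i) (8 + j) + (1, 0) = pt u w (7 + i) (8 + j) := by
      rw [pt_right]; congr 1; omega
    have h4 : f (pt u w (7 + i) (8 + j)) = .red := by
      rw [hfar _ _ (by omega) (by omega) (by omega) (by rw [Ne, pt_eq_iff]; omega) (by omega),
        hG.content_red (by simp only [EndRoad]; omega) (by omega)]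
    have hj : ∀ s, f.jumped .red (pt u w (6 + i) (8 + j) + (1, 0)) (-(1, 0)) s = _ :=
      fun s => capture_apply
    rw [e1, e2] at hj
    have hjt : ∀ a b, ¬ (5 + i ≤ a ∧ a ≤ 7 + i ∧ b = 8 + j) →
        f.jumped .red (pt u w (7 + i) (8 + j)) (-(1, 0)) (pt u w a b) = f (pt u w a b) := by
      intro a b h
      rw [hj, if_neg (by rw [pt_eq_iff]; omega), if_neg (by simp only [pt_eq_iff]; omega)]
    refine ⟨_, capture_move (e := (1, 0)) (.inl rfl) h.black (e2 ▸ h4) (e1 ▸ h1),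
      .inr ⟨hG, h.calm.captured (.inl rfl) (hpos _ _), hl.captured ?_ fun t ht htv => ⟨?_, ?_⟩,
        fun s hs hne => ?_, ?_, ?_⟩⟩
    · rintro s (rfl | rfl)
      exacts [.inr rfl, .inl e1.symm]
    · exact hguard t _ _ ht htv (by omega) (by omega) (by omega) (by omega)
    · rw [e2]; exact hguard t _ _ ht htv (by omega) (by omega) (by omega) (by omega)
    · have := hahead s hs
      rw [e2, hj, if_neg (this _ _ (by omega) (by omega) (by omega)), if_neg, h.ahead s hs hne]
      rintro (h | h)
      exacts [this _ _ (by omega) (by omega) (by omega) h,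
        this _ _ (by omega) (by omega) (by omega) h]
    · rw [e2, hjt _ _ (by omega), h.release]
    · rw [e2, hjt _ _ (by omega), h2]

/-! ### Existence of a value -/

theorem exists_valueAtMost_of_red_move {f f' : Grid} (h : GridMove .red f f')
    (h' : ∃ γ, (noForcedJumpDraughts .red).ValueAtMost (f'.toPosition .black) γ) :
    ∃ γ, (noForcedJumpDraughts .red).ValueAtMost (f.toPosition .red) γ := by
  obtain ⟨γ, hγ⟩ := h'
  exact ⟨Order.succ γ, .openMove rfl (legalMove_iff.2 ⟨f', h, rfl⟩) hγ (Order.lt_succ γ)⟩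

theorem Locked.exists_valueAtMost {f : Grid} (h : Locked f ∅ ∅) :
    ∃ γ, (noForcedJumpDraughts .red).ValueAtMost (f.toPosition .black) γ := by
  refine ⟨0, .won ⟨by simp [Grid.toPosition], fun q hq => ?_⟩⟩
  obtain ⟨f', hf', -⟩ := legalMove_iff.1 hq
  exact h.no_move hf'

/-- The only squares to which a black piece can move is that of the release. -/
theorem Alive.first {f : Grid} {u w i j : ℕ} {ρ : Ordinal.{0}} (h : Alive α f u w i j ρ)
    {p e : Pt} (hp : f p = .black) (he : Player.black.Step e) :
    f (p + e) ≠ .empty ∧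
      (f (p + e + e) = .empty → p = pt u w (2 + i) (5 + j) ∧ e = (1, 0)) := by
  have hk := h.gadget.ok
  have hb : baseGrid α p = .black := (h.calm.black p hp).resolve_left (by simp)
  have key : ∀ s, GuardOf p s → f s = .empty → s = pt u w (4 + i) (5 + j) := by
    intro s hg hs
    by_contra hne
    exact h.locked p s hp (by simp) hg hne hs
  have htok : GuardOf p (pt u w (4 + i) (5 + j)) → p = pt u w (2 + i) (5 + j) := by
    intro hg
    by_contra hne
    exact h.gadget.guardOf_row (by omega) hb hne hg
  constructor
  · intro h1
    have h2 := key _ ⟨e, he, .inl rfl⟩ h1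
    have h3 := htok ⟨e, he, .inl h2.symm⟩
    rw [h3] at h2
    rcases he with rfl | rfl <;> simp only [pt_right, pt_up, pt_eq_iff] at h2 <;> omega
  · intro h1
    have h2 := key _ ⟨e, he, .inr rfl⟩ h1
    have h3 := htok ⟨e, he, .inr h2.symm⟩
    refine ⟨h3, ?_⟩
    rw [h3] at h2
    rcases he with rfl | rfl
    · rfl
    · simp only [pt_up, pt_eq_iff] at h2
      omega

theorem Alive.first_jump {f : Grid} {u w i j : ℕ} {ρ : Ordinal.{0}} (h : Alive α f u w i j ρ)
    {p c : Pt} {y : Grid × Pt} (hp : f p = .black) (hJ : GridJump .black c (f, p) y) :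
    p = pt u w (2 + i) (5 + j) ∧ c = pt u w (3 + i) (5 + j) ∧ Cruise α u w i j ρ y.1 y.2 := by
  have hG := h.gadget
  have hk := hG.ok
  obtain ⟨e, he, rfl, h1, h2, rfl⟩ := hJ
  obtain ⟨rfl, rfl⟩ := (h.first hp he).2 h2
  have hj : ∀ s, f.jumped .black (pt u w (2 + i) (5 + j)) (1, 0) s = _ :=
    fun s => jumped_black_apply
  have e3 : 2 + i + 1 = 3 + i := by omega
  have e4 : 3 + i + 1 = 4 + i := by omega
  simp only [pt_right, e3, e4] at hj h1 h2 ⊢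
  have hblack : ∀ t, f.jumped .black (pt u w (2 + i) (5 + j)) (1, 0) t = .black →
      t ≠ pt u w (4 + i) (5 + j) → baseGrid α t = .black ∧ t ≠ pt u w (2 + i) (5 + j) := by
    intro t ht htv
    rw [hj, if_neg htv] at ht
    split_ifs at ht with h3
    exact ⟨(h.calm.black t ht).resolve_left (by simp), fun h => h3 (.inl h)⟩
  refine ⟨trivial, trivial, ⟨?_, by rw [hj, if_pos rfl], ?_, fun s hs hle => ?_, ?_,
    ⟨(1, 0), .inl rfl, ?_, ?_, fun t ht htv => ⟨?_, ?_⟩⟩, ?_⟩, .inl ⟨4 + i, rfl, le_rfl,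
    by omega, by omega, fun _ => ?_⟩⟩
  · have := h.calm.jumped (Set.empty_subset {pt u w (2 + i) (5 + j)}) (e := (1, 0)) (.inl rfl)
      (by simp only [pt]; omega)
    simpa only [pt_right, e3, e4] using this
  · intro t s ht htX hg _
    replace htX : t ≠ pt u w (4 + i) (5 + j) := htX
    have hb := hblack t ht htX
    rw [hj]
    split_ifs with h3 h4
    · simp
    · rcases h4 with rfl | rfl <;> exact absurd hg (hG.guardOf_row (by omega) hb.1 hb.2)
    · rw [hj, if_neg htX, if_neg] at ht
      · exact h.locked t s ht (by simp) hg h3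
      · rintro (rfl | rfl)
        · exact hb.2 rfl
        · rw [baseGrid_pt (by omega) (by omega), hG.content_red (by simp only [EndRoad]; omega)
            (by omega)] at hb
          cases hb.1
  · rw [hj, if_neg, if_neg, h.ahead s hs]
    · rintro rfl; exact hle le_rfl
    · rintro (rfl | rfl) <;> exact hle (by simp only [pt, Prod.mk_le_mk]; omega)
    · rintro rfl; exact hle le_rfl
  · rw [hj, if_neg (by rw [pt_eq_iff]; omega), if_pos (.inl rfl)]
    simp
  · rw [show 4 + i = 3 + i + 1 by omega, pt_sub_right, hj, if_neg (by rw [pt_eq_iff]; omega),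
      if_pos (.inr rfl)]
  · rw [pt_right, hj, if_neg (by rw [pt_eq_iff]; omega),
      if_neg (by simp only [pt_eq_iff]; omega), h.ahead _ (.inr ⟨4 + i + 1, 5 + j, by omega,
      by omega, rfl, by omega⟩) (by rw [Ne, pt_eq_iff]; omega), baseGrid_pt (by omega) (by omega)]
    exact hG.content_red (by simp only [EndRoad]; omega) (by omega)
  · have hb := hblack t ht htv
    exact hG.guardOf_row (by omega) hb.1 hb.2
  · have hb := hblack t ht htv
    rw [pt_right]
    exact hG.guardOf_row (by omega) hb.1 hb.2
  · simp only [pt]; omega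
  · rw [hj, if_neg (by rw [pt_eq_iff]; omega), if_neg (by simp only [pt_eq_iff]; omega), h.above]

/-- After an infinite iterated jump Red can pass, and wins. -/
theorem Alive.locked_of_infinite {f f' : Grid} {u w i j : ℕ} {ρ : Ordinal.{0}}
    (h : Alive α f u w i j ρ) {p : Pt} (hp : f p = .black) {x : ℕ → Grid × Pt} {c : ℕ → Pt}
    (hx0 : x 0 = (f, p)) (hx : ∀ n, GridJump .black (c n) (x n) (x (n + 1)))
    (h1 : f' p = .empty) (h2 : ∀ n, f' (c n) = .empty)
    (h3 : ∀ t, t ≠ p → (∀ n, t ≠ c n) → f' t = f t) :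
    ∃ f'', GridMove .red f' f'' ∧ Locked f'' ∅ ∅ := by
  have hG := h.gadget
  have hk := hG.ok
  have hfirst := h.first_jump hp (hx0 ▸ hx 0)
  obtain ⟨rfl, hc0, hC0⟩ := hfirst
  -- Entering the end of an exit would stop the iterated jump after two more jumps.
  have hno : ∀ u' w' σ n, ¬ Ending α 0 u' w' i (1 - j) σ (x n).1 (x n).2 := by
    intro u' w' σ n hE
    have hE1 := (hE.step (hx n)).2
    have hE2 := (hE1.step (hx (n + 1))).2
    have := (hE2.step (hx (n + 2))).1
    omega
  have hcr : ∀ n, Cruise α u w i j ρ (x (n + 1)).1 (x (n + 1)).2 := by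
    intro n
    induction n with
    | zero => exact hC0
    | succ n ih =>
      rcases ih.step hG (hx (n + 1)) with h | ⟨u', w', σ, -, h⟩
      exacts [h.2, absurd h (hno _ _ _ _)]
  -- The squares emptied by the infinite jump guard no token other than the one that has vanished,
  -- so all others remain locked.
  have hcg : ∀ n t, baseGrid α t = .black → t ≠ pt u w (2 + i) (5 + j) → ¬ GuardOf t (c n) := by
    rintro (_ | n)
    · intro t ht htt
      rw [hc0]
      exact hG.guardOf_row (by omega) ht htt
    · rcases (hcr n).step hG (hx (n + 1)) with h | ⟨u', w', σ, -, h⟩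
      exacts [h.1, absurd h (hno _ _ _ _)]
  have hcpos : ∀ n, 2 ≤ (c n).1 := by
    rintro (_ | n)
    · rw [hc0]; simp only [pt]; omega
    · obtain ⟨e, he, hce, -⟩ := hx (n + 1)
      rw [hce]
      exact (hcr n).1.pos.trans (step_fst he _).1
  have hneg : ∀ k : ℤ, k < 0 → f' (k, 0) = f (k, 0) := by
    intro k hk
    refine h3 _ (fun h => ?_) fun n h => ?_
    · have := congrArg Prod.fst h
      simp only [pt] at this
      omega
    · have := hcpos n
      rw [← h] at this
      simp only at this
      omega
  have hred : f' (-1, 0) = .red := (hneg _ (by norm_num)).trans h.calm.red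
  have hemp : f' (-2, 0) = .empty := (hneg _ (by norm_num)).trans h.calm.empty
  -- There is nothing left to capture; Red makes the spare move from `(-1, 0)` to `(-2, 0)`.
  refine ⟨_, ⟨(-1, 0), hred, .inl ⟨(-1, 0), .inl rfl, hemp, rfl⟩⟩, ?_⟩
  intro t s ht _ hg _
  have ht' : f t = .black ∧ t ≠ pt u w (2 + i) (5 + j) := by
    simp only [Function.update_apply] at ht
    split_ifs at ht with h4 h5
    · simp [Player.mark] at ht
    · have h6 : t ≠ pt u w (2 + i) (5 + j) := by
        rintro rfl
        rw [h1] at ht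
        cases ht
      refine ⟨?_, h6⟩
      rw [← h3 t h6 fun n => ?_, ht]
      rintro rfl
      rw [h2] at ht
      cases ht
  have hb := (h.calm.black t ht'.1).resolve_left (by simp)
  have hs0 : 0 ≤ s.1 := by
    obtain ⟨u', w', a, b, -, -, rfl, -⟩ := baseGrid_eq_black hb
    rw [guardOf_iff] at hg
    rcases hg with rfl | rfl | rfl | rfl <;> simp only [pt] <;> omega
  have hs' : ∀ k : ℤ, k < 0 → s ≠ (k, 0) := by
    rintro k hk rfl
    simp only at hs0
    omega
  rw [show ((-1, 0) : Pt) + (-1, 0) = (-2, 0) from rfl, Function.update_of_ne (hs' _ (by norm_num)),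
    Function.update_of_ne (hs' _ (by norm_num)), h3]
  · refine h.locked t s ht'.1 (by simp) hg ?_
    rintro rfl
    exact hG.guardOf_row (by omega) hb ht'.2 hg
  · rintro rfl
    exact hG.guardOf_row (by omega) hb ht'.2 hg
  · rintro n rfl
    exact hcg n t hb ht'.2 hg

/-- A finite jump stops either on the corridor, where the capture wins at once, or in the end of an
exit of rank `σ < ρ`, where the capture wins or leaves a position of the same kind of rank `σ`. An
infinite jump lets Red win by the spare move. -/
theorem Alive.exists_valueAtMost {f : Grid} {u w i j : ℕ} {ρ : Ordinal.{0}}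
    (h : Alive α f u w i j ρ) :
    ∃ γ, (noForcedJumpDraughts .red).ValueAtMost (f.toPosition .black) γ := by
  induction ρ using WellFoundedLT.induction generalizing f u w i j with
  | _ ρ ih =>
  have hG := h.gadget
  refine OpenGame.exists_valueAtMost_of_closed (by simp [noForcedJumpDraughts, Grid.toPosition])
    fun q hq => ?_
  obtain ⟨f', ⟨p, hp, hm⟩, rfl⟩ := legalMove_iff.1 hq
  rcases hm with ⟨e, he, h1, -⟩ | ⟨p', h1⟩ | ⟨x, c, hx0, hx, h1, h2, h3⟩
  · exact absurd h1 (h.first hp he).1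
  · obtain ⟨y, ⟨c, hc⟩, hy⟩ := Relation.TransGen.head'_iff.1 h1
    obtain ⟨-, -, hC⟩ := h.first_jump hp hc
    have key : ∀ z, Relation.ReflTransGen (fun x y => ∃ c, GridJump .black c x y) y z →
        Cruise α u w i j ρ z.1 z.2 ∨
          ∃ k u' w' σ, σ < ρ ∧ Ending α k u' w' i (1 - j) σ z.1 z.2 := by
      intro z hz
      induction hz with
      | refl => exact .inl hC
      | tail _ hstep ih =>
        obtain ⟨c, hc⟩ := hstep
        rcases ih with h | ⟨k, u', w', σ, hσ, h⟩
        · rcases h.step hG hc with h | ⟨u', w', σ, hσ, h⟩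
          exacts [.inl h.2, .inr ⟨0, u', w', σ, hσ, h⟩]
        · exact .inr ⟨k + 1, u', w', σ, hσ, (h.step hc).2⟩
    rcases key _ hy with h | ⟨k, u', w', σ, hσ, h⟩
    · obtain ⟨f'', hf, hl⟩ := h.1.locked_of_capture
      exact exists_valueAtMost_of_red_move hf hl.exists_valueAtMost
    · obtain ⟨f'', hf, hl | hl⟩ := h.alive_of_capture
      · exact exists_valueAtMost_of_red_move hf hl.exists_valueAtMost
      · exact exists_valueAtMost_of_red_move hf (ih σ hσ hl)
  · obtain ⟨f'', hf, hl⟩ := h.locked_of_infinite hp hx0 hx h1 h2 h3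
    exact exists_valueAtMost_of_red_move hf hl.exists_valueAtMost

/-! ### Iterated jumps along the roads -/

/-- The pawn on `v` can reach `v'` by an iterated jump which turns `f` into `g`. -/
def Runs (f : Grid) (v : Pt) (g : Grid) (v' : Pt) : Prop :=
  Relation.ReflTransGen (fun x y => ∃ c, GridJump .black c x y) (f, v) (g, v')

theorem Runs.refl (f : Grid) (v : Pt) : Runs f v f v := Relation.ReflTransGen.refl

theorem Runs.trans {f g h : Grid} {v v' v'' : Pt} (h1 : Runs f v g v') (h2 : Runs g v' h v'') :
    Runs f v h v'' := Relation.ReflTransGen.trans h1 h2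

theorem Runs.black {f g : Grid} {v v' s : Pt} (h : Runs f v g v') (hs : g s = .black) :
    s = v' ∨ f s = .black := by
  have key : ∀ y, Relation.ReflTransGen (fun x y => ∃ c, GridJump .black c x y) (f, v) y →
      ∀ s, y.1 s = .black → s = y.2 ∨ f s = .black := by
    intro y hy
    induction hy with
    | refl => exact fun s hs => .inr hs
    | @tail y z _ hz ih =>
      obtain ⟨c, e, he, rfl, -, -, rfl⟩ := hz
      intro s hs
      simp only at hs ⊢
      rw [jumped_black_apply] at hs
      split_ifs at hs with h1 h2
      · exact .inl h1
      · exact (ih s hs).imp (fun h => absurd (.inl h) h2) id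
  exact key _ h s hs

/-- The squares of `S` that the pawn on `v` can still reach are as at the beginning. -/
def Free (α : Ordinal.{0}) (S : Set Pt) (f : Grid) (v : Pt) : Prop :=
  f v = .black ∧ (∀ s ∈ S, ¬ s ≤ v → f s = baseGrid α s) ∧
    ∀ s ∈ S, f s = .black → s = v ∨ baseGrid α s = .black

theorem Free.mono {S S' : Set Pt} {f : Grid} {v : Pt} (h : Free α S f v) (hS : S' ⊆ S) :
    Free α S' f v := ⟨h.1, fun s hs => h.2.1 s (hS hs), fun s hs => h.2.2 s (hS hs)⟩

theorem free_jumped {S : Set Pt} {f : Grid} {v e : Pt} (he : Player.black.Step e)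
    (h : ∀ s ∈ S, ¬ s ≤ v + e + e → f s = baseGrid α s)
    (h' : ∀ s ∈ S, f s = .black → s = v ∨ baseGrid α s = .black) (h1 : f (v + e) = .red)
    (h2 : f (v + e + e) = .empty) :
    (∃ c, GridJump .black c (f, v) (f.jumped .black v e, v + e + e)) ∧
      Free α S (f.jumped .black v e) (v + e + e) := by
  have h4 := step_ne he v
  have h5 := step_ne he (v + e)
  refine ⟨⟨v + e, e, he, rfl, h1, h2, rfl⟩, by simp [jumped_black_apply],
    fun s hs hle => ?_, fun s hs hsb => ?_⟩
  · rw [jumped_black_apply, if_neg, if_neg, h s hs hle]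
    · rintro (rfl | rfl)
      exacts [hle (h4.2.2.1.trans h5.2.2.1), hle h5.2.2.1]
    · rintro rfl; exact hle le_rfl
  · rw [jumped_black_apply] at hsb
    split_ifs at hsb with h6 h7
    · exact .inl h6
    · exact .inr ((h' s hs hsb).resolve_left fun h => h7 (.inl h))

theorem Free.jump {S : Set Pt} {f : Grid} {v e : Pt} (h : Free α S f v)
    (he : Player.black.Step e) (h1 : v + e ∈ S) (h2 : v + e + e ∈ S)
    (h3 : baseGrid α (v + e) = .red) (h4 : baseGrid α (v + e + e) = .empty) :
    ∃ g, Runs f v g (v + e + e) ∧ Free α S g (v + e + e) := by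
  have h5 := step_ne he v
  have h6 := step_ne he (v + e)
  have h7 := free_jumped he (fun s hs hle => h.2.1 s hs fun h => hle ?_) h.2.2 ?_ ?_
  · exact ⟨_, .single h7.1, h7.2⟩
  · exact h.trans (h5.2.2.1.trans h6.2.2.1)
  · rw [h.2.1 _ h1 h5.2.2.2, h3]
  · rw [h.2.1 _ h2 fun h => h6.2.2.2 (h.trans h5.2.2.1), h4]

theorem Free.jump_right {S : Set Pt} {f : Grid} {u w a b : ℕ} (h : Free α S f (pt u w a b))
    (h1 : pt u w (a + 1) b ∈ S) (h2 : pt u w (a + 2) b ∈ S)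
    (h3 : baseGrid α (pt u w (a + 1) b) = .red) (h4 : baseGrid α (pt u w (a + 2) b) = .empty) :
    ∃ g, Runs f (pt u w a b) g (pt u w (a + 2) b) ∧ Free α S g (pt u w (a + 2) b) := by
  have := h.jump (e := (1, 0)) (.inl rfl)
  simp only [pt_right] at this
  exact this h1 h2 h3 h4

theorem Free.jump_up {S : Set Pt} {f : Grid} {u w a b : ℕ} (h : Free α S f (pt u w a b))
    (h1 : pt u w a (b + 1) ∈ S) (h2 : pt u w a (b + 2) ∈ S)
    (h3 : baseGrid α (pt u w a (b + 1)) = .red) (h4 : baseGrid α (pt u w a (b + 2)) = .empty) :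
    ∃ g, Runs f (pt u w a b) g (pt u w a (b + 2)) ∧ Free α S g (pt u w a (b + 2)) := by
  have := h.jump (e := (0, 1)) (.inr rfl)
  simp only [pt_up] at this
  exact this h1 h2 h3 h4

theorem Corridor.content_empty {i j u w a b : ℕ} {ρ : Ordinal.{0}} (h : Corridor α i j ρ u w)
    (hr : Road α u w a b) : content α u w a b = .empty := by
  rcases h.plain_or_gadget with ⟨ok, hP⟩ | ⟨σ, -, hG⟩
  · exact hP.content_empty (hP.road.1 hr)
  · exact hG.content_empty (.inl (hG.road.1 hr))

theorem Corridor.run_right {i j u w a b : ℕ} {ρ : Ordinal.{0}} (hC : Corridor α i j ρ u w)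
    (hb : b < 12) (hg : ∀ σ, Gadget α u w i j σ → b = 4 + j) (k : ℕ) (hk : a + 2 * k < 12)
    (hr : ∀ m ≤ k, Road α u w (a + 2 * m) b) {f : Grid}
    (h : Free α (Region u w) f (pt u w a b)) :
    ∃ g, Runs f (pt u w a b) g (pt u w (a + 2 * k) b) ∧
      Free α (Region u w) g (pt u w (a + 2 * k) b) := by
  induction k with
  | zero => exact ⟨f, .refl _ _, h⟩
  | succ k ih =>
    obtain ⟨g, h1, h2⟩ := ih (by omega) fun m hm => hr m (by omega)
    have hed := hC.edge_right (hr k (by omega)) (by omega) hb hg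
    obtain ⟨g', h3, h4⟩ := h2.jump_right hed.2.2
      ((pt_mem_region (by omega) hb).2 .refl) hed.1
      (by rw [baseGrid_pt (by omega) hb]; exact hC.content_empty (hr (k + 1) le_rfl))
    exact ⟨g', h1.trans h3, h4⟩

theorem Corridor.run_up {i j u w a b : ℕ} {ρ : Ordinal.{0}} (hC : Corridor α i j ρ u w)
    (ha : a < 12) (hg : ∀ σ, ¬ Gadget α u w i j σ) (k : ℕ) (hk : b + 2 * k < 12)
    (hr : ∀ m ≤ k, Road α u w a (b + 2 * m)) {f : Grid}
    (h : Free α (Region u w) f (pt u w a b)) :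
    ∃ g, Runs f (pt u w a b) g (pt u w a (b + 2 * k)) ∧
      Free α (Region u w) g (pt u w a (b + 2 * k)) := by
  induction k with
  | zero => exact ⟨f, .refl _ _, h⟩
  | succ k ih =>
    obtain ⟨g, h1, h2⟩ := ih (by omega) fun m hm => hr m (by omega)
    have hed := hC.edge_up (hr k (by omega)) ha (by omega) hg
    obtain ⟨g', h3, h4⟩ := h2.jump_up hed.2.2
      ((pt_mem_region ha (by omega)).2 .refl) hed.1
      (by rw [baseGrid_pt ha (by omega)]; exact hC.content_empty (hr (k + 1) le_rfl))
    exact ⟨g', h1.trans h3, h4⟩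

theorem Corridor.cross_right {i j u w b : ℕ} {ρ : Ordinal.{0}} (hC : Corridor α i j ρ u w)
    (hb : b < 12) (hg : ∀ σ, ¬ Gadget α u w i j σ) (hr : Road α u w (10 + i) b) {f : Grid}
    (h : Free α (Region u w) f (pt u w (10 + i) b)) :
    ∃ g, Runs f (pt u w (10 + i) b) g (pt (u + 1) w i b) ∧
      Free α (Region (u + 1) w) g (pt (u + 1) w i b) := by
  have hk := hC.ok
  obtain ⟨hR, hC', -, hr'⟩ := hC.road_right hr (by omega)
  have hed := hC.edge_right hr (by omega) hb (fun σ hσ => absurd hσ (hg σ))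
  have e : pt u w (10 + i + 2) b = pt (u + 1) w i b := by
    rw [← pt_shift_right]; congr 1; omega
  have h1 := h.jump_right hed.2.2
  rw [e] at h1
  obtain ⟨g, h2, h3⟩ := h1 ((pt_mem_region (by omega) hb).2 (.single (.right hR))) hed.1
    (by rw [baseGrid_pt (by omega) hb]; exact hC'.content_empty hr')
  exact ⟨g, h2, h3.mono (region_subset (.single (.right hR)))⟩

theorem Corridor.cross_up {i j u w a : ℕ} {ρ : Ordinal.{0}} (hC : Corridor α i j ρ u w)
    (ha : a < 12) (hg : ∀ σ, ¬ Gadget α u w i j σ) (hr : Road α u w a (10 + j)) {f : Grid}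
    (h : Free α (Region u w) f (pt u w a (10 + j))) :
    ∃ g, Runs f (pt u w a (10 + j)) g (pt u (w + 1) a j) ∧
      Free α (Region u (w + 1)) g (pt u (w + 1) a j) := by
  have hk := hC.ok
  obtain ⟨hU, hC', -, hr'⟩ := hC.road_up hr (by omega)
  have hed := hC.edge_up hr ha (by omega) hg
  have e : pt u w a (10 + j + 2) = pt u (w + 1) a j := by
    rw [← pt_shift_up]; congr 1; omega
  have h1 := h.jump_up hed.2.2
  rw [e] at h1
  obtain ⟨g, h2, h3⟩ := h1 ((pt_mem_region ha (by omega)).2 (.single (.up hU))) hed.1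
    (by rw [baseGrid_pt ha (by omega)]; exact hC'.content_empty hr')
  exact ⟨g, h2, h3.mono (region_subset (.single (.up hU)))⟩

/-! ### Following a road to its branching cells and exits -/

open Classical in
/-- The landing square on which a road of class `(i, j)` enters a cell. -/
noncomputable def entry (u w i j : ℕ) : Pt :=
  if FromL u w then pt u w i (if GoesR u w then 4 + j else 6 - j) else pt u w (6 - i) j

open Classical in
/-- The ordinate of the landing square on which a road turns away from its entry. -/
noncomputable def turn (u w j : ℕ) : ℕ := if FromL u w ∧ ¬ GoesR u w then 6 - j else 4 + j

/-- The pawn on `v` can continue to the entry of the cell `(u, w)`. -/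
def Reaches (α : Ordinal.{0}) (f : Grid) (v : Pt) (u w : ℕ) (v' : Pt) : Prop :=
  ∃ g, Runs f v g v' ∧ Free α (Region u w) g v'

theorem Reaches.trans {f : Grid} {v v' v'' : Pt} {u w u' w' : ℕ} (h : Reaches α f v u w v')
    (h' : ∀ g, Free α (Region u w) g v' → Reaches α g v' u' w' v'') :
    Reaches α f v u' w' v'' := by
  obtain ⟨g, h1, h2⟩ := h
  obtain ⟨g', h3, h4⟩ := h' g h2
  exact ⟨g', h1.trans h3, h4⟩

theorem Corridor.reaches_turn {i j u w : ℕ} {ρ : Ordinal.{0}} {ok : Prop}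
    (hC : Corridor α i j ρ u w) (hP : Plain α u w i j ok) {f : Grid}
    (h : Free α (Region u w) f (entry u w i j)) :
    Reaches α f (entry u w i j) u w (pt u w (6 - i) (turn u w j)) := by
  have hk := hC.ok
  by_cases hL : FromL u w
  · have e1 : entry u w i j = pt u w i (turn u w j) := by
      by_cases hR : GoesR u w <;> simp [entry, turn, hL, hR]
    have e2 : 6 - i = i + 2 * (3 - i) := by omega
    have ht : turn u w j < 12 ∧ (GoesR u w ∧ turn u w j = 4 + j ∨
        ¬ GoesR u w ∧ turn u w j = 6 - j) := by
      by_cases hR : GoesR u w <;> simp [turn, hL, hR] <;> omega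
    rw [e1, e2]
    rw [e1] at h
    exact hC.run_right ht.1 (fun σ hσ => absurd hσ hP.not_gadget) _ (by omega)
      (fun m hm => hP.road.2 (.inl ⟨hL, by omega, by omega, ht.2⟩)) h
  · have e1 : entry u w i j = pt u w (6 - i) j := by simp only [entry, hL, if_false]
    have e2 : turn u w j = j + 2 * 2 := by
      simp only [turn, hL, false_and, if_false]; omega
    rw [e1, e2]
    rw [e1] at h
    exact hC.run_up (by omega) (fun σ hσ => absurd hσ hP.not_gadget) _ (by omega)
      (fun m hm => hP.road.2 (.inr (.inl ⟨hL, rfl, by omega, by omega⟩))) h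

theorem Corridor.reaches_right {i j u w : ℕ} {ρ : Ordinal.{0}} {ok : Prop}
    (hC : Corridor α i j ρ u w) (hP : Plain α u w i j ok) (hR : GoesR u w) {f : Grid}
    (h : Free α (Region u w) f (entry u w i j)) :
    Reaches α f (entry u w i j) (u + 1) w (entry (u + 1) w i j) := by
  have hk := hC.ok
  have hng : ∀ σ, ¬ Gadget α u w i j σ := fun σ => hP.not_gadget
  refine (hC.reaches_turn hP h).trans fun g hg => ?_
  have et : turn u w j = 4 + j := by simp only [turn, hR, not_true_eq_false, and_false, if_false]
  rw [et] at hg ⊢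
  have hiff := goesR_succ_iff hk.2.2.2 hR
  -- In a branching cell the pawn first climbs from row `4 + j` to row `6 - j`, by one jump if `j =
  -- 0` and none if `j = 1`, because the next cell is entered on that row.
  obtain ⟨b, hb, h2, h3, h4⟩ : ∃ b < 12, Reaches α g (pt u w (6 - i) (4 + j)) u w
      (pt u w (6 - i) b) ∧ (GoesU u w ∧ b = 6 - j ∨ ¬ GoesU u w ∧ b = 4 + j) ∧
      entry (u + 1) w i j = pt (u + 1) w i b := by
    by_cases hU : GoesU u w
    · refine ⟨6 - j, by omega, ?_, .inl ⟨hU, rfl⟩, ?_⟩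
      · have := hC.run_up (by omega) hng (1 - j) (by omega)
          (fun m hm => hP.road.2 (.inr (.inr (.inr ⟨hU, rfl, by omega, by omega,
            .inr (by omega)⟩)))) hg
        rwa [show 4 + j + 2 * (1 - j) = 6 - j by omega] at this
      · simp only [entry, fromL_succ.2 hR, hiff, hU, not_true_eq_false, if_true, if_false]
    · refine ⟨4 + j, by omega, ⟨g, .refl _ _, hg⟩, .inr ⟨hU, rfl⟩, ?_⟩
      simp only [entry, fromL_succ.2 hR, hiff, hU, not_false_eq_true, if_true]
  refine h2.trans fun g' hg' => ?_
  rw [h4]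
  have hr : ∀ m, 6 - i ≤ m → m % 2 = i → Road α u w m b := fun m h1 h2 =>
    hP.road.2 (.inr (.inr (.inl ⟨hR, h2, h1, h3⟩)))
  have h5 : Reaches α g' (pt u w (6 - i) b) u w (pt u w (10 + i) b) := by
    have := hC.run_right hb (fun σ hσ => absurd hσ (hng σ)) (2 + i) (by omega)
      (fun m hm => hr _ (by omega) (by omega)) hg'
    rwa [show 6 - i + 2 * (2 + i) = 10 + i by omega] at this
  exact h5.trans fun g'' hg'' => hC.cross_right hb hng (hr _ (by omega) (by omega)) hg''

theorem Corridor.reaches_up {i j u w : ℕ} {ρ : Ordinal.{0}} {ok : Prop}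
    (hC : Corridor α i j ρ u w) (hP : Plain α u w i j ok) (hok : ok) (hU : GoesU u w) {f : Grid}
    (h : Free α (Region u w) f (entry u w i j)) :
    Reaches α f (entry u w i j) u (w + 1) (entry u (w + 1) i j) := by
  have hk := hC.ok
  have hng : ∀ σ, ¬ Gadget α u w i j σ := fun σ => hP.not_gadget
  refine (hC.reaches_turn hP h).trans fun g hg => ?_
  have ht : turn u w j = 4 + j ∨ turn u w j = 6 - j := by
    simp only [turn]; split_ifs <;> simp
  have e : entry u (w + 1) i j = pt u (w + 1) (6 - i) j := by
    simp only [entry, not_fromL_of_goesU hU, if_false]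
  rw [e]
  have hr : ∀ m, 4 + j ≤ m → m % 2 = j → Road α u w (6 - i) m := fun m h1 h2 =>
    hP.road.2 (.inr (.inr (.inr ⟨hU, rfl, h2, h1, .inl hok⟩)))
  have h5 : Reaches α g (pt u w (6 - i) (turn u w j)) u w (pt u w (6 - i) (10 + j)) := by
    have := hC.run_up (by omega) hng ((10 + j - turn u w j) / 2) (by omega)
      (fun m hm => hr _ (by omega) (by omega)) hg
    rwa [show turn u w j + 2 * ((10 + j - turn u w j) / 2) = 10 + j by omega] at this
  exact h5.trans fun g' hg' => hC.cross_up (by omega) hng (hr _ (by omega) (by omega)) hg'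

/-- A pawn can follow a road to the next branching cell. -/
theorem reaches_branch (i j u w : ℕ) (ρ : Ordinal.{0}) (hC : Corridor α i j ρ u w) (f : Grid)
    (h : Free α (Region u w) f (entry u w i j)) :
    ∃ u' w', GoesR u' w' ∧ GoesU u' w' ∧ cellState α u' w' = cellState α u w ∧
      Reaches α f (entry u w i j) u' w' (entry u' w' i j) := by
  have hk := hC.ok
  have plain : ∀ u w, Corridor α i j ρ u w → ¬ (GoesR u w ∧ GoesU u w) →
      ∃ ok, Plain α u w i j ok ∧ (¬ GoesR u w → ok) := by
    rintro u w (⟨n, h⟩ | ⟨σ, hσ, h⟩) hb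
    · exact ⟨_, .inl ⟨ρ, n, h, Iff.rfl⟩, .inr⟩
    · exact ⟨_, .inr ⟨⟨σ, h⟩, hb, Iff.rfl⟩, fun _ => trivial⟩
  refine cell_induction (motive := fun u w => Corridor α i j ρ u w → ∀ f,
    Free α (Region u w) f (entry u w i j) → ∃ u' w', GoesR u' w' ∧ GoesU u' w' ∧
      cellState α u' w' = cellState α u w ∧
      Reaches α f (entry u w i j) u' w' (entry u' w' i j)) ?_ ?_ ?_ u w (by omega) (by omega) hC f h
  · intro u w _ _ hR hU _ f h
    exact ⟨u, w, hR, hU, rfl, f, .refl _ _, h⟩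
  · intro u w _ _ hR hU ih hC f h
    obtain ⟨ok, hP, -⟩ := plain u w hC fun h => hU h.2
    have hs : cellState α (u + 1) w = cellState α u w := by
      rw [cellState_right hC.ne_dead hR, CellState.right.eq_def, if_neg hU]
    obtain ⟨g, h1, h2⟩ := hC.reaches_right hP hR h
    obtain ⟨u', w', hR', hU', hs', g', h3, h4⟩ := ih (hC.right hP hR) g h2
    exact ⟨u', w', hR', hU', hs'.trans hs, g', h1.trans h3, h4⟩
  · intro u w _ _ hR hU ih hC f h
    obtain ⟨ok, hP, hok⟩ := plain u w hC fun h => hR h.1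
    have hs : cellState α u (w + 1) = cellState α u w := by
      rw [cellState_up hC.ne_dead hU, CellState.up.eq_def, if_neg hR]
    obtain ⟨g, h1, h2⟩ := hC.reaches_up hP (hok hR) hU h
    obtain ⟨u', w', hR', hU', hs', g', h3, h4⟩ := ih (hC.up hP hU (hok hR)) g h2
    exact ⟨u', w', hR', hU', hs'.trans hs, g', h1.trans h3, h4⟩

/-- From the corridor of a node a pawn can reach each exit that lies ahead. -/
theorem reaches_exit (i j : ℕ) (ρ : Ordinal.{0}) (hρ : ρ ≠ 0) (k : ℕ) (n u w : ℕ) (f : Grid)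
    (hs : cellState α u w = .run i j ρ n) (h : Free α (Region u w) f (entry u w i j)) :
    ∃ u' w', Gadget α u' w' i j (listing ρ (n + k)) ∧
      Reaches α f (entry u w i j) u' w' (pt u' w' i (4 + j)) := by
  induction k generalizing n u w f with
  | zero =>
    have hC : Corridor α i j ρ u w := .inl ⟨n, hs⟩
    obtain ⟨u1, w1, hR, hU, hs1, g1, hr1, hf1⟩ := reaches_branch i j u w ρ hC f h
    rw [hs] at hs1
    have hC1 : Corridor α i j ρ u1 w1 := .inl ⟨n, hs1⟩
    have hk := hC1.ok
    -- At the first branching cell ahead the upward arm is the exit to rank `listing ρ n`; it ends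
    -- at the next branching cell on its way.
    obtain ⟨g2, hr2, hf2⟩ := hC1.reaches_up (.inl ⟨ρ, n, hs1, Iff.rfl⟩) (.inl hρ) hU hf1
    have hs2 : cellState α u1 (w1 + 1) = .exit i j (listing ρ n) := by
      rw [cellState_up hC1.ne_dead hU, hs1]
      simp only [CellState.up, hR, hρ, if_true, if_false]
    have hC2 : Corridor α i j ρ u1 (w1 + 1) := .inr ⟨_, listing_lt hρ n, hs2⟩
    obtain ⟨u3, w3, hR3, hU3, hs3, g3, hr3, hf3⟩ := reaches_branch i j _ _ ρ hC2 g2 hf2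
    rw [hs2] at hs3
    have hG : Gadget α u3 w3 i j (listing ρ n) := ⟨hs3, hR3, hU3⟩
    have hk3 := hG.ok
    have e : entry u3 w3 i j = pt u3 w3 i (4 + j) := by
      simp only [entry, fromL_of_branch (by omega : 1 ≤ u3) hk3.2.2.2.2 hR3 hU3, hR3, if_true]
    rw [e] at hr3 hf3
    exact ⟨u3, w3, hG, g3, (hr1.trans hr2).trans hr3, hf3⟩
  | succ k ih =>
    have hC : Corridor α i j ρ u w := .inl ⟨n, hs⟩
    obtain ⟨u1, w1, hR, hU, hs1, g1, hr1, hf1⟩ := reaches_branch i j u w ρ hC f h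
    rw [hs] at hs1
    have hC1 : Corridor α i j ρ u1 w1 := .inl ⟨n, hs1⟩
    obtain ⟨g2, hr2, hf2⟩ := hC1.reaches_right (.inl ⟨ρ, n, hs1, Iff.rfl⟩) hR hf1
    have hs2 : cellState α (u1 + 1) w1 = .run i j ρ (n + 1) := by
      rw [cellState_right hC1.ne_dead hR, hs1]
      simp only [CellState.right, hU, if_true]
    obtain ⟨u3, w3, hG, g3, hr3, hf3⟩ := ih (n + 1) _ _ g2 hs2 hf2
    rw [show n + 1 + k = n + (k + 1) by omega] at hG
    exact ⟨u3, w3, hG, g3, (hr1.trans hr2).trans hr3, hf3⟩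

/-! ### The first player with a piece on the road cannot be stopped in time -/

/-- All black pieces stand on interior squares of the cells. -/
def Inner (f : Grid) : Prop :=
  ∀ s, f s = .black → ∃ u w a b, (1 ≤ a ∧ a ≤ 10) ∧ (1 ≤ b ∧ b ≤ 10) ∧ s = pt u w a b

/-- The squares that the first token of an exit can visit. -/
def RowSet (u w i j : ℕ) : Set Pt :=
  {s | s ∈ Region (u + 1) w ∨ ∃ a, 2 + i ≤ a ∧ a < 12 ∧ s = pt u w a (5 + j)}

/-- The squares that the second token of an exit can visit. -/
def ColSet (u w i j : ℕ) : Set Pt :=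
  {s | s ∈ Region u (w + 1) ∨ ∃ b, 6 + j ≤ b ∧ b < 12 ∧ s = pt u w (5 + i) b}

/-- The first token of an exit is released. -/
def RowOpen (α : Ordinal.{0}) (f : Grid) (u w i j : ℕ) : Prop :=
  f (pt u w (4 + i) (5 + j)) = .empty ∧
    ∀ s ∈ RowSet u w i j, s ≠ pt u w (4 + i) (5 + j) → f s = baseGrid α s

/-- The second token of an exit is released. -/
def ColOpen (α : Ordinal.{0}) (f : Grid) (u w i j : ℕ) : Prop :=
  f (pt u w (5 + i) (8 + j)) = .empty ∧
    ∀ s ∈ ColSet u w i j, s ≠ pt u w (5 + i) (8 + j) → f s = baseGrid α s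

/-- Both tokens of an exit are released. -/
structure Twin (α : Ordinal.{0}) (f : Grid) (u w i j : ℕ) : Prop where
  inner : Inner f
  row : RowOpen α f u w i j
  col : ColOpen α f u w i j
  black : ∀ a b, a < 12 → b < 12 → f (pt u w a b) = .black → a = 2 + i ∧ b = 5 + j ∨
    a = 5 + i ∧ b = 6 + j ∨ a = 6 + i ∧ b = 8 + j

theorem Gadget.token_of_black {u w i j a b : ℕ} {ρ : Ordinal.{0}} (h : Gadget α u w i j ρ)
    (ha : a < 12) (hb : b < 12) (hs : baseGrid α (pt u w a b) = .black) :
    a = 2 + i ∧ b = 5 + j ∨ a = 5 + i ∧ b = 6 + j := by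
  obtain ⟨u', w', a', b', ha', hb', he, i', j', ρ', hG, hT⟩ := baseGrid_eq_black hs
  obtain ⟨rfl, rfl, rfl, rfl⟩ := pt_inj he ha hb ha' hb'
  obtain ⟨rfl, rfl, -⟩ := h.unique hG
  exact hT

theorem inner_baseGrid : Inner (baseGrid α) := by
  intro s hs
  obtain ⟨u, w, a, b, -, -, rfl, i, j, ρ, hG, hT⟩ := baseGrid_eq_black hs
  have := hG.ok
  exact ⟨u, w, a, b, by omega, by omega, rfl⟩

/-! ### Release of both tokens -/

/-- A pawn that arrives at an exit releases both tokens. -/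
theorem Gadget.twin {u w i j : ℕ} {ρ : Ordinal.{0}} {f : Grid} (hG : Gadget α u w i j ρ)
    (h : Free α (Region u w) f (pt u w (4 + i) (4 + j))) (hin : Inner f) :
    ∃ g, Runs f (pt u w (4 + i) (4 + j)) g (pt u w (6 + i) (8 + j)) ∧ Twin α g u w i j := by
  have hk := hG.ok
  have hf : ∀ a b, a < 12 → b < 12 → (4 + i < a ∨ 4 + j < b) →
      f (pt u w a b) = content α u w a b := by
    intro a b ha hb hab
    rw [h.2.1 _ ((pt_mem_region ha hb).2 .refl) (not_pt_le hab), baseGrid_pt ha hb]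
  -- The three jumps remove the red pawns on `(4 + i, 5 + j)`, `(4 + i, 7 + j)` and `(5 + i, 8 +
  -- j)`; the first and the last of these squares are the release squares.
  obtain ⟨g1, hg1⟩ : ∃ g, g = f.jumped .black (pt u w (4 + i) (4 + j)) (0, 1) := ⟨_, rfl⟩
  obtain ⟨g2, hg2⟩ : ∃ g, g = g1.jumped .black (pt u w (4 + i) (6 + j)) (0, 1) := ⟨_, rfl⟩
  obtain ⟨g3, hg3⟩ : ∃ g, g = g2.jumped .black (pt u w (4 + i) (8 + j)) (1, 0) := ⟨_, rfl⟩
  have h1 : ∀ s, g1 s = _ := fun s => hg1 ▸ jumped_black_apply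
  have h2 : ∀ s, g2 s = _ := fun s => hg2 ▸ jumped_black_apply
  have h3 : ∀ s, g3 s = _ := fun s => hg3 ▸ jumped_black_apply
  simp only [pt_up, pt_right, show 4 + j + 1 = 5 + j by omega, show 5 + j + 1 = 6 + j by omega,
    show 6 + j + 1 = 7 + j by omega, show 7 + j + 1 = 8 + j by omega,
    show 4 + i + 1 = 5 + i by omega, show 5 + i + 1 = 6 + i by omega] at h1 h2 h3
  have hr1 : Runs f (pt u w (4 + i) (4 + j)) g1 (pt u w (4 + i) (6 + j)) := by
    refine .single ⟨_, (0, 1), .inr rfl, rfl, ?_, ?_, ?_⟩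
    · dsimp only
      rw [pt_up, show 4 + j + 1 = 5 + j by omega, hf _ _ (by omega) (by omega) (by omega)]
      exact hG.content_red (by simp only [EndRoad]; omega) (by omega)
    · dsimp only
      rw [pt_up, pt_up, show 4 + j + 1 + 1 = 6 + j by omega, hf _ _ (by omega) (by omega) (by omega)]
      exact hG.content_empty (.inl (.inr (.inl ⟨rfl, .inl rfl⟩)))
    · dsimp only
      rw [pt_up, pt_up, hg1]
      congr 2; omega
  have hr2 : Runs g1 (pt u w (4 + i) (6 + j)) g2 (pt u w (4 + i) (8 + j)) := by
    refine .single ⟨_, (0, 1), .inr rfl, rfl, ?_, ?_, ?_⟩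
    · dsimp only
      rw [pt_up, show 6 + j + 1 = 7 + j by omega, h1, if_neg (by rw [pt_eq_iff]; omega),
        if_neg (by simp only [pt_eq_iff]; omega), hf _ _ (by omega) (by omega) (by omega)]
      exact hG.content_red (by simp only [EndRoad]; omega) (by omega)
    · dsimp only
      rw [pt_up, pt_up, show 6 + j + 1 + 1 = 8 + j by omega, h1, if_neg (by rw [pt_eq_iff]; omega),
        if_neg (by simp only [pt_eq_iff]; omega), hf _ _ (by omega) (by omega) (by omega)]
      exact hG.content_empty (.inl (.inr (.inl ⟨rfl, .inr rfl⟩)))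
    · dsimp only
      rw [pt_up, pt_up, hg2]
      congr 2; omega
  have hr3 : Runs g2 (pt u w (4 + i) (8 + j)) g3 (pt u w (6 + i) (8 + j)) := by
    refine .single ⟨_, (1, 0), .inl rfl, rfl, ?_, ?_, ?_⟩
    · dsimp only
      rw [pt_right, show 4 + i + 1 = 5 + i by omega, h2, if_neg (by rw [pt_eq_iff]; omega),
        if_neg (by simp only [pt_eq_iff]; omega), h1, if_neg (by rw [pt_eq_iff]; omega),
        if_neg (by simp only [pt_eq_iff]; omega), hf _ _ (by omega) (by omega) (by omega)]
      exact hG.content_red (by simp only [EndRoad]; omega) (by omega)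
    · dsimp only
      rw [pt_right, pt_right, show 4 + i + 1 + 1 = 6 + i by omega, h2,
        if_neg (by rw [pt_eq_iff]; omega),
        if_neg (by simp only [pt_eq_iff]; omega), h1, if_neg (by rw [pt_eq_iff]; omega),
        if_neg (by simp only [pt_eq_iff]; omega), hf _ _ (by omega) (by omega) (by omega)]
      exact hG.content_empty (.inl (.inr (.inr ⟨rfl, rfl⟩)))
    · dsimp only
      rw [pt_right, pt_right, hg3]
      congr 2; omega
  have hr := (hr1.trans hr2).trans hr3
  have hsame : ∀ s ∈ Region u w, (∀ a b, a < 12 → b < 12 → s = pt u w a b →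
      (4 + i < a ∨ 4 + j < b) ∧ ¬ (a = 4 + i ∧ b ≤ 8 + j) ∧
        ¬ ((a = 5 + i ∨ a = 6 + i) ∧ b = 8 + j)) → ¬ s ≤ pt u w (4 + i) (4 + j) →
      g3 s = baseGrid α s := by
    intro s hs hne hle
    have key : ∀ a b, a < 12 → b < 12 →
        ((4 + i < a ∨ 4 + j < b) ∧ ¬ (a = 4 + i ∧ b ≤ 8 + j) ∧
        ¬ ((a = 5 + i ∨ a = 6 + i) ∧ b = 8 + j) → False) → s ≠ pt u w a b :=
      fun a b ha hb hn he => hn (hne a b ha hb he)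
    rw [h3, if_neg (key _ _ (by omega) (by omega) (by omega)), if_neg, h2,
      if_neg (key _ _ (by omega) (by omega) (by omega)), if_neg, h1,
      if_neg (key _ _ (by omega) (by omega) (by omega)), if_neg, h.2.1 s hs hle]
    · rintro (h | h)
      exacts [key _ _ (by omega) (by omega) (by omega) h, key _ _ (by omega) (by omega) (by omega) h]
    · rintro (h | h)
      exacts [key _ _ (by omega) (by omega) (by omega) h, key _ _ (by omega) (by omega) (by omega) h]
    · rintro (h | h)
      exacts [key _ _ (by omega) (by omega) (by omega) h, key _ _ (by omega) (by omega) (by omega) h]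
  have hfarther : ∀ s, (s ∈ Region (u + 1) w ∨ s ∈ Region u (w + 1)) → g3 s = baseGrid α s := by
    intro s hs
    have hs' : (12 * (u + 1) : ℤ) ≤ s.1 ∨ (12 * (w + 1) : ℤ) ≤ s.2 := by
      rcases hs with hs | hs <;> have := le_of_mem_region hs <;> push_cast at this
      exacts [.inl this.1, .inr this.2]
    refine hsame s ?_ ?_ ?_
    · rcases hs with hs | hs
      exacts [region_subset (.single (.right hG.2.1)) hs, region_subset (.single (.up hG.2.2)) hs]
    · rintro a b ha hb rfl
      simp only [pt] at hs'
      omega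
    · intro hle
      have h1 := hle.1
      have h2 := hle.2
      simp only [pt] at h1 h2
      push_cast at h1 h2
      omega
  have htile : ∀ a b, a < 12 → b < 12 → (4 + i < a ∨ 4 + j < b) → ¬ (a = 4 + i ∧ b ≤ 8 + j) →
      ¬ ((a = 5 + i ∨ a = 6 + i) ∧ b = 8 + j) → g3 (pt u w a b) = baseGrid α (pt u w a b) := by
    intro a b ha hb h1 h2 h3
    refine hsame _ ((pt_mem_region ha hb).2 .refl) ?_ (not_pt_le h1)
    intro a' b' _ _ he
    rw [pt_eq_iff] at he
    omega
  refine ⟨g3, hr, fun s hs => ?_, ⟨?_, ?_⟩, ⟨?_, ?_⟩, fun a b ha hb hs => ?_⟩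
  · rcases hr.black hs with rfl | hs
    · exact ⟨u, w, 6 + i, 8 + j, by omega, by omega, rfl⟩
    · exact hin s hs
  · rw [h3, if_neg (by rw [pt_eq_iff]; omega), if_neg (by simp only [pt_eq_iff]; omega), h2,
      if_neg (by rw [pt_eq_iff]; omega), if_neg (by simp only [pt_eq_iff]; omega), h1,
      if_neg (by rw [pt_eq_iff]; omega), if_pos (.inr rfl)]
  · rintro s (hs | ⟨a, h1, h2, rfl⟩) hne
    · exact hfarther s (.inl hs)
    · rw [Ne, pt_eq_iff] at hne
      exact htile _ _ h2 (by omega) (by omega) (by omega) (by omega)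
  · rw [h3, if_neg (by rw [pt_eq_iff]; omega), if_pos (.inr rfl)]
  · rintro s (hs | ⟨b, h1, h2, rfl⟩) hne
    · exact hfarther s (.inr hs)
    · rw [Ne, pt_eq_iff] at hne
      exact htile _ _ (by omega) h2 (by omega) (by omega) (by omega)
  · have hv : ¬ (a = 4 + i ∧ b = 4 + j) := by
      rintro ⟨rfl, rfl⟩
      rw [h3, if_neg (by rw [pt_eq_iff]; omega), if_neg (by simp only [pt_eq_iff]; omega), h2,
        if_neg (by rw [pt_eq_iff]; omega), if_neg (by simp only [pt_eq_iff]; omega), h1,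
        if_neg (by rw [pt_eq_iff]; omega), if_pos (.inl rfl)] at hs
      cases hs
    rcases hr.black hs with he | hs'
    · rw [pt_eq_iff] at he
      exact .inr (.inr he)
    · have := (h.2.2 _ ((pt_mem_region ha hb).2 .refl) hs').resolve_left (by rwa [pt_eq_iff])
      exact (hG.token_of_black ha hb this).imp_right .inl

/-- The token jumps onto its release square and follows row `5 + j`, which is row `6 - (1 - j)`, the
entry of the next corridor. The first jump is kept apart because a turn needs at least one. -/
theorem RowOpen.reaches {u w i j : ℕ} {ρ : Ordinal.{0}} {f : Grid} (hG : Gadget α u w i j ρ)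
    (h : RowOpen α f u w i j) : f (pt u w (2 + i) (5 + j)) = .black ∧
    ∃ y, (∃ c, GridJump .black c (f, pt u w (2 + i) (5 + j)) y) ∧
      Reaches α y.1 y.2 (u + 1) w (entry (u + 1) w i (1 - j)) := by
  have hk := hG.ok
  obtain ⟨ok, hP⟩ := hG.plain_right
  have hC := hG.corridor_right
  have hS : ∀ a, 2 + i ≤ a → a < 12 → pt u w a (5 + j) ∈ RowSet u w i j :=
    fun a h1 h2 => .inr ⟨a, h1, h2, rfl⟩
  have hf : ∀ a, 2 + i ≤ a → a < 12 → a ≠ 4 + i → f (pt u w a (5 + j)) = content α u w a (5 + j) := by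
    intro a h1 h2 h3
    rw [h.2 _ (hS a h1 h2) (by rw [Ne, pt_eq_iff]; omega), baseGrid_pt h2 (by omega)]
  have hblack : f (pt u w (2 + i) (5 + j)) = .black := by
    rw [hf _ (by omega) (by omega) (by omega), hG.content_black (by omega)]
  refine ⟨hblack, ?_⟩
  have hj := free_jumped (α := α) (f := f) (S := RowSet u w i j) (v := pt u w (2 + i) (5 + j))
    (e := (1, 0)) (.inl rfl)
  simp only [pt_right, show 2 + i + 1 = 3 + i by omega, show 3 + i + 1 = 4 + i by omega] at hj
  obtain ⟨hj1, hj2⟩ := hj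
    (fun s hs hle => h.2 s hs fun he => hle he.le)
    (fun s hs hb => .inr (by
      rw [← h.2 s hs, hb]
      rintro rfl
      rw [h.1] at hb
      cases hb))
    (by rw [hf _ (by omega) (by omega) (by omega)]
        exact hG.content_red (by simp only [EndRoad]; omega) (by omega)) h.1
  refine ⟨_, hj1, ?_⟩
  have hrun : ∀ k ≤ 3, ∃ g, Runs (f.jumped .black (pt u w (2 + i) (5 + j)) (1, 0))
      (pt u w (4 + i) (5 + j)) g (pt u w (4 + i + 2 * k) (5 + j)) ∧
      Free α (RowSet u w i j) g (pt u w (4 + i + 2 * k) (5 + j)) := by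
    intro k hk'
    induction k with
    | zero => exact ⟨_, .refl _ _, hj2⟩
    | succ k ih =>
      obtain ⟨g, h1, h2⟩ := ih (by omega)
      obtain ⟨g', h3, h4⟩ := h2.jump_right (hS _ (by omega) (by omega)) (hS _ (by omega) (by omega))
        (by rw [baseGrid_pt (by omega) (by omega)]
            exact hG.content_red (by simp only [EndRoad]; omega) (by omega))
        (by rw [baseGrid_pt (by omega) (by omega)]
            exact hG.content_empty (.inr (.inl (by omega))))
      exact ⟨g', h1.trans h3, h4⟩
  obtain ⟨g, h1, h2⟩ := hrun 3 le_rfl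
  rw [show 4 + i + 2 * 3 = 10 + i by omega] at h1 h2
  have e : pt u w (10 + i + 2) (5 + j) = pt (u + 1) w i (5 + j) := by
    rw [← pt_shift_right]; congr 1; omega
  have e' : entry (u + 1) w i (1 - j) = pt (u + 1) w i (5 + j) := by
    simp only [entry, fromL_succ.2 hG.2.1, goesR_succ_iff hk.2.2.2.2 hG.2.1, hG.2.2,
      not_true_eq_false, if_true, if_false]
    congr 1; omega
  have h3 := h2.jump_right
  rw [e] at h3
  have hreg : ∀ a, a < 12 → pt (u + 1) w a (5 + j) ∈ RowSet u w i j :=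
    fun a ha => .inl ((pt_mem_region ha (by omega)).2 .refl)
  obtain ⟨g', h4, h5⟩ := h3
    (by
      rcases Nat.lt_or_ge (10 + i + 1) 12 with h | h
      · exact hS _ (by omega) h
      · obtain rfl : i = 1 := by omega
        rw [show 10 + 1 + 1 = 0 + 12 from rfl, pt_shift_right]
        exact hreg _ (by omega))
    (hreg _ (by omega))
    (by
      rcases Nat.lt_or_ge (10 + i + 1) 12 with h | h
      · rw [baseGrid_pt h (by omega)]
        exact hG.content_red (by simp only [EndRoad]; omega) (by omega)
      · obtain rfl : i = 1 := by omega
        rw [show 10 + 1 + 1 = 0 + 12 from rfl, pt_shift_right, baseGrid_pt (by omega) (by omega)]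
        exact hP.content_red_of_parity (by omega))
    (by rw [baseGrid_pt (by omega) (by omega)]; exact hC.content_empty hG.road_right)
  rw [e']
  exact ⟨g', h1.trans h4, h5.mono fun s hs => .inl hs⟩

theorem ColOpen.reaches {u w i j : ℕ} {ρ : Ordinal.{0}} {f : Grid} (hG : Gadget α u w i j ρ)
    (h : ColOpen α f u w i j) : f (pt u w (5 + i) (6 + j)) = .black ∧
    ∃ y, (∃ c, GridJump .black c (f, pt u w (5 + i) (6 + j)) y) ∧
      Reaches α y.1 y.2 u (w + 1) (entry u (w + 1) (1 - i) j) := by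
  have hk := hG.ok
  have hP : Plain α u (w + 1) (1 - i) j (ρ ≠ 0 ∨ ¬ GoesR u (w + 1)) :=
    .inl ⟨ρ, 0, hG.up, Iff.rfl⟩
  have hS : ∀ b, 6 + j ≤ b → b < 12 → pt u w (5 + i) b ∈ ColSet u w i j :=
    fun b h1 h2 => .inr ⟨b, h1, h2, rfl⟩
  have hf : ∀ b, 6 + j ≤ b → b < 12 → b ≠ 8 + j → f (pt u w (5 + i) b) = content α u w (5 + i) b := by
    intro b h1 h2 h3
    rw [h.2 _ (hS b h1 h2) (by rw [Ne, pt_eq_iff]; omega), baseGrid_pt (by omega) h2]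
  have hblack : f (pt u w (5 + i) (6 + j)) = .black := by
    rw [hf _ (by omega) (by omega) (by omega), hG.content_black (by omega)]
  refine ⟨hblack, ?_⟩
  have hj := free_jumped (α := α) (f := f) (S := ColSet u w i j) (v := pt u w (5 + i) (6 + j))
    (e := (0, 1)) (.inr rfl)
  simp only [pt_up, show 6 + j + 1 = 7 + j by omega, show 7 + j + 1 = 8 + j by omega] at hj
  obtain ⟨hj1, hj2⟩ := hj
    (fun s hs hle => h.2 s hs fun he => hle he.le)
    (fun s hs hb => .inr (by
      rw [← h.2 s hs, hb]
      rintro rfl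
      rw [h.1] at hb
      cases hb))
    (by rw [hf _ (by omega) (by omega) (by omega)]
        exact hG.content_red (by simp only [EndRoad]; omega) (by omega)) h.1
  refine ⟨_, hj1, ?_⟩
  obtain ⟨g, h1, h2⟩ := hj2.jump_up (hS _ (by omega) (by omega)) (hS _ (by omega) (by omega))
    (by rw [baseGrid_pt (by omega) (by omega)]
        exact hG.content_red (by simp only [EndRoad]; omega) (by omega))
    (by rw [baseGrid_pt (by omega) (by omega)]
        exact hG.content_empty (.inr (.inr (by omega))))
  rw [show 8 + j + 2 = 10 + j by omega] at h1 h2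
  have e : pt u w (5 + i) (10 + j + 2) = pt u (w + 1) (5 + i) j := by
    rw [← pt_shift_up]; congr 1; omega
  have e' : entry u (w + 1) (1 - i) j = pt u (w + 1) (5 + i) j := by
    simp only [entry, not_fromL_of_goesU hG.2.2, if_false]
    congr 1; omega
  have h3 := h2.jump_up
  rw [e] at h3
  have hreg : ∀ b, b < 12 → pt u (w + 1) (5 + i) b ∈ ColSet u w i j :=
    fun b hb => .inl ((pt_mem_region (by omega) hb).2 .refl)
  obtain ⟨g', h4, h5⟩ := h3
    (by
      rcases Nat.lt_or_ge (10 + j + 1) 12 with h | h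
      · exact hS _ (by omega) h
      · obtain rfl : j = 1 := by omega
        rw [show 10 + 1 + 1 = 0 + 12 from rfl, pt_shift_up]
        exact hreg _ (by omega))
    (hreg _ (by omega))
    (by
      rcases Nat.lt_or_ge (10 + j + 1) 12 with h | h
      · rw [baseGrid_pt (by omega) h]
        exact hG.content_red (by simp only [EndRoad]; omega) (by omega)
      · obtain rfl : j = 1 := by omega
        rw [show 10 + 1 + 1 = 0 + 12 from rfl, pt_shift_up, baseGrid_pt (by omega) (by omega)]
        exact hP.content_red_of_parity (by omega))
    (by
      rw [baseGrid_pt (by omega) (by omega)]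
      exact hP.content_empty (.inr (.inl ⟨not_fromL_of_goesU hG.2.2, by omega, by omega, by omega⟩)))
  rw [e']
  exact ⟨g', h1.trans h4, h5.mono fun s hs => .inl hs⟩

/-- A released token can reach an exit of any smaller rank. -/
theorem exists_twin {u w i j : ℕ} {ρ σ : Ordinal.{0}} {f : Grid} (hG : Gadget α u w i j ρ)
    (hρ : ρ.card ≤ Cardinal.aleph0) (hσ : σ < ρ) (hin : Inner f)
    (h : RowOpen α f u w i j ∨ ColOpen α f u w i j) :
    ∃ g u' w' i' j', GridMove .black f g ∧ Gadget α u' w' i' j' σ ∧ Twin α g u' w' i' j' := by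
  obtain ⟨n, rfl⟩ := exists_listing_eq hρ hσ
  have hρ0 : ρ ≠ 0 := (pos_of_gt hσ).ne'
  obtain ⟨p, hp, y, hy, u1, w1, i1, j1, hs1, g1, hr1, hf1⟩ : ∃ p, f p = .black ∧
      ∃ y, (∃ c, GridJump .black c (f, p) y) ∧ ∃ u1 w1 i1 j1,
        cellState α u1 w1 = .run i1 j1 ρ 0 ∧ Reaches α y.1 y.2 u1 w1 (entry u1 w1 i1 j1) := by
    rcases h with h | h
    · obtain ⟨hb, y, hy, hr⟩ := h.reaches hG
      exact ⟨_, hb, y, hy, _, _, _, _, hG.right, hr⟩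
    · obtain ⟨hb, y, hy, hr⟩ := h.reaches hG
      exact ⟨_, hb, y, hy, _, _, _, _, hG.up, hr⟩
  obtain ⟨u2, w2, hG2, g2, hr2, hf2⟩ := reaches_exit i1 j1 ρ hρ0 n 0 u1 w1 g1 hs1 hf1
  rw [zero_add] at hG2
  have hk := hG2.ok
  have hC2 : Corridor α i1 j1 ρ u2 w2 := .inr ⟨_, hσ, hG2.1⟩
  have h3 := hC2.run_right (b := 4 + j1) (by omega) (fun _ _ => rfl) 2 (by omega)
    (fun m hm => hG2.road.2 (.inl ⟨by omega, by omega, rfl⟩)) hf2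
  rw [show i1 + 2 * 2 = 4 + i1 by omega] at h3
  obtain ⟨g3, hr3, hf3⟩ := h3
  have hstart : Runs f p g3 (pt u2 w2 (4 + i1) (4 + j1)) :=
    Relation.ReflTransGen.head hy ((hr1.trans hr2).trans hr3)
  have hin3 : Inner g3 := by
    intro s hs
    rcases hstart.black hs with rfl | hs
    · exact ⟨u2, w2, _, _, by omega, by omega, rfl⟩
    · exact hin s hs
  obtain ⟨g4, hr4, hT⟩ := hG2.twin hf3 hin3
  refine ⟨g4, u2, w2, i1, j1, ⟨p, hp, .inr (.inl ⟨pt u2 w2 (6 + i1) (8 + j1), ?_⟩)⟩, hG2, hT⟩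
  exact Relation.TransGen.head' hy (((hr1.trans hr2).trans hr3).trans hr4)

/-! ### Red cannot block both tokens in one turn -/

/-- The squares of the cell `(u, w)`. -/
def Tile (u w : ℕ) : Set Pt := {s | ∃ a b, a < 12 ∧ b < 12 ∧ s = pt u w a b}

theorem tile_unique {u w u' w' : ℕ} {s : Pt} (h : s ∈ Tile u w) (h' : s ∈ Tile u' w') :
    u = u' ∧ w = w' := by
  obtain ⟨a, b, ha, hb, rfl⟩ := h
  obtain ⟨a', b', ha', hb', h⟩ := h'
  obtain ⟨h1, h2, -, -⟩ := pt_inj h ha hb ha' hb'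
  exact ⟨h1, h2⟩

theorem mem_region_of_tile {u w u' w' : ℕ} {s : Pt} (h : s ∈ Region u w) (h' : s ∈ Tile u' w') :
    Reach (u, w) (u', w') := by
  obtain ⟨a, b, ha, hb, rfl⟩ := h'
  exact (pt_mem_region ha hb).1 h

theorem RowOpen.congr {f f' : Grid} {u w i j : ℕ} (hi : i < 2) (h : RowOpen α f u w i j)
    (hf : ∀ s ∈ RowSet u w i j, f' s = f s) : RowOpen α f' u w i j :=
  ⟨(hf _ (.inr ⟨4 + i, by omega, by omega, rfl⟩)).trans h.1,
    fun s hs hne => (hf s hs).trans (h.2 s hs hne)⟩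

theorem ColOpen.congr {f f' : Grid} {u w i j : ℕ} (hj : j < 2) (h : ColOpen α f u w i j)
    (hf : ∀ s ∈ ColSet u w i j, f' s = f s) : ColOpen α f' u w i j :=
  ⟨(hf _ (.inr ⟨8 + j, by omega, by omega, rfl⟩)).trans h.1,
    fun s hs hne => (hf s hs).trans (h.2 s hs hne)⟩

/-- The set of squares that concern the first token is disjoint from that of the second. -/
theorem not_mem_colSet {u w i j : ℕ} {s : Pt} (hi : i < 2) (hj : j < 2)
    (h : s ∈ RowSet u w i j) : s ∉ ColSet u w i j := by
  rintro (h' | ⟨b, hb, hb', rfl⟩)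
  · rcases h with h | ⟨a, ha, ha', rfl⟩
    · exact region_disjoint h h'
    · have := (le_of_mem_region h').2
      simp only [pt] at this
      push_cast at this
      omega
  · rcases h with h | ⟨a, ha, ha', h⟩
    · have := (le_of_mem_region h).1
      simp only [pt] at this
      push_cast at this
      omega
    · rw [pt_eq_iff] at h
      omega

/-- The last column of a cell is vacated only by an arm leaving to the right or by the row of a
first token. -/
theorem goesR_of_content_empty {u w b : ℕ} (h : content α u w 11 b = .empty) : GoesR u w := by
  have hV : Vacant α u w 11 b := by
    by_contra hV
    rw [content, if_neg hV] at h
    split_ifs at h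
  rcases hV with hr | ⟨i, j, ρ, hG, -⟩
  · have hs := cellState_ok (α := α) u w
    rw [Road] at hr
    revert hr hs
    cases cellState α u w with
    | dead => exact fun h => h.elim
    | run i j ρ n =>
      intro hr hs
      simp only [CellState.Ok] at hs
      simp only [Arms] at hr
      by_contra hR
      simp only [hR, false_and, false_or] at hr
      omega
    | exit i j ρ =>
      intro hr hs
      simp only [CellState.Ok] at hs
      simp only [Arms] at hr
      by_contra hR
      simp only [hR, false_and, false_or] at hr
      omega
  · exact hG.2.1

theorem goesU_of_content_empty {u w a : ℕ} (h : content α u w a 11 = .empty) : GoesU u w := by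
  have hV : Vacant α u w a 11 := by
    by_contra hV
    rw [content, if_neg hV] at h
    split_ifs at h
  rcases hV with hr | ⟨i, j, ρ, hG, -⟩
  · have hs := cellState_ok (α := α) u w
    rw [Road] at hr
    revert hr hs
    cases cellState α u w with
    | dead => exact fun h => h.elim
    | run i j ρ n =>
      intro hr hs
      simp only [CellState.Ok] at hs
      simp only [Arms] at hr
      by_contra hU
      simp only [hU, false_and, or_false, not_false_eq_true, true_and, false_or] at hr
      omega
    | exit i j ρ =>
      intro hr hs
      simp only [CellState.Ok] at hs
      simp only [Arms] at hr
      by_contra hU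
      simp only [hU, and_false, false_and, false_or, or_false] at hr
      omega
  · exact hG.2.2

/-- Read backwards, for Red: a red pawn stepping onto an originally empty square of a region comes
from the same region. -/
theorem add_mem_region {u w : ℕ} {s e : Pt} (h : s ∈ Region u w) (hs : baseGrid α s = .empty)
    (he : Player.black.Step e) : s + e ∈ Region u w := by
  obtain ⟨u', w', a, b, hr, ha, hb, rfl⟩ := h
  rw [baseGrid_pt ha hb] at hs
  rcases he with rfl | rfl
  · rw [pt_right]
    rcases Nat.lt_or_ge (a + 1) 12 with h | h
    · exact (pt_mem_region h hb).2 hr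
    · obtain rfl : a = 11 := by omega
      rw [show 11 + 1 = 0 + 12 from rfl, pt_shift_right]
      exact (pt_mem_region (by omega) hb).2 (hr.tail (.right (goesR_of_content_empty hs)))
  · rw [pt_up]
    rcases Nat.lt_or_ge (b + 1) 12 with h | h
    · exact (pt_mem_region ha h).2 hr
    · obtain rfl : b = 11 := by omega
      rw [show 11 + 1 = 0 + 12 from rfl, pt_shift_up]
      exact (pt_mem_region ha (by omega)).2 (hr.tail (.up (goesU_of_content_empty hs)))

/-- A simple red move ends on an empty square `s` and starts on some `s + e`. So a move ending among
the squares of the first token does not start among those of the second. -/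
theorem RowOpen.add_not_mem {f : Grid} {u w i j : ℕ} {ρ : Ordinal.{0}} {s e : Pt}
    (hG : Gadget α u w i j ρ) (h : RowOpen α f u w i j) (hs : s ∈ RowSet u w i j)
    (hfs : f s = .empty) (he : Player.black.Step e) : s + e ∉ ColSet u w i j := by
  have hk := hG.ok
  by_cases hne : s = pt u w (4 + i) (5 + j)
  · subst hne
    rintro (h1 | ⟨b, hb, hb', h1⟩)
    · have := (le_of_mem_region h1).2
      rcases he with rfl | rfl <;> simp only [pt_right, pt_up] at this <;>
        simp only [pt] at this <;> push_cast at this <;> omega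
    · rcases he with rfl | rfl <;> simp only [pt_right, pt_up, pt_eq_iff] at h1 <;> omega
  · have hbase := (h.2 s hs hne).symm.trans hfs
    rcases hs with hs | ⟨a, ha, ha', rfl⟩
    · exact not_mem_colSet hk.1 hk.2.1 (.inl (add_mem_region hs hbase he))
    · rw [pt_eq_iff] at hne
      -- Empty squares of the row have parity `i`, whereas the column of the second token is `5 +
      -- i`; so none of them lies directly below that column.
      have hpar : a % 2 = i := by
        by_contra hpar
        rw [baseGrid_pt ha' (by omega), hG.content_red (by simp only [EndRoad]; omega) (by omega)]
          at hbase
        cases hbase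
      rintro (h1 | ⟨b, hb, hb', h1⟩)
      · have := (le_of_mem_region h1).2
        rcases he with rfl | rfl <;> simp only [pt_right, pt_up] at this <;> simp only [pt] at this <;>
          push_cast at this <;> omega
      · rcases he with rfl | rfl <;> simp only [pt_right, pt_up, pt_eq_iff] at h1 <;> omega

theorem ColOpen.add_not_mem {f : Grid} {u w i j : ℕ} {ρ : Ordinal.{0}} {s e : Pt}
    (hG : Gadget α u w i j ρ) (h : ColOpen α f u w i j) (hs : s ∈ ColSet u w i j)
    (hfs : f s = .empty) (he : Player.black.Step e) : s + e ∉ RowSet u w i j := by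
  have hk := hG.ok
  have key : ∀ b, 6 + j ≤ b → b < 12 → pt u w (5 + i) b + e ∉ RowSet u w i j := by
    rintro b hb hb' (h1 | ⟨a, ha, ha', h1⟩)
    · have := (le_of_mem_region h1).1
      rcases he with rfl | rfl <;> simp only [pt_right, pt_up] at this <;> simp only [pt] at this <;>
        push_cast at this <;> omega
    · rcases he with rfl | rfl <;> simp only [pt_right, pt_up, pt_eq_iff] at h1 <;> omega
  rcases hs with hs | ⟨b, hb, hb', rfl⟩
  · have hne : s ≠ pt u w (5 + i) (8 + j) := by
      rintro rfl
      have := (le_of_mem_region hs).2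
      simp only [pt] at this
      push_cast at this
      omega
    have hbase := (h.2 s (.inl hs) hne).symm.trans hfs
    exact fun h' => not_mem_colSet hk.1 hk.2.1 h' (.inl (add_mem_region hs hbase he))
  · exact key b hb hb'

/-! ### Turns of Red after both tokens are released -/

theorem eq_add_left (v : Pt) : v = v + (-1, 0) + (1, 0) := by
  obtain ⟨x, y⟩ := v
  simp

theorem eq_add_down (v : Pt) : v = v + (0, -1) + (0, 1) := by
  obtain ⟨x, y⟩ := v
  simp

/-- A jump of a red pawn stays within one cell. -/
theorem Inner.red_jump {f : Grid} {v c : Pt} {y : Grid × Pt} (hin : Inner f)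
    (h : GridJump .red c (f, v) y) : ∃ u w a b, (1 ≤ a ∧ a ≤ 10) ∧ (1 ≤ b ∧ b ≤ 10) ∧
      f (pt u w a b) = .black ∧ c = pt u w a b ∧
      (v = pt u w (a + 1) b ∧ y.2 = pt u w (a - 1) b ∨
        v = pt u w a (b + 1) ∧ y.2 = pt u w a (b - 1)) ∧ f y.2 = .empty ∧
      (∀ s, y.1 s = .black → f s = .black) ∧
      ∀ s, s ≠ v → s ≠ c → s ≠ y.2 → y.1 s = f s := by
  obtain ⟨e, he, rfl, h1, h2, rfl⟩ := h
  simp only at h1 h2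
  obtain ⟨u, w, a, b, ha, hb, hc⟩ := hin _ h1
  have hval : ∀ s, s ≠ v → s ≠ v + e → s ≠ v + e + e → f.jumped .red v e s = f s := by
    intro s h1 h2 h3
    simp only [Grid.jumped, Function.update_apply, h1, h2, h3, if_false]
  refine ⟨u, w, a, b, ha, hb, hc ▸ h1, hc, ?_, h2, fun s hs => ?_, hval⟩
  · rcases he with rfl | rfl
    · left
      constructor
      · rw [← pt_right, ← hc]; exact eq_add_left v
      · rw [hc, ← pt_sub_right u w (a - 1), show a - 1 + 1 = a by omega]
        simp [sub_eq_add_neg]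
    · right
      constructor
      · rw [← pt_up, ← hc]; exact eq_add_down v
      · rw [hc, ← pt_sub_up u w a (b - 1), show b - 1 + 1 = b by omega]
        simp [sub_eq_add_neg]
  · simp only [Grid.jumped, Function.update_apply] at hs
    split_ifs at hs
    · simp [Player.mark] at hs
    · exact hs

theorem Inner.red_jump_tile {f g : Grid} {v c : Pt} {y : Grid × Pt} {u w : ℕ} (hin : Inner f)
    (hg : ∀ s, g s = .black → f s = .black) (hgt : ∀ s ∉ Tile u w, g s = f s)
    (h : GridJump .red c (g, v) y) (hv : v ∈ Tile u w) :
    c ∈ Tile u w ∧ y.2 ∈ Tile u w ∧ (∀ s, y.1 s = .black → f s = .black) ∧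
      ∀ s ∉ Tile u w, y.1 s = f s := by
  have hin' : Inner g := fun s hs => hin s (hg s hs)
  obtain ⟨u', w', a, b, ha, hb, -, rfl, hv', -, h1, h2⟩ := hin'.red_jump h
  have hT : u' = u ∧ w' = w := by
    rcases hv' with ⟨rfl, -⟩ | ⟨rfl, -⟩
    · exact tile_unique ⟨a + 1, b, by omega, by omega, rfl⟩ hv
    · exact tile_unique ⟨a, b + 1, by omega, by omega, rfl⟩ hv
  obtain ⟨rfl, rfl⟩ := hT
  have hc : pt u' w' a b ∈ Tile u' w' := ⟨a, b, by omega, by omega, rfl⟩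
  have hy : y.2 ∈ Tile u' w' := by
    rcases hv' with ⟨-, h⟩ | ⟨-, h⟩
    · exact ⟨a - 1, b, by omega, by omega, h⟩
    · exact ⟨a, b - 1, by omega, by omega, h⟩
  refine ⟨hc, hy, fun s hs => hg s (h1 s hs), fun s hs => ?_⟩
  rw [h2 s (fun h => hs (h ▸ hv)) (fun h => hs (h ▸ hc)) (fun h => hs (h ▸ hy)), hgt s hs]

/-- An iterated jump of a red pawn stays within one cell. -/
theorem Inner.red_jumps {f f' : Grid} {p : Pt} (hin : Inner f)
    (h : (∃ p', Relation.TransGen (fun x y => ∃ c, GridJump .red c x y) (f, p) (f', p')) ∨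
      (∃ (x : ℕ → Grid × Pt) (c : ℕ → Pt), x 0 = (f, p) ∧
        (∀ n, GridJump .red (c n) (x n) (x (n + 1))) ∧
        f' p = .empty ∧ (∀ n, f' (c n) = .empty) ∧
        ∀ t, t ≠ p → (∀ n, t ≠ c n) → f' t = f t)) :
    ∃ c y, GridJump .red c (f, p) y ∧ (f' = y.1 ∨ ∃ c' z, GridJump .red c' y z) ∧
      (∀ s, f' s = .black → f s = .black) ∧
      ∃ u w, p ∈ Tile u w ∧ ∀ s ∉ Tile u w, f' s = f s := by
  have htile : ∀ c y, GridJump .red c (f, p) y → ∃ u w, p ∈ Tile u w := by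
    intro c y hJ
    obtain ⟨u, w, a, b, ha, hb, -, -, ⟨rfl, -⟩ | ⟨rfl, -⟩, -⟩ := hin.red_jump hJ
    · exact ⟨u, w, a + 1, b, by omega, by omega, rfl⟩
    · exact ⟨u, w, a, b + 1, by omega, by omega, rfl⟩
  rcases h with ⟨p', h⟩ | ⟨x, c, hx0, hx, h1, h2, h3⟩
  · obtain ⟨y, ⟨c, hJ⟩, hy⟩ := Relation.TransGen.head'_iff.1 h
    obtain ⟨u, w, hp⟩ := htile c y hJ
    have key : ∀ z, Relation.ReflTransGen (fun x y => ∃ c, GridJump .red c x y) (f, p) z →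
        z.2 ∈ Tile u w ∧ (∀ s, z.1 s = .black → f s = .black) ∧ ∀ s ∉ Tile u w, z.1 s = f s := by
      intro z hz
      induction hz with
      | refl => exact ⟨hp, fun _ h => h, fun _ _ => rfl⟩
      | @tail z z' _ hz ih =>
        obtain ⟨c, hc⟩ := hz
        exact (hin.red_jump_tile ih.2.1 ih.2.2 hc ih.1).2
    have hk := key _ h.to_reflTransGen
    refine ⟨c, y, hJ, ?_, hk.2.1, u, w, hp, hk.2.2⟩
    rcases Relation.ReflTransGen.cases_head hy with rfl | ⟨z, ⟨c', hz⟩, -⟩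
    exacts [.inl rfl, .inr ⟨c', z, hz⟩]
  · obtain ⟨u, w, hp⟩ := htile _ _ (hx0 ▸ hx 0)
    have key : ∀ n, (x n).2 ∈ Tile u w ∧ (∀ s, (x n).1 s = .black → f s = .black) ∧
        ∀ s ∉ Tile u w, (x n).1 s = f s := by
      intro n
      induction n with
      | zero => rw [hx0]; exact ⟨hp, fun _ h => h, fun _ _ => rfl⟩
      | succ n ih => exact (hin.red_jump_tile ih.2.1 ih.2.2 (hx n) ih.1).2
    have hc : ∀ n, c n ∈ Tile u w := fun n =>
      (hin.red_jump_tile (key n).2.1 (key n).2.2 (hx n) (key n).1).1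
    refine ⟨c 0, x 1, hx0 ▸ hx 0, .inr ⟨c 1, x 2, hx 1⟩, fun s hs => ?_, u, w, hp, fun s hs => ?_⟩
    · rw [← h3 s, hs]
      · rintro rfl
        rw [h1] at hs
        cases hs
      · rintro n rfl
        rw [h2] at hs
        cases hs
    · exact h3 s (fun h => hs (h ▸ hp)) fun n h => hs (h ▸ hc n)

/-- After every move of Red one of the two tokens is still released. -/
theorem Twin.red_move {f f' : Grid} {u w i j : ℕ} {ρ : Ordinal.{0}} (hG : Gadget α u w i j ρ)
    (h : Twin α f u w i j) (hm : GridMove .red f f') :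
    Inner f' ∧ (RowOpen α f' u w i j ∨ ColOpen α f' u w i j) := by
  have hk := hG.ok
  obtain ⟨p, hp, ⟨e, he, h1, rfl⟩ | hm⟩ := hm
  · obtain ⟨e', he', hpe⟩ : ∃ e', Player.black.Step e' ∧ p = p + e + e' := by
      rcases he with rfl | rfl
      exacts [⟨(1, 0), .inl rfl, eq_add_left p⟩, ⟨(0, 1), .inr rfl, eq_add_down p⟩]
    have hval : ∀ s, s ≠ p → s ≠ p + e →
        Function.update (Function.update f p .empty) (p + e) Player.red.mark s = f s :=
      fun s h1 h2 => by rw [Function.update_of_ne h2, Function.update_of_ne h1]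
    refine ⟨fun s hs => h.inner s ?_, ?_⟩
    · simp only [Function.update_apply] at hs
      split_ifs at hs
      · simp [Player.mark] at hs
      · exact hs
    -- Only the start and the target of a simple move change; if one of them concerns the first
    -- token, then neither concerns the second.
    by_cases hR : ∃ s ∈ RowSet u w i j, s = p ∨ s = p + e
    · right
      refine h.col.congr hk.2.1 fun s hs => ?_
      obtain ⟨t, ht, htp⟩ := hR
      refine hval s ?_ ?_
      · rintro rfl
        rcases htp with rfl | rfl
        · exact not_mem_colSet hk.1 hk.2.1 ht hs
        · exact h.row.add_not_mem hG ht h1 he' (hpe ▸ hs)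
      · rintro rfl
        rcases htp with rfl | rfl
        · exact h.col.add_not_mem hG hs h1 he' (hpe ▸ ht)
        · exact not_mem_colSet hk.1 hk.2.1 ht hs
    · left
      refine h.row.congr hk.1 fun s hs => hval s ?_ ?_
      · exact fun h => hR ⟨s, hs, .inl h⟩
      · exact fun h => hR ⟨s, hs, .inr h⟩
  · obtain ⟨c, y, hJ, hf', hblack, u', w', hpT, hout⟩ := h.inner.red_jumps hm
    refine ⟨fun s hs => h.inner s (hblack s hs), ?_⟩
    by_cases hT : u' = u ∧ w' = w
    · obtain ⟨rfl, rfl⟩ := hT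
      obtain ⟨u1, w1, a, b, ha, hb, hab, rfl, hv, hy, hy1, hy2⟩ := h.inner.red_jump hJ
      obtain ⟨rfl, rfl⟩ : u1 = u' ∧ w1 = w' := by
        rcases hv with ⟨rfl, -⟩ | ⟨rfl, -⟩
        · exact tile_unique ⟨a + 1, b, by omega, by omega, rfl⟩ hpT
        · exact tile_unique ⟨a, b + 1, by omega, by omega, rfl⟩ hpT
      have hcase := h.black a b (by omega) (by omega) hab
      -- A second capture would need two black pieces whose coordinate sums differ by two, but in
      -- this cell the differences are 3, 4 and 7.
      have hnext : ∀ c z, ¬ GridJump .red c y z := by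
        intro c z hz
        have hin' : Inner y.1 := fun s hs => h.inner s (hy1 s hs)
        obtain ⟨u2, w2, a', b', ha', hb', hab', -, hv', -⟩ := hin'.red_jump hz
        replace hab' := hy1 _ hab'
        obtain ⟨a'', b'', ha'', hb'', hy2', hd⟩ : ∃ a'' b'', a'' < 12 ∧ b'' < 12 ∧
            y.2 = pt u1 w1 a'' b'' ∧ (a'' + 1 = a ∧ b'' = b ∨ a'' = a ∧ b'' + 1 = b) := by
          rcases hv with ⟨-, h⟩ | ⟨-, h⟩
          · exact ⟨a - 1, b, by omega, by omega, h, by omega⟩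
          · exact ⟨a, b - 1, by omega, by omega, h, by omega⟩
        rw [hy2'] at hv'
        rcases hv' with ⟨h1, -⟩ | ⟨h1, -⟩
        · obtain ⟨rfl, rfl, h2, h3⟩ := pt_inj h1 ha'' hb'' (by omega) (by omega)
          have := h.black a' b' (by omega) (by omega) hab'
          omega
        · obtain ⟨rfl, rfl, h2, h3⟩ := pt_inj h1 ha'' hb'' (by omega) (by omega)
          have := h.black a' b' (by omega) (by omega) hab'
          omega
      obtain rfl : f' = y.1 := hf'.resolve_right fun ⟨c, z, hz⟩ => hnext c z hz
      have hfar : ∀ s, s ∈ Region (u1 + 1) w1 ∨ s ∈ Region u1 (w1 + 1) → y.1 s = f s := by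
        refine fun s hs => hout s fun hsT => ?_
        rcases hs with hs | hs <;> have := (mem_region_of_tile hs hsT).le <;> simp only at this <;>
          omega
      -- A capture on row `5 + j` takes the first token and leaves the column alone. The other
      -- captures happen above that row; only a downward capture of the second token would touch it,
      -- and its landing square `(5 + i, 5 + j)` is red.
      by_cases h5 : b = 5 + j
      · right
        refine h.col.congr hk.2.1 ?_
        rintro s (hs | ⟨b', hb', hb'', rfl⟩)
        · exact hfar s (.inr hs)
        · rcases hv with ⟨rfl, h6⟩ | ⟨rfl, h6⟩ <;> rw [h6] at hy2 <;>
            refine hy2 _ ?_ ?_ ?_ <;> rw [Ne, pt_eq_iff] <;> omega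
      · left
        have h7 : ¬ (a = 5 + i ∧ b = 6 + j ∧ y.2 = pt u1 w1 a (b - 1)) := by
          rintro ⟨rfl, rfl, h6⟩
          rw [h6, h.row.2 _ (.inr ⟨5 + i, by omega, by omega, by rw [pt_eq_iff]; omega⟩)
            (by rw [Ne, pt_eq_iff]; omega), baseGrid_pt (by omega) (by omega),
            hG.content_red (by simp only [EndRoad]; omega) (by omega)] at hy
          cases hy
        refine h.row.congr hk.1 ?_
        rintro s (hs | ⟨a', ha', ha'', rfl⟩)
        · exact hfar s (.inl hs)
        · rcases hv with ⟨rfl, h6⟩ | ⟨rfl, h6⟩ <;> rw [h6] at hy2 h7 <;>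
            refine hy2 _ ?_ ?_ ?_ <;> rw [Ne, pt_eq_iff] <;>
            rw [pt_eq_iff] at h7 <;> omega
    -- A jump in another cell changes that cell only, and no cell descends from both `(u + 1, w)`
    -- and `(u, w + 1)`.
    · by_cases hR : Reach (u + 1, w) (u', w')
      · right
        refine h.col.congr hk.2.1 fun s hs => hout s fun hsT => ?_
        rcases hs with hs | ⟨b, hb, hb', rfl⟩
        · obtain ⟨a, b, ha, hb, rfl⟩ := hsT
          exact region_disjoint ((pt_mem_region ha hb).2 hR) hs
        · have := tile_unique hsT ⟨5 + i, b, by omega, hb', rfl⟩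
          exact hT this
      · left
        refine h.row.congr hk.1 fun s hs => hout s fun hsT => ?_
        rcases hs with hs | ⟨a, ha, ha', rfl⟩
        · exact hR (mem_region_of_tile hs hsT)
        · have := tile_unique hsT ⟨a, 5 + j, ha', by omega, rfl⟩
          exact hT this

/-! ### The lower bound and the conclusion -/

/-- If a token of an exit of rank `ρ` is released, then the value is at least `ρ`. -/
theorem le_of_valueAtMost (hα : α.card ≤ Cardinal.aleph0) (ρ : Ordinal.{0}) :
    ∀ (f : Grid) (u w i j : ℕ) (β : Ordinal.{0}), Gadget α u w i j ρ → Inner f →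
      RowOpen α f u w i j ∨ ColOpen α f u w i j →
      (noForcedJumpDraughts .red).ValueAtMost (f.toPosition .black) β → ρ ≤ β := by
  induction ρ using WellFoundedLT.induction with
  | _ ρ ih =>
  intro f u w i j β hG hin ho hv
  -- If the value were at most some `β < ρ`, Black would run to an exit of rank exactly `β`; Red's
  -- answer would then have a value below `β` although a token of rank `β` is still released.
  by_contra hlt
  rw [not_le] at hlt
  have hk := hG.ok
  obtain ⟨g, u', w', i', j', hm, hG', hT⟩ :=
    exists_twin hG ((Ordinal.card_le_card hk.2.2.1).trans hα) hlt hin ho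
  have hlegal : LegalMove (f.toPosition .black) (g.toPosition .red) :=
    legalMove_iff.2 ⟨g, hm, rfl⟩
  have hg : (noForcedJumpDraughts .red).ValueAtMost (g.toPosition .red) β := by
    cases hv with
    | won h => exact absurd hlegal (h.2 _)
    | openMove h => cases h
    | closedMove _ h => exact h _ hlegal
  cases hg with
  | won h => exact h.1 rfl
  | closedMove h => exact h rfl
  | openMove _ hmove hq hβ =>
    obtain ⟨f', hf', rfl⟩ := legalMove_iff.1 hmove
    obtain ⟨hin', ho'⟩ := hT.red_move hG' hf'
    exact absurd (ih β hlt f' u' w' i' j' _ hG' hin' ho' hq) (not_le.2 hβ)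

/-- On the base grid all guard squares of all tokens are red, so removing one red pawn frees exactly
one token. Applied at the root this gives the initial position. -/
theorem Gadget.alive_update {u w i j : ℕ} {ρ : Ordinal.{0}} (hG : Gadget α u w i j ρ) :
    Alive α (Function.update (baseGrid α) (pt u w (4 + i) (5 + j)) .empty) u w i j ρ := by
  have hk := hG.ok
  have hval : ∀ s, s ≠ pt u w (4 + i) (5 + j) →
      Function.update (baseGrid α) (pt u w (4 + i) (5 + j)) .empty s = baseGrid α s :=
    fun s hs => Function.update_of_ne hs _ _
  have hneg : ∀ k : ℤ, k < 0 → (k, 0) ≠ pt u w (4 + i) (5 + j) := by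
    intro k hk h
    have := congrArg Prod.fst h
    simp only [pt] at this
    omega
  refine ⟨hG, ⟨fun s hs => ?_, ?_, ?_⟩, ?_, fun s _ hs => hval s hs, by simp, ?_⟩
  · right
    rw [← hval s, hs]
    rintro rfl
    simp at hs
  · rw [hval _ (hneg _ (by norm_num))]
    simp [baseGrid]
  · rw [hval _ (hneg _ (by norm_num))]
    simp [baseGrid]
  · intro t s ht _ hg hs
    have htb : baseGrid α t = .black := by
      rw [← hval t, ht]
      rintro rfl
      simp at ht
    rw [hval s hs]
    obtain ⟨u', w', a, b, ha, hb, rfl, i', j', ρ', hG', hT⟩ := baseGrid_eq_black htb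
    have hk' := hG'.ok
    rw [guardOf_iff] at hg
    rcases hT with ⟨rfl, rfl⟩ | ⟨rfl, rfl⟩ <;> rcases hg with rfl | rfl | rfl | rfl
    all_goals
      rw [baseGrid_pt (by omega) (by omega), hG'.content_red]
      · simp
      · simp only [EndRoad]; omega
      · omega
  · rw [hval _ (by rw [Ne, pt_eq_iff]; omega), baseGrid_pt (by omega) (by omega)]
    exact hG.content_empty (.inl (.inr (.inl ⟨rfl, .inl rfl⟩)))

end InfiniteDraughts

theorem theorem3 (α : Ordinal.{0}) (hα : α.card ≤ Cardinal.aleph0) :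
    ∃ p : InfiniteDraughts.Position,
      (InfiniteDraughts.noForcedJumpDraughts InfiniteDraughts.Player.red).HasGameValue p α := by
  have hG : InfiniteDraughts.Gadget α 4 2 0 0 α :=
    ⟨InfiniteDraughts.cellState_root, InfiniteDraughts.goesR_root, InfiniteDraughts.goesU_root⟩
  have hA := hG.alive_update
  obtain ⟨γ, hγ⟩ := hA.exists_valueAtMost
  obtain ⟨β, -, hβ⟩ := hγ.exists_value
  -- The position constructed has some value `β ≥ α`, so `α` occurs as the value of a possibly
  -- different position.
  refine hβ.exists_of_le (InfiniteDraughts.le_of_valueAtMost hα α _ 4 2 0 0 β hG ?_ (.inl ?_) hβ.1)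
  · intro s hs
    refine InfiniteDraughts.inner_baseGrid (α := α) s ?_
    exact (hA.calm.black s hs).resolve_left (by simp)
  · exact ⟨hA.release, fun s _ hne => Function.update_of_ne hne _ _⟩
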